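/- Let $A$ be a Dedekind domain whose fraction field $k$ is a global field, let $K$ be a finitely generated field (over its prime field), let $K^{\mathrm{sep}}$ be its separable closure in an algebraic closure $\bar K$, and put $G_K=\mathrm{Gal}(K^{\mathrm{sep}}/K)$. Let $r\ge 1$. A $(G_K,A)$-module of rank $r$ is an $A$-module $M$ with an additive action of $G_K$ that commutes with the action of $A$, such that for every non-zero ideal $\mathfrak a\subset A$ the torsion submodule $M[\mathfrak a]=\{x\in M: ax=0 \text{ for all } a\in\mathfrak a\}$ is isomorphic to $(A/\mathfrak a)^r$ as an $A$-module. Write $I(\mathfrak a)$ for the index of the image of $\rho_{\mathfrak a}:G_K\to \mathrm{Aut}_A(M[\mathfrak a])\cong \mathrm{GL}_r(A/\mathfrak a)$, and put $M[\mathfrak p^\infty]=\bigcup_{n\ge1}M[\mathfrak p^n]$ and $M_{\mathrm{tor}}=\bigcup_{\mathfrak a\neq 0}M[\mathfrak a]$. For a subset $H\subset M$ and a finite extension $L/K$ inside $\bar K$ let $H(L)$ be the set of elements of $H$ fixed by the absolute Galois group of $L$ (that is, by all $\sigma\in G_K$ that are trivial on $L\cap K^{\mathrm{sep}}$). (I)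 For every real number $C_{\mathfrak p}$ there is a constant $C>0$, depending only on $A$, $K$, $r$ and $C_{\mathfrak p}$, such that for every $(G_K,A)$-module $M$ of rank $r$ and every non-zero prime ideal $\mathfrak p\subset A$ with $I(\mathfrak p^n)\le C_{\mathfrak p}$ for all $n\geq 1$, and for every finite extension $L/K$, the set $M[\mathfrak p^\infty](L)$ is finite and $$|M[\mathfrak p^\infty](L)|\le C\,[L:K]^{1/r}.$$ (II) For every real number $C_0$ there is a constant $C>0$, depending only on $A$, $K$, $r$ and $C_0$, such that for every $(G_K,A)$-module $M$ of rank $r$ with $I(\mathfrak a)\le C_0$ for all non-zero ideals $\mathfrak a\subset A$, and for every finite extension $L/K$, the set $M_{\mathrm{tor}}(L)$ is finite and $$|M_{\mathrm{tor}}(L)|\le C\big([L:K]\,\log\log \max([L:K],3)\big)^{1/r}.$$ Moreover, these bounds are asymptotically optimal. Suppose in addition that the action of $G_K$ on the torsion of $M$ is continuous (every torsion element of $M$ has an open stabilizer in $G_K$). Then under the hypotheses of (I) there are a constant $c>0$ and a tower $L_0\subset L_1\subset L_2\subset\cdots\subset\bar K$ of finite extensions of $K$ with $[L_n:K]\to\infty$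 such that $|M[\mathfrak p^\infty](L_n)|\ge c\,[L_n:K]^{1/r}$ for all $n$. Under the hypotheses of (II), if moreover $A$ is finitely generated as a ring (that is, $A$ is the ring of $S$-integers of $k$ for a finite non-empty set $S$ of places containing the archimedean ones), there are a constant $c>0$ and such a tower with $|M_{\mathrm{tor}}(L_n)|\ge c\big([L_n:K]\log\log\max([L_n:K],3)\big)^{1/r}$ for all $n$. -/

import Mathlib

open Filter

universe u v w x

/-- A global field: a number field, or a finite extension of `𝔽_p(t)` for some prime `p`. -/
def IsGlobalField (k : Type v) [Field k] : Prop :=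
  NumberField k ∨
    ∃ p : ℕ, ∃ _ : Fact p.Prime, ∃ _ : Algebra (RatFunc (ZMod p)) k,
      FiniteDimensional (RatFunc (ZMod p)) k

/-- A finitely generated field, that is, finitely generated over its prime field. -/
def IsFinitelyGeneratedField (K : Type w) [Field K] : Prop :=
  ∃ s : Finset K, Subfield.closure (s : Set K) = ⊤

/-- The absolute Galois group `Gal(K^sep / K)`, where `K^sep` is the separable closure of `K` in
`AlgebraicClosure K`. It carries the Krull topology. -/
abbrev AbsGal (K : Type w) [Field K] : Type w :=
  SeparableClosure K ≃ₐ[K] SeparableClosure K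

section

variable (A : Type u) [CommRing A] (M : Type x) [AddCommGroup M] [Module A M]

/-- The `𝔞`-torsion submodule `M[𝔞]` of `M`. -/
abbrev idealTorsion (𝔞 : Ideal A) : Submodule A M :=
  Submodule.torsionBySet A M (𝔞 : Set A)

/-- The `𝔞`-power torsion `M[𝔞^∞]`: the union of the `M[𝔞 ^ n]` for `n ≥ 1`. -/
def idealPowerTorsion (𝔞 : Ideal A) : Set M :=
  {x | ∃ n : ℕ, 1 ≤ n ∧ x ∈ idealTorsion A M (𝔞 ^ n)}

/-- The full torsion `M_tor`: the union of the `M[𝔞]` over all non-zero ideals `𝔞`. -/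
def fullTorsion : Set M :=
  {x | ∃ 𝔞 : Ideal A, 𝔞 ≠ ⊥ ∧ x ∈ idealTorsion A M 𝔞}

/-- `M[𝔞] ≅ (A/𝔞)^r` as `A`-modules, for every non-zero ideal `𝔞`. An `A`-module `M` with an additive
action of `G_K` that commutes with the action of `A` (`SMulCommClass (AbsGal K) A M`) is called a
`(G_K, A)`-module of rank `r` if this holds. -/
def HasTorsionRank (r : ℕ) : Prop :=
  ∀ 𝔞 : Ideal A, 𝔞 ≠ ⊥ → Nonempty (idealTorsion A M 𝔞 ≃ₗ[A] (Fin r → A ⧸ 𝔞))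

end

section

variable (K : Type w) [Field K] (A : Type u) [CommRing A]
  (M : Type x) [AddCommGroup M] [Module A M] [DistribMulAction (AbsGal K) M]

variable {A M} in
theorem smul_mem_idealTorsion [SMulCommClass (AbsGal K) A M] {𝔞 : Ideal A} (σ : AbsGal K) {y : M}
    (hy : y ∈ idealTorsion A M 𝔞) : σ • y ∈ idealTorsion A M 𝔞 := by
  rw [Submodule.mem_torsionBySet_iff] at hy ⊢
  intro a
  rw [← smul_comm, hy a, smul_zero]

/-- The Galois representation `ρ_𝔞 : G_K → Aut_A(M[𝔞])`, `σ ↦ (y ↦ σ • y)`. -/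
noncomputable def galoisRep [SMulCommClass (AbsGal K) A M] (𝔞 : Ideal A) :
    AbsGal K →* (idealTorsion A M 𝔞 ≃ₗ[A] idealTorsion A M 𝔞) where
  toFun σ :=
    { toFun := fun y => ⟨σ • (y : M), smul_mem_idealTorsion K σ y.2⟩
      invFun := fun y => ⟨σ⁻¹ • (y : M), smul_mem_idealTorsion K σ⁻¹ y.2⟩
      map_add' := fun y z => Subtype.ext (smul_add σ (y : M) (z : M))
      map_smul' := fun a y => Subtype.ext (smul_comm σ a (y : M))
      left_inv := fun y => Subtype.ext (inv_smul_smul σ (y : M))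
      right_inv := fun y => Subtype.ext (smul_inv_smul σ (y : M)) }
  map_one' := by
    ext y
    exact one_smul (AbsGal K) (y : M)
  map_mul' σ τ := by
    ext y
    exact mul_smul σ τ (y : M)

/-- The index `I(𝔞)` of the image of `ρ_𝔞` in `Aut_A(M[𝔞])`. -/
noncomputable def galoisIndex [SMulCommClass (AbsGal K) A M] (𝔞 : Ideal A) : ℕ :=
  (galoisRep K A M 𝔞).range.index

/-- The action of `G_K` on the torsion of `M` is continuous for the discrete topology: every torsion
element has an open stabilizer. -/
def IsContinuousOnTorsion : Prop :=
  ∀ y ∈ fullTorsion A M, IsOpen (MulAction.stabilizer (AbsGal K) y : Set (AbsGal K))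

variable {K M} in
/-- The set `H(L)` of the elements of `H` that are fixed by the absolute Galois group of `L`, for
an extension `L` of `K` in `AlgebraicClosure K`. That group is identified with its image in
`Gal(K^sep / K)`, the group of all `σ` that fix `L ∩ K^sep` pointwise (and `L ∩ K^sep = L` if `L / K`
is separable). -/
def rationalPoints (H : Set M) (L : IntermediateField K (AlgebraicClosure K)) : Set M :=
  {y ∈ H | ∀ σ : AbsGal K,
    (∀ z : SeparableClosure K, (z : AlgebraicClosure K) ∈ L → σ z = z) → σ • y = y}

end

section

variable {K : Type w} [Field K]

/-- An increasing sequence of finite extensions of `K` whose degrees tend to infinity. -/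
structure IsTower (L : ℕ → IntermediateField K (AlgebraicClosure K)) : Prop where
  mono : Monotone L
  finite : ∀ n, FiniteDimensional K (L n)
  degree : Tendsto (fun n => Module.finrank K (L n)) atTop atTop

/-- `[L:K]` as a real number. -/
noncomputable def deg (L : IntermediateField K (AlgebraicClosure K)) : ℝ :=
  (Module.finrank K L : ℝ)

/-- `log log d`, with `d` replaced by `3` where `d < 3`, so that the value is defined and
positive. -/
noncomputable def logLog (d : ℝ) : ℝ := Real.log (Real.log (max d 3))

end

/-! Upper bounds. Put `H = M[𝔞](L)`. The image of `G_L` in `Aut(M[𝔞])` fixes `H` pointwise and has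
index at most `I(𝔞)[L:K]`. An automorphism `g` fixing `H` is determined by `g - 1`, which factors
through `M[𝔞]/H`; as `|Hom(Q, A/𝔞)| ≤ |Q|` for every finite module `Q`, there are at most
`|M[𝔞]/H|^r` such `g`. On the other hand `|GL_r(A/𝔞)|` is `|A/𝔞|^(r²)` times the product, over the
primes `𝔭 ∣ 𝔞`, of the densities `∏_{i=1}^r (1 - N𝔭^(-i))`. Dividing, `|H|^r` times the product of
the densities is at most `I(𝔞)[L:K]`; this is `ncard_pow_mul_prod_glDensity_le`.

For `𝔞 = 𝔭^n` there is a single density, bounded below in terms of `r` alone, and (I) follows. For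
(II), `𝔞` is replaced by the annihilator of `H`. Then the norms of the primes dividing it have
product at most `|H|`, so by Mertens' theorem the densities multiply to at least a constant times `1
/ log log |H|`, and the resulting inequality is solved for `|H|`.

Optimality. Take `L = K(M[𝔞])`, whose degree is at most `|GL_r(A/𝔞)|` and over which all `|A/𝔞|^r`
points of `M[𝔞]` are rational. Powers of `𝔭` serve for (I). For (II), `𝔞` is the product of all
primes of norm at most `n`: the densities then multiply to at most a constant times `1 / log n`, and
`log log [L:K]` is at most a constant times `log n`.

Mertens' theorem for `A` comes from a smaller Dedekind domain `B` with the same fraction field: the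
ring of integers of a number field, or the integral closure of `F[y]` for a separating `y` in `A`.
The ideals of `B` have a linear counting function, so its zeta function has a simple pole at `1`,
which determines `∑ 1/N𝔭` up to a bounded error. The primes of `A` inject into those of `B` with the
same norms, and miss only finitely many when `A` is finitely generated. -/

set_option linter.unusedSectionVars false

/-! ### Dirichlet series of families with linear counting function -/

section LinearCounting

open scoped ENNReal Topology

theorem rpow_neg_eq_tsum_sub {s : ℝ} (hs : 0 < s) {n : ℕ} (hn : 1 ≤ n) :
    ENNReal.ofReal ((n : ℝ) ^ (-s)) =
      ∑' m : ℕ, if n ≤ m then ENNReal.ofReal ((m : ℝ) ^ (-s) - ((m + 1 : ℕ) : ℝ) ^ (-s)) else 0 := by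
  have hanti : ∀ a : ℕ, 1 ≤ a → ((a + 1 : ℕ) : ℝ) ^ (-s) ≤ (a : ℝ) ^ (-s) := fun a ha =>
    Real.rpow_le_rpow_of_nonpos (by positivity) (by push_cast; linarith) (by linarith)
  have hsum : HasSum (fun m : ℕ => ((n + m : ℕ) : ℝ) ^ (-s) - ((n + m + 1 : ℕ) : ℝ) ^ (-s))
      ((n : ℝ) ^ (-s)) := by
    rw [hasSum_iff_tendsto_nat_of_nonneg fun m => sub_nonneg.2 (hanti _ (by omega))]
    have htel : ∀ k : ℕ, ∑ m ∈ Finset.range k,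
        (((n + m : ℕ) : ℝ) ^ (-s) - ((n + m + 1 : ℕ) : ℝ) ^ (-s)) =
          (n : ℝ) ^ (-s) - ((n + k : ℕ) : ℝ) ^ (-s) := fun k => by
      induction k with
      | zero => simp
      | succ k ih => rw [Finset.sum_range_succ, ih]; simp [add_assoc]
    simp_rw [htel]
    have h0 : Tendsto (fun k : ℕ => ((n + k : ℕ) : ℝ) ^ (-s)) atTop (𝓝 0) :=
      (tendsto_rpow_neg_atTop hs).comp
        (tendsto_natCast_atTop_atTop.comp (tendsto_add_atTop_nat n |>.congr fun k => add_comm k n))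
    simpa using tendsto_const_nhds.sub h0
  rw [← hsum.tsum_eq, ENNReal.ofReal_tsum_of_nonneg
    (fun m => sub_nonneg.2 (hanti _ (by omega))) hsum.summable]
  refine Eq.symm (tsum_eq_tsum_of_ne_zero_bij (fun m => n + m.1) (fun a b h => ?_) (fun m hm => ?_)
    fun m => ?_)
  · simpa [Subtype.ext_iff] using h
  · rw [Function.mem_support] at hm
    have hnm : n ≤ m := by
      by_contra h
      exact hm (if_neg h)
    rw [if_pos hnm] at hm
    exact ⟨⟨m - n, by rw [Function.mem_support, Nat.add_sub_cancel' hnm]; exact hm⟩,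
      Nat.add_sub_cancel' hnm⟩
  · simp

variable {ι : Type*} (f : ι → ℕ)

/-- Abel summation: each term is a telescoping sum over `m ≥ f i`, and the two sums are exchanged.
In `ℝ≥0∞` no convergence has to be known. The weights do not depend on `f` and are non-negative for
`m ≥ 1`, so comparing counting functions compares the series. -/
theorem tsum_rpow_neg_eq_tsum_mul_encard (hf : ∀ i, 1 ≤ f i) {s : ℝ} (hs : 0 < s) :
    ∑' i, ENNReal.ofReal ((f i : ℝ) ^ (-s)) =
      ∑' m : ℕ, ENNReal.ofReal ((m : ℝ) ^ (-s) - ((m + 1 : ℕ) : ℝ) ^ (-s)) *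
        ({i | f i ≤ m}.encard : ℝ≥0∞) := by
  simp_rw [fun i => rpow_neg_eq_tsum_sub hs (hf i)]
  rw [ENNReal.tsum_comm]
  refine tsum_congr fun m => ?_
  rw [← ENNReal.tsum_set_one, ← ENNReal.tsum_mul_left, tsum_subtype {i | f i ≤ m} fun _ =>
    ENNReal.ofReal ((m : ℝ) ^ (-s) - ((m + 1 : ℕ) : ℝ) ^ (-s)) * 1]
  refine tsum_congr fun i => ?_
  simp [Set.indicator_apply]

/-- `f` takes every value at least `1`, finitely often, and the number of indices at which its value
is at most `n` grows linearly with `n`. -/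
structure HasLinearCount : Prop where
  one_le : ∀ i, 1 ≤ f i
  finite : ∀ n : ℕ, {i | f i ≤ n}.Finite
  lower : ∃ c : ℝ, 0 < c ∧ ∀ n : ℕ, 1 ≤ n → c * n ≤ ({i | f i ≤ n}.ncard : ℝ)
  upper : ∃ C : ℝ, 0 < C ∧ ∀ n : ℕ, 1 ≤ n → ({i | f i ≤ n}.ncard : ℝ) ≤ C * n

theorem tsum_rpow_neg_le_mul_of_ncard_le {κ : Type*} {g : κ → ℕ} {C : ℝ} (hC : 0 ≤ C)
    (hf : ∀ i, 1 ≤ f i) (hg : ∀ i, 1 ≤ g i)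
    (hff : ∀ n : ℕ, {i | f i ≤ n}.Finite) (hgf : ∀ n : ℕ, {i | g i ≤ n}.Finite)
    (h : ∀ n : ℕ, 1 ≤ n → ({i | f i ≤ n}.ncard : ℝ) ≤ C * ({i | g i ≤ n}.ncard : ℝ))
    {s : ℝ} (hs : 0 < s) :
    ∑' i, ENNReal.ofReal ((f i : ℝ) ^ (-s)) ≤
      ENNReal.ofReal C * ∑' i, ENNReal.ofReal ((g i : ℝ) ^ (-s)) := by
  rw [tsum_rpow_neg_eq_tsum_mul_encard f hf hs, tsum_rpow_neg_eq_tsum_mul_encard g hg hs,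
    ← ENNReal.tsum_mul_left]
  refine ENNReal.tsum_le_tsum fun m => ?_
  rw [mul_left_comm]
  gcongr
  rcases Nat.eq_zero_or_pos m with rfl | hm
  · have : {i | f i ≤ 0} = ∅ := by
      ext i
      have := hf i
      exact iff_of_false (fun h' : f i ≤ 0 => by omega) id
    rw [this]; simp
  rw [← (hff m).cast_ncard_eq, ← (hgf m).cast_ncard_eq]
  have := ENNReal.ofReal_le_ofReal (h m hm)
  rw [ENNReal.ofReal_mul hC] at this
  simpa using this

variable {f}

theorem hasLinearCount_succ : HasLinearCount fun n : ℕ => n + 1 := by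
  have h : ∀ n : ℕ, {i : ℕ | i + 1 ≤ n} = Finset.range n := fun n => by
    ext i; simp
  refine ⟨fun i => by omega, fun n => ?_, ⟨1, one_pos, fun n _ => ?_⟩, ⟨1, one_pos, fun n _ => ?_⟩⟩
  · rw [h]; exact Finset.finite_toSet _
  · rw [h, Set.ncard_coe_finset]; simp
  · rw [h, Set.ncard_coe_finset]; simp

theorem summable_succ_rpow_neg {s : ℝ} (hs : 1 < s) :
    Summable fun n : ℕ => ((n + 1 : ℕ) : ℝ) ^ (-s) :=
  (summable_nat_add_iff 1).2 (Real.summable_nat_rpow.2 (by linarith))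

theorem HasLinearCount.summable (hf : HasLinearCount f) {s : ℝ} (hs : 1 < s) :
    Summable fun i => (f i : ℝ) ^ (-s) := by
  obtain ⟨C, hC, h⟩ := hf.upper
  have key := tsum_rpow_neg_le_mul_of_ncard_le f (g := fun n : ℕ => n + 1) hC.le hf.one_le
    hasLinearCount_succ.one_le hf.finite hasLinearCount_succ.finite (fun n hn => by
      have h' : {i : ℕ | i + 1 ≤ n} = Finset.range n := by ext i; simp
      rw [h', Set.ncard_coe_finset, Finset.card_range]
      exact h n hn) (s := s) (by linarith)
  have hfin : ∑' i, ENNReal.ofReal ((f i : ℝ) ^ (-s)) ≠ ⊤ := by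
    refine ne_top_of_le_ne_top ?_ key
    rw [← ENNReal.ofReal_tsum_of_nonneg (fun n => by positivity) (summable_succ_rpow_neg hs)]
    exact ENNReal.mul_ne_top ENNReal.ofReal_ne_top ENNReal.ofReal_ne_top
  refine (ENNReal.summable_toReal hfin).congr fun i => ?_
  rw [ENNReal.toReal_ofReal (by positivity)]

/-- The point is that `C` is independent of `s`, so the comparison survives as `s` tends to `1`. -/
theorem tsum_rpow_neg_le_mul {κ : Type*} {g : κ → ℕ} (hf : HasLinearCount f)
    (hg : HasLinearCount g) :
    ∃ C : ℝ, 0 < C ∧ ∀ s : ℝ, 1 < s →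
      ∑' i, (f i : ℝ) ^ (-s) ≤ C * ∑' i, (g i : ℝ) ^ (-s) := by
  obtain ⟨C, hC, h⟩ := hf.upper
  obtain ⟨c, hc, h'⟩ := hg.lower
  refine ⟨C / c, by positivity, fun s hs => ?_⟩
  have key := tsum_rpow_neg_le_mul_of_ncard_le f (g := g) (C := C / c) (by positivity) hf.one_le
    hg.one_le hf.finite hg.finite (fun n hn => by
      have h1 := h n hn
      have h2 := h' n hn
      calc _ ≤ C * n := h1
        _ = C / c * (c * n) := by field_simp
        _ ≤ _ := by gcongr) (s := s) (by linarith)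
  rw [← ENNReal.ofReal_tsum_of_nonneg (fun n => by positivity) (hf.summable hs),
    ← ENNReal.ofReal_tsum_of_nonneg (fun n => by positivity) (hg.summable hs),
    ← ENNReal.ofReal_mul (by positivity)] at key
  exact (ENNReal.ofReal_le_ofReal_iff
    (mul_nonneg (by positivity) (tsum_nonneg fun i => by positivity))).1 key

/-- The zeta function of a family with linear counting function has a simple pole at `1`. -/
theorem HasLinearCount.exists_tsum_bounds (hf : HasLinearCount f) :
    ∃ a b δ₀ : ℝ, 0 < a ∧ 0 < b ∧ 0 < δ₀ ∧ ∀ δ : ℝ, 0 < δ → δ ≤ δ₀ →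
      a / δ ≤ ∑' i, (f i : ℝ) ^ (-(1 + δ)) ∧ ∑' i, (f i : ℝ) ^ (-(1 + δ)) ≤ b / δ := by
  obtain ⟨C, hC, h⟩ := tsum_rpow_neg_le_mul hf hasLinearCount_succ
  obtain ⟨D, hD, h'⟩ := tsum_rpow_neg_le_mul hasLinearCount_succ hf
  -- The comparison family is the positive integers, where `(s - 1) ζ(s)` tends to `1`.
  have hlim := tendsto_sub_mul_tsum_nat_rpow.eventually
    (Icc_mem_nhds (show (1 / 2 : ℝ) < 1 by norm_num) (show (1 : ℝ) < 2 by norm_num))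
  obtain ⟨u, hu, hu'⟩ := mem_nhdsGT_iff_exists_Ioc_subset.1 hlim
  refine ⟨1 / (2 * D), 2 * C, u - 1, by positivity, by positivity, sub_pos.2 hu,
    fun δ hδ hδ' => ?_⟩
  have h1 : 1 < 1 + δ := by linarith
  have hz : ∑' n : ℕ, 1 / (n : ℝ) ^ (1 + δ) = ∑' n : ℕ, ((n + 1 : ℕ) : ℝ) ^ (-(1 + δ)) := by
    rw [(Real.summable_one_div_nat_rpow.2 h1).tsum_eq_zero_add]
    simp only [Nat.cast_zero, Real.zero_rpow (by linarith : (1 + δ) ≠ 0), div_zero, zero_add]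
    exact tsum_congr fun n => by rw [Real.rpow_neg (by positivity), one_div]
  have := hu' (show 1 + δ ∈ Set.Ioc 1 u from ⟨h1, by linarith⟩)
  simp only [Set.mem_ofPred_eq, add_sub_cancel_left, hz] at this
  have e1 := h _ h1
  have e2 := h' _ h1
  set Z := ∑' i, (f i : ℝ) ^ (-(1 + δ))
  set z := ∑' n : ℕ, ((n + 1 : ℕ) : ℝ) ^ (-(1 + δ))
  constructor
  · rw [div_le_iff₀ hδ, div_le_iff₀ (by positivity)]
    nlinarith [this.1, mul_le_mul_of_nonneg_left e2 hδ.le]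
  · rw [le_div_iff₀ hδ]
    nlinarith [this.2, mul_le_mul_of_nonneg_left e1 hδ.le]

end LinearCounting

/-! ### Mertens' second theorem from a simple pole -/

section MertensFromPole

open scoped Topology

variable {π : Type*} {q : π → ℕ}

/-- Used with `t = q ^ (-δ)`, where `t` and `t * (1 - t)`, divided by `q`, are the terms of `P δ`
and of `P δ - P (2 * δ)`. No Tauberian theorem is needed: the sharp cutoff at `q ≤ x` is dominated
by these two series. -/
theorem mertens_pointwise_upper {t : ℝ} (h : Real.exp (-1) ≤ t) (h1 : t ≤ 1) :
    1 ≤ t + Real.exp 1 * (t * (1 - t)) := by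
  have h2 : 1 ≤ Real.exp 1 * t := by
    calc (1 : ℝ) = Real.exp 1 * Real.exp (-1) := by rw [← Real.exp_add]; simp
      _ ≤ _ := by gcongr
  nlinarith [mul_nonneg (sub_nonneg.2 h2) (sub_nonneg.2 h1)]

theorem mertens_pointwise_lower {t : ℝ} (h : t ≤ Real.exp (-1)) (h0 : 0 ≤ t) :
    t ≤ 2 * (t * (1 - t)) := by
  have : Real.exp (-1) ≤ 1 / 2 := by
    rw [Real.exp_neg, ← one_div]
    exact one_div_le_one_div_of_le two_pos (by linarith [Real.exp_one_gt_d9])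
  nlinarith

/-- **Mertens' second theorem** from the behaviour of `∑ q⁻¹⁻ᵟ` as `δ` tends to `0`. -/
theorem exists_mertens_of_tsum_bounds (hq : ∀ p, 2 ≤ q p) (hfin : ∀ n : ℕ, {p | q p ≤ n}.Finite)
    (hsum : ∀ δ : ℝ, 0 < δ → Summable fun p => (q p : ℝ) ^ (-(1 + δ)))
    (hP : ∃ K δ₀ : ℝ, 0 < δ₀ ∧ ∀ δ : ℝ, 0 < δ → δ ≤ δ₀ →
      |∑' p, (q p : ℝ) ^ (-(1 + δ)) - Real.log (1 / δ)| ≤ K) :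
    ∃ C : ℝ, (∀ x : ℝ, 3 ≤ x → ∀ S : Finset π, (∀ p ∈ S, (q p : ℝ) ≤ x) →
        ∑ p ∈ S, (1 / q p : ℝ) ≤ Real.log (Real.log x) + C) ∧
      ∀ n : ℕ, 3 ≤ n →
        Real.log (Real.log n) - C ≤ ∑ p ∈ (hfin n).toFinset, (1 / q p : ℝ) := by
  obtain ⟨K, δ₀, hδ₀, hP⟩ := hP
  set P : ℝ → ℝ := fun δ => ∑' p, (q p : ℝ) ^ (-(1 + δ)) with hPdef
  have hqpos : ∀ p, (0 : ℝ) < q p := fun p => by have := hq p; positivity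
  have hsplit : ∀ p (δ : ℝ), (q p : ℝ) ^ (-(1 + δ)) = 1 / q p * (q p : ℝ) ^ (-δ) := fun p δ => by
    rw [neg_add, Real.rpow_add (hqpos p), Real.rpow_neg_one, one_div]
  have hsplit2 : ∀ p (δ : ℝ), (q p : ℝ) ^ (-(1 + δ)) - (q p : ℝ) ^ (-(1 + 2 * δ)) =
      1 / q p * ((q p : ℝ) ^ (-δ) * (1 - (q p : ℝ) ^ (-δ))) := fun p δ => by
    have : (q p : ℝ) ^ (-(2 * δ)) = (q p : ℝ) ^ (-δ) * (q p : ℝ) ^ (-δ) := by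
      rw [← Real.rpow_add (hqpos p)]; ring_nf
    rw [hsplit, hsplit, this]; ring
  have ht1 : ∀ p (δ : ℝ), 0 < δ → (q p : ℝ) ^ (-δ) ≤ 1 := fun p δ hδ =>
    Real.rpow_le_one_of_one_le_of_nonpos (by have := hq p; exact_mod_cast (by omega : 1 ≤ q p))
      (by linarith)
  -- The two logarithmic main terms differ by the constant `log 2`, so the difference of the series
  -- stays bounded.
  have hdiff : ∀ δ : ℝ, 0 < δ → 2 * δ ≤ δ₀ → P δ - P (2 * δ) ≤ 2 * K + Real.log 2 := by
    intro δ hδ h2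
    have a1 := abs_le.1 (hP δ hδ (by linarith))
    have a2 := abs_le.1 (hP (2 * δ) (by linarith) h2)
    have : Real.log (1 / δ) - Real.log (1 / (2 * δ)) = Real.log 2 := by
      rw [← Real.log_div (by positivity) (by positivity)]
      congr 1
      field_simp
    simp only [hPdef]
    linarith [a1.2, a2.1]
  -- the estimate for a finite set, in terms of the Dirichlet series
  have hup : ∀ x : ℝ, 1 < x → 2 * (1 / Real.log x) ≤ δ₀ → ∀ S : Finset π,
      (∀ p ∈ S, (q p : ℝ) ≤ x) → ∑ p ∈ S, (1 / q p : ℝ) ≤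
        Real.log (Real.log x) + (K + Real.exp 1 * (2 * K + Real.log 2)) := by
    intro x hx hx0 S hS
    have hlx : 0 < Real.log x := Real.log_pos hx
    -- With this `δ` the main term `log (1 / δ)` is `log log x`, and `q ≤ x` means `q ^ (-δ) ≥ exp
    -- (-1)`.
    set δ := 1 / Real.log x with hδdef
    have hδ : 0 < δ := by positivity
    have hsd := (hsum δ hδ).sub (hsum (2 * δ) (by linarith))
    have hnn : ∀ p, 0 ≤ (q p : ℝ) ^ (-(1 + δ)) - (q p : ℝ) ^ (-(1 + 2 * δ)) := fun p => by
      rw [hsplit2]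
      have := ht1 p δ hδ
      have := sub_nonneg.2 this
      have := hqpos p
      positivity
    have hterm : ∀ p ∈ S, (1 / q p : ℝ) ≤ (q p : ℝ) ^ (-(1 + δ)) +
        Real.exp 1 * ((q p : ℝ) ^ (-(1 + δ)) - (q p : ℝ) ^ (-(1 + 2 * δ))) := fun p hp => by
      have h1 : Real.exp (-1) ≤ (q p : ℝ) ^ (-δ) := by
        rw [Real.rpow_def_of_pos (hqpos p), Real.exp_le_exp, hδdef]
        have : Real.log (q p) ≤ Real.log x := Real.log_le_log (hqpos p) (hS p hp)
        have : Real.log (q p) * (1 / Real.log x) ≤ 1 := by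
          rw [mul_one_div, div_le_one hlx]; exact this
        linarith
      have := mertens_pointwise_upper h1 (ht1 p δ hδ)
      rw [hsplit2, hsplit]
      have h3 : (0 : ℝ) ≤ 1 / q p := by have := hqpos p; positivity
      nlinarith [mul_le_mul_of_nonneg_left this h3]
    calc ∑ p ∈ S, (1 / q p : ℝ) ≤ ∑ p ∈ S, (q p : ℝ) ^ (-(1 + δ)) + Real.exp 1 *
          ∑ p ∈ S, ((q p : ℝ) ^ (-(1 + δ)) - (q p : ℝ) ^ (-(1 + 2 * δ))) := by
          rw [Finset.mul_sum, ← Finset.sum_add_distrib]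
          exact Finset.sum_le_sum hterm
      _ ≤ P δ + Real.exp 1 * (P δ - P (2 * δ)) := by
          gcongr
          · exact (hsum δ hδ).sum_le_tsum _ fun p _ => by positivity
          · rw [hPdef, ← (hsum δ hδ).tsum_sub (hsum (2 * δ) (by linarith))]
            exact hsd.sum_le_tsum _ fun p _ => hnn p
      _ ≤ (Real.log (Real.log x) + K) + Real.exp 1 * (2 * K + Real.log 2) := by
          have a := hdiff δ hδ hx0
          have b := (abs_le.1 (hP δ hδ (by linarith))).2
          rw [hδdef, one_div_one_div, ← hδdef] at b
          gcongr
          linarith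
      _ = _ := by ring
  have hlow : ∀ n : ℕ, 1 < n → 2 * (1 / Real.log n) ≤ δ₀ →
      Real.log (Real.log n) - (K + 2 * (2 * K + Real.log 2)) ≤
        ∑ p ∈ (hfin n).toFinset, (1 / q p : ℝ) := by
    intro n hn hn0
    have hlx : 0 < Real.log n := Real.log_pos (by exact_mod_cast hn)
    set δ := 1 / Real.log n with hδdef
    have hδ : 0 < δ := by positivity
    have hs2 := hsum (2 * δ) (by linarith)
    have hsd := ((hsum δ hδ).sub hs2).mul_left 2
    -- Terms with `q ≤ n` are bounded by `1 / q`; the tail `q > n`, where `q ^ (-δ) ≤ exp (-1)`, is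
    -- absorbed by the difference `P δ - P (2 * δ)`.
    have hle : P δ ≤ ∑ p ∈ (hfin n).toFinset, (1 / q p : ℝ) + 2 * (P δ - P (2 * δ)) := by
      have hS : HasSum (Set.indicator ((hfin n).toFinset : Set π) fun p => (1 / q p : ℝ))
          (∑ p ∈ (hfin n).toFinset, (1 / q p : ℝ)) := by
        have := hasSum_sum_of_ne_finset_zero (L := .unconditional π) (s := (hfin n).toFinset)
          (f := Set.indicator ((hfin n).toFinset : Set π) fun p => (1 / q p : ℝ))
          fun p hp => Set.indicator_of_notMem (by simpa using hp) _
        rwa [Finset.sum_indicator_subset _ subset_rfl] at this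
      have h2 : 2 * (P δ - P (2 * δ)) =
          ∑' p, 2 * ((q p : ℝ) ^ (-(1 + δ)) - (q p : ℝ) ^ (-(1 + 2 * δ))) := by
        rw [tsum_mul_left, (hsum δ hδ).tsum_sub hs2]
      rw [h2]
      refine hasSum_le (fun p => ?_) (hsum δ hδ).hasSum (hS.add hsd.hasSum)
      have ht := ht1 p δ hδ
      have h0 := hqpos p
      have htn := sub_nonneg.2 ht
      rw [hsplit2]
      by_cases hp : p ∈ ((hfin n).toFinset : Set π)
      · rw [Set.indicator_of_mem hp, hsplit]
        have : 1 / (q p : ℝ) * (q p : ℝ) ^ (-δ) ≤ 1 / (q p : ℝ) * 1 := by gcongr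
        have : 0 ≤ 2 * (1 / (q p : ℝ) * ((q p : ℝ) ^ (-δ) * (1 - (q p : ℝ) ^ (-δ)))) := by
          positivity
        linarith
      · rw [Set.indicator_of_notMem hp, zero_add, hsplit, mul_left_comm]
        have hqn : n < q p := by simpa using hp
        have : (q p : ℝ) ^ (-δ) ≤ Real.exp (-1) := by
          rw [Real.rpow_def_of_pos h0, Real.exp_le_exp, hδdef]
          have : Real.log n ≤ Real.log (q p) :=
            Real.log_le_log (by positivity) (by exact_mod_cast hqn.le)
          have : 1 ≤ Real.log (q p) * (1 / Real.log n) := by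
            rw [mul_one_div, one_le_div hlx]; exact this
          linarith
        exact mul_le_mul_of_nonneg_left (mertens_pointwise_lower this (by positivity))
          (by positivity)
    have a := hdiff δ hδ hn0
    have b := (abs_le.1 (hP δ hδ (by linarith))).1
    rw [hδdef, one_div_one_div, ← hδdef] at b
    linarith
  -- small arguments
  obtain ⟨m, hm⟩ := exists_nat_ge (Real.exp (2 / δ₀) + 3)
  have hm3 : 3 ≤ m := by
    have : (3 : ℝ) ≤ m := by linarith [Real.exp_pos (2 / δ₀)]
    exact_mod_cast this
  have hlarge : ∀ x : ℝ, (m : ℝ) ≤ x → 2 * (1 / Real.log x) ≤ δ₀ := fun x hx => by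
    have h1 : Real.exp (2 / δ₀) ≤ x := by linarith
    have h2 : 2 / δ₀ ≤ Real.log x := by
      rwa [Real.le_log_iff_exp_le ((Real.exp_pos _).trans_le h1)]
    have h3 : 0 < Real.log x := lt_of_lt_of_le (by positivity) h2
    rw [mul_one_div, div_le_comm₀ h3 hδ₀]
    exact h2
  have hll3 : ∀ x : ℝ, 3 ≤ x → 0 ≤ Real.log (Real.log x) := fun x hx => by
    apply Real.log_nonneg
    rw [Real.le_log_iff_exp_le (by linarith)]
    linarith [Real.exp_one_lt_d9]
  set C₁ := K + Real.exp 1 * (2 * K + Real.log 2)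
  set C₂ := K + 2 * (2 * K + Real.log 2)
  have hm1 : (1 : ℝ) < m := by exact_mod_cast (by omega : 1 < m)
  -- The term `log (log m)` takes care of the arguments below `m`, which are compared with `m`.
  refine ⟨|C₁| + |C₂| + Real.log (Real.log m), fun x hx S hS => ?_, fun n hn => ?_⟩
  · have h0 := hll3 x hx
    have hm0 := hll3 m (by exact_mod_cast hm3)
    rcases le_total (m : ℝ) x with hmx | hmx
    · have := hup x (by linarith) (hlarge x hmx) S hS
      linarith [le_abs_self C₁, abs_nonneg C₂]
    · have := hup m hm1 (hlarge m le_rfl) S fun p hp => (hS p hp).trans hmx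
      linarith [le_abs_self C₁, abs_nonneg C₂]
  · have hm0 := hll3 m (by exact_mod_cast hm3)
    rcases le_total m n with hmn | hmn
    · have := hlow n (by omega) (hlarge n (by exact_mod_cast hmn))
      linarith [le_abs_self C₂, abs_nonneg C₁]
    · have h1 : Real.log (Real.log n) ≤ Real.log (Real.log m) := by
        have : (0 : ℝ) < n := by positivity
        apply Real.log_le_log (Real.log_pos (by exact_mod_cast (by omega : 1 < n)))
        exact Real.log_le_log this (by exact_mod_cast hmn)
      have h2 : 0 ≤ ∑ p ∈ (hfin n).toFinset, (1 / q p : ℝ) :=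
        Finset.sum_nonneg fun p _ => by positivity
      linarith [abs_nonneg C₁, abs_nonneg C₂]

end MertensFromPole

/-! ### Zeta functions of Dedekind domains and Mertens' theorem -/

section IdealZeta

open IsDedekindDomain

open scoped Topology

variable {B : Type*} [CommRing B] [IsDedekindDomain B]

/-- By unique factorization it suffices to treat prime powers and coprime ideals. Infiniteness gives
the zero ideal the value `0`, without which multiplicativity fails there. -/
theorem cardQuot_mul_of_infinite [Infinite B] (I J : Ideal B) :
    Submodule.cardQuot (I * J) = Submodule.cardQuot I * Submodule.cardQuot J :=
  UniqueFactorizationMonoid.multiplicative_of_coprime Submodule.cardQuot I J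
    (Submodule.cardQuot_bot _ _)
    (fun {I J} hI => by simp [Ideal.isUnit_iff.mp hI, Ideal.mul_top])
    (fun {I} i hI =>
      have : Ideal.IsPrime I := Ideal.isPrime_of_prime hI
      cardQuot_pow_of_prime hI.ne_zero)
    fun {I J} hIJ => cardQuot_mul_of_coprime <| Ideal.isCoprime_iff_sup_eq.mpr
      (Ideal.isUnit_iff.mp
        (hIJ (Ideal.dvd_iff_le.mpr le_sup_left) (Ideal.dvd_iff_le.mpr le_sup_right)))

theorem HeightOneSpectrum.two_le_cardQuot [Ring.HasFiniteQuotients B] (v : HeightOneSpectrum B) :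
    2 ≤ Submodule.cardQuot v.asIdeal := by
  have h0 := Ring.HasFiniteQuotients.cardQuot_pos v.asIdeal v.ne_bot
  have h1 : Submodule.cardQuot v.asIdeal ≠ 1 := fun h =>
    v.isPrime.ne_top (Submodule.cardQuot_eq_one_iff.1 h)
  omega

theorem exists_heightOneSpectrum_le {I : Ideal B} (h0 : I ≠ ⊥) (h1 : I ≠ ⊤) :
    ∃ v : HeightOneSpectrum B, I ≤ v.asIdeal := by
  obtain ⟨m, hm, hle⟩ := Ideal.exists_le_maximal I h1
  exact ⟨⟨m, hm.isPrime, fun h => h0 (le_bot_iff.1 (h ▸ hle))⟩, hle⟩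

theorem finite_heightOneSpectrum_ge {I : Ideal B} (h0 : I ≠ ⊥) :
    {v : HeightOneSpectrum B | I ≤ v.asIdeal}.Finite := by
  simpa only [Ideal.dvd_iff_le] using Ideal.finite_factors h0

theorem HeightOneSpectrum.eq_of_le {v w : HeightOneSpectrum B} (h : v.asIdeal ≤ w.asIdeal) :
    v = w :=
  HeightOneSpectrum.ext (v.isMaximal.eq_of_le w.isPrime.ne_top h)

variable (B) in
/-- The norm of a non-zero ideal. -/
noncomputable def nonzeroIdealNorm (I : {I : Ideal B // I ≠ ⊥}) : ℕ := Submodule.cardQuot I.1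

/-- The product of a prime ideal and a non-zero ideal. -/
def primeMul (v : HeightOneSpectrum B) (I : {I : Ideal B // I ≠ ⊥}) : {I : Ideal B // I ≠ ⊥} :=
  ⟨v.asIdeal * I.1, mul_ne_zero v.ne_bot I.2⟩

theorem primeMul_injective (v : HeightOneSpectrum B) : Function.Injective (primeMul v) :=
  fun _ _ h => Subtype.ext (mul_left_cancel₀ v.ne_bot (congrArg Subtype.val h))

open scoped Classical in
/-- The terms of the zeta function at the ideals prime to all members of `F`. -/
noncomputable def coprimeTerm (s : ℝ) (F : Finset (HeightOneSpectrum B))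
    (I : {I : Ideal B // I ≠ ⊥}) : ℝ :=
  if ∀ v ∈ F, ¬ I.1 ≤ v.asIdeal then (nonzeroIdealNorm B I : ℝ) ^ (-s) else 0

theorem coprimeTerm_nonneg (s : ℝ) (F : Finset (HeightOneSpectrum B))
    (I : {I : Ideal B // I ≠ ⊥}) : 0 ≤ coprimeTerm s F I := by
  unfold coprimeTerm; split_ifs <;> positivity

theorem coprimeTerm_le (s : ℝ) (F : Finset (HeightOneSpectrum B))
    (I : {I : Ideal B // I ≠ ⊥}) : coprimeTerm s F I ≤ (nonzeroIdealNorm B I : ℝ) ^ (-s) := by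
  unfold coprimeTerm; split_ifs
  · rfl
  · positivity

theorem coprimeTerm_primeMul [Infinite B] (s : ℝ) {F : Finset (HeightOneSpectrum B)}
    {v : HeightOneSpectrum B} (hv : v ∉ F) (I : {I : Ideal B // I ≠ ⊥}) :
    coprimeTerm s F (primeMul v I) =
      (Submodule.cardQuot v.asIdeal : ℝ) ^ (-s) * coprimeTerm s F I := by
  have h : (∀ w ∈ F, ¬ (primeMul v I).1 ≤ w.asIdeal) ↔ ∀ w ∈ F, ¬ I.1 ≤ w.asIdeal := by
    refine forall₂_congr fun w hw => not_congr ?_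
    rw [primeMul, w.isPrime.mul_le, or_iff_right]
    exact fun hle => hv (HeightOneSpectrum.eq_of_le hle ▸ hw)
  have hn : (nonzeroIdealNorm B (primeMul v I) : ℝ) =
      Submodule.cardQuot v.asIdeal * nonzeroIdealNorm B I := by
    simp only [nonzeroIdealNorm, primeMul, cardQuot_mul_of_infinite, Nat.cast_mul]
  unfold coprimeTerm
  by_cases hF : ∀ w ∈ F, ¬ I.1 ≤ w.asIdeal
  · rw [if_pos hF, if_pos (h.2 hF), hn, Real.mul_rpow (by positivity) (by positivity)]
  · rw [if_neg hF, if_neg (mt h.1 hF), mul_zero]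

open scoped Classical in
theorem coprimeTerm_insert (s : ℝ) (F : Finset (HeightOneSpectrum B))
    (v : HeightOneSpectrum B) (I : {I : Ideal B // I ≠ ⊥}) :
    coprimeTerm s (insert v F) I =
      coprimeTerm s F I - if I.1 ≤ v.asIdeal then coprimeTerm s F I else 0 := by
  unfold coprimeTerm
  by_cases h : I.1 ≤ v.asIdeal <;> simp [h]

variable [Infinite B] [Ring.HasFiniteQuotients B]

/-- A sieve in place of the infinite Euler product: the ideals divisible by `v` are the multiples `v
* I`, so discarding them multiplies the sum by `1 - N(v)^(-s)`. -/
theorem tsum_coprimeTerm {s : ℝ} (hs : Summable fun I => (nonzeroIdealNorm B I : ℝ) ^ (-s))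
    (F : Finset (HeightOneSpectrum B)) :
    ∑' I, coprimeTerm s F I = (∏ v ∈ F, (1 - (Submodule.cardQuot v.asIdeal : ℝ) ^ (-s))) *
      ∑' I, (nonzeroIdealNorm B I : ℝ) ^ (-s) := by
  classical
  have hsum : ∀ F : Finset (HeightOneSpectrum B), Summable (coprimeTerm (B := B) s F) := fun F =>
    hs.of_nonneg_of_le (coprimeTerm_nonneg s F) (coprimeTerm_le s F)
  induction F using Finset.induction_on with
  | empty => simp [coprimeTerm]
  | insert v F hv ih =>
    have hsub : Summable fun I : {I : Ideal B // I ≠ ⊥} =>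
        if I.1 ≤ v.asIdeal then coprimeTerm s F I else 0 := by
      refine (hsum F).of_nonneg_of_le (fun I => ?_) (fun I => ?_)
      · split_ifs
        exacts [coprimeTerm_nonneg s F I, le_rfl]
      · split_ifs
        exacts [le_rfl, coprimeTerm_nonneg s F I]
    simp_rw [coprimeTerm_insert]
    rw [(hsum F).tsum_sub hsub, Finset.prod_insert hv, mul_assoc, ← ih, sub_mul, one_mul]
    congr 1
    rw [← tsum_mul_left, ← (primeMul_injective v).tsum_eq]
    · refine tsum_congr fun I => ?_
      rw [if_pos (show (primeMul v I).1 ≤ v.asIdeal from Ideal.mul_le_left),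
        coprimeTerm_primeMul s hv]
    · intro I hI
      have hle : I.1 ≤ v.asIdeal := by
        by_contra h
        exact hI (if_neg h)
      obtain ⟨J, hJ⟩ := Ideal.dvd_iff_le.2 hle
      refine ⟨⟨J, fun h => I.2 ?_⟩, Subtype.ext hJ.symm⟩
      rw [hJ, h, Ideal.mul_bot]

theorem one_le_tsum_coprimeTerm {s : ℝ}
    (hs : Summable fun I => (nonzeroIdealNorm B I : ℝ) ^ (-s))
    (F : Finset (HeightOneSpectrum B)) : 1 ≤ ∑' I, coprimeTerm s F I := by
  have hsum : Summable (coprimeTerm (B := B) s F) :=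
    hs.of_nonneg_of_le (coprimeTerm_nonneg s F) (coprimeTerm_le s F)
  have h := hsum.le_tsum (⟨⊤, top_ne_bot⟩ : {I : Ideal B // I ≠ ⊥})
    fun I _ => coprimeTerm_nonneg s F I
  refine le_trans (le_of_eq ?_) h
  have : ∀ v ∈ F, ¬ (⊤ : Ideal B) ≤ v.asIdeal := fun v _ h => v.isPrime.ne_top (top_le_iff.1 h)
  rw [coprimeTerm, if_pos this]
  simp [nonzeroIdealNorm]

/-- Let the finite set `T` carry all but at most `1` of the zeta sum, and sieve by every prime
dividing a member of `T`. What survives is the unit ideal, contributing `1`, and ideals outside `T`,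
contributing at most `1`. -/
theorem exists_tsum_coprimeTerm_le_two {s : ℝ}
    (hs : Summable fun I => (nonzeroIdealNorm B I : ℝ) ^ (-s)) :
    ∃ F : Finset (HeightOneSpectrum B), ∑' I, coprimeTerm s F I ≤ 2 := by
  classical
  set Z := ∑' I, (nonzeroIdealNorm B I : ℝ) ^ (-s) with hZ
  obtain ⟨T, hT⟩ := (hs.hasSum.eventually (lt_mem_nhds (show Z - 1 < Z by linarith))).exists
  set F : Finset (HeightOneSpectrum B) := T.biUnion fun I =>
    (finite_heightOneSpectrum_ge I.2).toFinset
  have hsum : Summable (coprimeTerm (B := B) s F) :=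
    hs.of_nonneg_of_le (coprimeTerm_nonneg s F) (coprimeTerm_le s F)
  refine ⟨F, ?_⟩
  set top : {I : Ideal B // I ≠ ⊥} := ⟨⊤, top_ne_bot⟩
  have h1 : HasSum (fun I => if I = top then (1 : ℝ) else 0) 1 := hasSum_ite_eq top 1
  have h2 : HasSum (fun I => if I ∈ T then (nonzeroIdealNorm B I : ℝ) ^ (-s) else 0)
      (∑ I ∈ T, (nonzeroIdealNorm B I : ℝ) ^ (-s)) := by
    have := hasSum_sum_of_ne_finset_zero (L := .unconditional _) (s := T)
      (f := fun I => if I ∈ T then (nonzeroIdealNorm B I : ℝ) ^ (-s) else 0)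
      fun I hI => if_neg hI
    rwa [Finset.sum_congr rfl fun I hI => if_pos hI] at this
  have key : ∑' I, coprimeTerm s F I ≤ 1 + (Z - ∑ I ∈ T, (nonzeroIdealNorm B I : ℝ) ^ (-s)) := by
    refine hasSum_le (fun I => ?_) hsum.hasSum (h1.add (hs.hasSum.sub h2))
    have hle := coprimeTerm_le s F I
    have h0 : 0 ≤ (nonzeroIdealNorm B I : ℝ) ^ (-s) := by positivity
    by_cases hIT : I ∈ T
    · by_cases hI : I = top
      · have : (nonzeroIdealNorm B I : ℝ) ^ (-s) = 1 := by
          simp [hI, top, nonzeroIdealNorm]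
        simp only [hI, if_true] at *
        split_ifs
        linarith
      · obtain ⟨v, hv⟩ := exists_heightOneSpectrum_le I.2 fun h => hI (Subtype.ext h)
        have hvF : v ∈ F := Finset.mem_biUnion.2 ⟨I, hIT, by simpa using hv⟩
        have : coprimeTerm s F I = 0 := if_neg fun h => h v hvF hv
        simp [this, hIT, hI]
    · simp only [hIT, if_false, sub_zero]
      split_ifs <;> linarith
  linarith

theorem heightOneSpectrum_summable {s : ℝ}
    (hs : Summable fun I => (nonzeroIdealNorm B I : ℝ) ^ (-s)) :
    Summable fun v : HeightOneSpectrum B => (Submodule.cardQuot v.asIdeal : ℝ) ^ (-s) :=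
  have hinj : Function.Injective
      fun v : HeightOneSpectrum B => (⟨v.asIdeal, v.ne_bot⟩ : {I : Ideal B // I ≠ ⊥}) :=
    fun _ _ h => HeightOneSpectrum.ext (congrArg Subtype.val h)
  (hs.comp_injective hinj).congr fun _ => rfl

theorem exp_neg_le_one_sub {x : ℝ} (h : x ≤ 1 / 2) :
    Real.exp (-(x + 2 * x ^ 2)) ≤ 1 - x := by
  have h1 : 0 < 1 - x := by linarith
  rw [← Real.le_log_iff_exp_le h1]
  refine le_trans ?_ (Real.one_sub_inv_le_log_of_pos h1)
  have : (1 - x)⁻¹ ≤ 1 + (x + 2 * x ^ 2) := by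
    rw [inv_le_iff_one_le_mul₀ h1]
    nlinarith [mul_nonneg (sq_nonneg x) (by linarith : 0 ≤ 1 - 2 * x)]
  linarith

/-- **Mertens' theorem** for a Dedekind domain with finite quotients in which the number of ideals of
norm at most `n` grows linearly with `n`. -/
theorem exists_mertens_of_hasLinearCount (h : HasLinearCount (nonzeroIdealNorm B)) :
    ∃ C : ℝ, (∀ x : ℝ, 3 ≤ x → ∀ S : Finset (HeightOneSpectrum B),
        (∀ v ∈ S, (Submodule.cardQuot v.asIdeal : ℝ) ≤ x) →
        ∑ v ∈ S, (1 / Submodule.cardQuot v.asIdeal : ℝ) ≤ Real.log (Real.log x) + C) ∧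
      ∀ n : ℕ, 3 ≤ n → Real.log (Real.log n) - C ≤
        ∑ v ∈ (Ring.HasFiniteQuotients.finite_cardQuot_heightOneSpectrum_le (R := B) n).toFinset,
          (1 / Submodule.cardQuot v.asIdeal : ℝ) := by
  refine exists_mertens_of_tsum_bounds HeightOneSpectrum.two_le_cardQuot
    Ring.HasFiniteQuotients.finite_cardQuot_heightOneSpectrum_le
    (fun δ hδ => heightOneSpectrum_summable (h.summable (by linarith))) ?_
  obtain ⟨a, b, δ₀, ha, hb, hδ₀, hab⟩ := h.exists_tsum_bounds
  set Q := ∑' v : HeightOneSpectrum B, (Submodule.cardQuot v.asIdeal : ℝ) ^ (-2 : ℝ)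
  refine ⟨|Real.log b| + |Real.log a| + Real.log 2 + 2 * Q, δ₀, hδ₀, fun δ hδ hδ' => ?_⟩
  obtain ⟨h1, h2⟩ := hab δ hδ hδ'
  have hs := h.summable (show 1 < 1 + δ by linarith)
  have hsv := heightOneSpectrum_summable hs
  have hs2 := heightOneSpectrum_summable (h.summable (show (1 : ℝ) < 2 by norm_num))
  set Z := ∑' I, (nonzeroIdealNorm B I : ℝ) ^ (-(1 + δ))
  have hZ : 0 < Z := lt_of_lt_of_le (by positivity) h1
  have hQ : 0 ≤ Q := tsum_nonneg fun v => by positivity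
  have hl2 : 0 ≤ Real.log 2 := Real.log_nonneg one_le_two
  rw [abs_le]
  constructor
  -- Lower bound: the sieved sum is at most `2`, and `1 - x ≥ exp (-(x + 2 * x ^ 2))` for each Euler
  -- factor. Hence `Z ≤ 2 * exp (∑ x + 2 * Q)`, while `Z ≥ a / δ`.
  · obtain ⟨F, hF⟩ := exists_tsum_coprimeTerm_le_two hs
    rw [tsum_coprimeTerm hs] at hF
    have hprod : Real.exp (-(∑' v : HeightOneSpectrum B,
        (Submodule.cardQuot v.asIdeal : ℝ) ^ (-(1 + δ)) + 2 * Q)) ≤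
        ∏ v ∈ F, (1 - (Submodule.cardQuot v.asIdeal : ℝ) ^ (-(1 + δ))) := by
      calc _ ≤ Real.exp (∑ v ∈ F, -((Submodule.cardQuot v.asIdeal : ℝ) ^ (-(1 + δ)) +
            2 * ((Submodule.cardQuot v.asIdeal : ℝ) ^ (-(1 + δ))) ^ 2)) := by
            rw [Real.exp_le_exp, Finset.sum_neg_distrib, neg_le_neg_iff, Finset.sum_add_distrib,
              ← Finset.mul_sum]
            gcongr
            · exact hsv.sum_le_tsum _ fun v _ => by positivity
            · refine le_trans (Finset.sum_le_sum fun v _ => ?_)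
                (hs2.sum_le_tsum F fun v _ => by positivity)
              rw [← Real.rpow_natCast, ← Real.rpow_mul (by positivity)]
              have := HeightOneSpectrum.two_le_cardQuot v
              apply Real.rpow_le_rpow_of_exponent_le
              · exact_mod_cast (by omega : 1 ≤ Submodule.cardQuot v.asIdeal)
              · push_cast; linarith
        _ ≤ _ := by
            rw [Real.exp_sum]
            refine Finset.prod_le_prod (fun v _ => (Real.exp_pos _).le) fun v _ =>
              exp_neg_le_one_sub ?_
            have : (2 : ℝ) ≤ Submodule.cardQuot v.asIdeal := by
              exact_mod_cast HeightOneSpectrum.two_le_cardQuot v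
            calc (Submodule.cardQuot v.asIdeal : ℝ) ^ (-(1 + δ))
                ≤ (Submodule.cardQuot v.asIdeal : ℝ) ^ (-1 : ℝ) :=
                  Real.rpow_le_rpow_of_exponent_le (by linarith) (by linarith)
              _ = 1 / (Submodule.cardQuot v.asIdeal : ℝ) := by rw [Real.rpow_neg_one, one_div]
              _ ≤ 1 / 2 := one_div_le_one_div_of_le two_pos this
    have h3 := (mul_le_mul_of_nonneg_right hprod hZ.le).trans hF
    have h4 : Real.exp (-(∑' v : HeightOneSpectrum B,
        (Submodule.cardQuot v.asIdeal : ℝ) ^ (-(1 + δ)) + 2 * Q)) * (a / δ) ≤ 2 :=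
      le_trans (by gcongr) h3
    have h5 := Real.log_le_log (by positivity) h4
    rw [Real.log_mul (by positivity) (by positivity), Real.log_exp, div_eq_mul_one_div,
      Real.log_mul (by positivity) (by positivity)] at h5
    linarith [neg_abs_le (Real.log a), abs_nonneg (Real.log b)]
  -- Upper bound: the unit ideal always survives the sieve, so `1 ≤ Z * ∏ (1 - x) ≤ Z * exp (-∑ x)`,
  -- while `Z ≤ b / δ`.
  · have hle : ∑' v : HeightOneSpectrum B, (Submodule.cardQuot v.asIdeal : ℝ) ^ (-(1 + δ)) ≤
        Real.log Z := by
      refine hsv.tsum_le_of_sum_le fun F => ?_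
      have h3 := one_le_tsum_coprimeTerm hs F
      rw [tsum_coprimeTerm hs] at h3
      have h4 : ∏ v ∈ F, (1 - (Submodule.cardQuot v.asIdeal : ℝ) ^ (-(1 + δ))) ≤
          Real.exp (-∑ v ∈ F, (Submodule.cardQuot v.asIdeal : ℝ) ^ (-(1 + δ))) := by
        rw [← Finset.sum_neg_distrib, Real.exp_sum]
        refine Finset.prod_le_prod (fun v _ => ?_) fun v _ => Real.one_sub_le_exp_neg _
        have := HeightOneSpectrum.two_le_cardQuot v
        exact sub_nonneg.2 (Real.rpow_le_one_of_one_le_of_nonpos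
          (by exact_mod_cast (by omega : 1 ≤ Submodule.cardQuot v.asIdeal)) (by linarith))
      rw [Real.le_log_iff_exp_le hZ]
      have h5 := h3.trans (mul_le_mul_of_nonneg_right h4 hZ.le)
      rw [Real.exp_neg, inv_mul_eq_div, one_le_div (Real.exp_pos _)] at h5
      exact h5
    have h6 := hle.trans (Real.log_le_log hZ h2)
    rw [div_eq_mul_one_div, Real.log_mul (by positivity) (by positivity)] at h6
    linarith [le_abs_self (Real.log b), abs_nonneg (Real.log a)]

end IdealZeta

/-! ### Counting ideals in finite free extensions of `F[X]` -/

section FunctionFieldCount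

open Polynomial Module

variable {F : Type*} [Field F]

section Degree

variable {ι : Type*} [Fintype ι] [DecidableEq ι]

theorem natDegree_prod_le_card_mul {f : ι → F[X]} {e : ℕ} (hf : ∀ i, (f i).natDegree ≤ e) :
    (∏ i, f i).natDegree ≤ Fintype.card ι * e := by
  refine (natDegree_prod_le _ _).trans ((Finset.sum_le_card_nsmul _ _ e fun i _ => hf i).trans ?_)
  simp

theorem natDegree_det_le {M : Matrix ι ι F[X]} {e : ℕ} (hM : ∀ i j, (M i j).natDegree ≤ e) :
    M.det.natDegree ≤ Fintype.card ι * e := by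
  rw [Matrix.det_apply]
  refine natDegree_sum_le_of_forall_le _ _ fun σ _ => ?_
  refine (natDegree_smul_le _ _).trans (natDegree_prod_le_card_mul fun i => hM _ _)

/-- In the Leibniz expansion only the identity permutation reaches the degree `card ι * m`: any
other one uses an off-diagonal entry, of degree less than `m`. -/
theorem natDegree_det_scalar_add {E : Matrix ι ι F[X]} {m : ℕ} (hE : ∀ i j, (E i j).natDegree < m) :
    (((X : F[X]) ^ m • (1 : Matrix ι ι F[X]) + E).det).natDegree = Fintype.card ι * m := by
  set M := (X : F[X]) ^ m • (1 : Matrix ι ι F[X]) + E with hM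
  have hdiag : ∀ i, (M i i).Monic ∧ (M i i).natDegree = m := fun i => by
    have h : M i i = X ^ m + E i i := by simp [hM]
    have hd : (E i i).degree < (m : WithBot ℕ) :=
      degree_le_natDegree.trans_lt (by exact_mod_cast hE i i)
    rw [h]
    exact ⟨monic_X_pow_add hd, by
      rw [natDegree_eq_of_degree_eq (degree_add_eq_left_of_degree_lt (by rwa [degree_X_pow])),
        natDegree_X_pow]⟩
  have hoff : ∀ i j, i ≠ j → (M i j).natDegree < m := fun i j hij => by
    have h : M i j = E i j := by simp [hM, Matrix.one_apply_ne hij]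
    rw [h]; exact hE i j
  have hle : ∀ i j, (M i j).natDegree ≤ m := fun i j => by
    by_cases hij : i = j
    · subst hij; exact (hdiag i).2.le
    · exact (hoff i j hij).le
  rw [Matrix.det_apply, ← Finset.add_sum_erase _ _ (Finset.mem_univ (1 : Equiv.Perm ι))]
  have h1 : (∏ i, M ((1 : Equiv.Perm ι) i) i).natDegree = Fintype.card ι * m := by
    simp only [Equiv.Perm.coe_one, id_eq]
    rw [natDegree_prod_of_monic _ _ fun i _ => (hdiag i).1,
      Finset.sum_congr rfl fun i _ => (hdiag i).2]
    simp
  have hmon : (∏ i, M ((1 : Equiv.Perm ι) i) i).Monic :=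
    monic_prod_of_monic _ _ fun i _ => by simpa using (hdiag i).1
  simp only [Equiv.Perm.sign_one, one_smul]
  have hdeg : (∏ i, M ((1 : Equiv.Perm ι) i) i).degree = ((Fintype.card ι * m : ℕ) : WithBot ℕ) := by
    rw [degree_eq_natDegree hmon.ne_zero, h1]
  refine natDegree_eq_of_degree_eq_some ?_
  rw [degree_add_eq_left_of_degree_lt, hdeg]
  rw [hdeg, ← mem_degreeLT]
  refine Submodule.sum_mem _ fun σ hσ => ?_
  rw [mem_degreeLT]
  obtain ⟨k, hk⟩ : ∃ k, σ k ≠ k := by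
    by_contra! h
    exact (Finset.mem_erase.1 hσ).1 (Equiv.ext h)
  refine degree_le_natDegree.trans_lt ?_
  rw [Nat.cast_lt]
  refine (natDegree_smul_le _ _).trans_lt ((natDegree_prod_le _ _).trans_lt ?_)
  calc ∑ i, (M (σ i) i).natDegree < ∑ _i : ι, m :=
        Finset.sum_lt_sum (fun i _ => hle _ _) ⟨k, Finset.mem_univ _, hoff _ _ hk⟩
    _ = Fintype.card ι * m := by simp

end Degree

instance hasFiniteQuotients_polynomial [Finite F] : Ring.HasFiniteQuotients F[X] where
  finiteQuotient {I} hI := by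
    obtain ⟨f, rfl⟩ := Submodule.IsPrincipal.principal I
    have hf : f ≠ 0 := by rintro rfl; simp at hI
    have : Module.Finite F (F[X] ⧸ Ideal.span {f}) :=
      PowerBasis.finite (AdjoinRoot.powerBasis hf)
    exact Module.finite_of_finite F

variable {B : Type*} [CommRing B] [Algebra F[X] B]
variable {ι : Type*} [Fintype ι] (b : Basis ι F[X] B)

/-- The elements of `B` all of whose coordinates are polynomials of degree less than `m`. -/
def coordBox (m : ℕ) : AddSubgroup B where
  carrier := {x | ∀ i, b.repr x i ∈ degreeLT F m}
  zero_mem' := fun i => by simp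
  add_mem' := fun {x y} hx hy i => by
    rw [map_add, Finsupp.add_apply]; exact Submodule.add_mem _ (hx i) (hy i)
  neg_mem' := fun {x} hx i => by
    rw [map_neg, Finsupp.neg_apply]; exact Submodule.neg_mem _ (hx i)

/-- Coordinates identify the box with a product of spaces of polynomials. -/
noncomputable def coordBoxEquiv (m : ℕ) : coordBox b m ≃ (ι → degreeLT F m) where
  toFun x i := ⟨b.repr x.1 i, x.2 i⟩
  invFun c := ⟨b.equivFun.symm fun i => (c i).1, fun i => by
    rw [← b.equivFun_apply, LinearEquiv.apply_symm_apply]; exact (c i).2⟩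
  left_inv x := Subtype.ext (b.equivFun.symm_apply_apply x.1)
  right_inv c := by
    ext i : 2
    change b.equivFun (b.equivFun.symm fun i => (c i).1) i = _
    rw [LinearEquiv.apply_symm_apply]

theorem card_coordBox (m : ℕ) :
    Nat.card (coordBox b m) = Nat.card F ^ (Fintype.card ι * m) := by
  rw [Nat.card_congr (coordBoxEquiv b m), Nat.card_fun,
    Nat.card_congr (degreeLTEquiv F m).toEquiv, Nat.card_fun]
  simp [← pow_mul, mul_comm]

theorem finite_coordBox [Finite F] (m : ℕ) : Finite (coordBox b m) := by
  have : Finite (degreeLT F m) := Finite.of_equiv _ (degreeLTEquiv F m).symm.toEquiv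
  exact Finite.of_equiv _ (coordBoxEquiv b m).symm

variable [DecidableEq ι]

/-- The entries of the matrix of multiplication by an element of a box have bounded degree. -/
theorem exists_natDegree_leftMulMatrix_le :
    ∃ c₀ : ℕ, ∀ m : ℕ, ∀ x ∈ coordBox b m, ∀ i j,
      (Algebra.leftMulMatrix b x i j).natDegree ≤ m + c₀ := by
  refine ⟨∑ k, ∑ i, ∑ j, (Algebra.leftMulMatrix b (b k) i j).natDegree, fun m x hx i j => ?_⟩
  have hexp : Algebra.leftMulMatrix b x i j =
      ∑ k, b.repr x k * Algebra.leftMulMatrix b (b k) i j := by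
    conv_lhs => rw [← b.sum_repr x]
    rw [map_sum, Matrix.sum_apply]
    refine Finset.sum_congr rfl fun k _ => ?_
    rw [map_smul, Matrix.smul_apply, smul_eq_mul]
  rw [hexp]
  refine natDegree_sum_le_of_forall_le _ _ fun k _ => natDegree_mul_le.trans (add_le_add ?_ ?_)
  · exact natDegree_le_of_degree_le (mem_degreeLT.1 (hx k)).le
  · exact ((Finset.single_le_sum (f := fun j => (Algebra.leftMulMatrix b (b k) i j).natDegree)
      (fun _ _ => Nat.zero_le _) (Finset.mem_univ j)).trans
      (Finset.single_le_sum (f := fun i => ∑ j, (Algebra.leftMulMatrix b (b k) i j).natDegree)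
      (fun _ _ => Nat.zero_le _) (Finset.mem_univ i))).trans
      (Finset.single_le_sum (f := fun k => ∑ i, ∑ j, (Algebra.leftMulMatrix b (b k) i j).natDegree)
      (fun _ _ => Nat.zero_le _) (Finset.mem_univ k))

section

variable [IsDomain B]

theorem cardQuot_span_singleton (b : Basis ι F[X] B) [Finite F] {f : B} (hf : f ≠ 0) :
    Submodule.cardQuot (Ideal.span {f}) = Nat.card F ^ (Algebra.norm F[X] f).natDegree := by
  let _ : Algebra F B := Algebra.compHom B (algebraMap F F[X])
  have : IsScalarTower F F[X] B := IsScalarTower.of_algebraMap_eq fun _ => rfl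
  have : Module.Finite F[X] B := Module.Finite.of_basis b
  have : Ring.HasFiniteQuotients B := .of_module_finite F[X] B
  have : Finite (B ⧸ Ideal.span {f}) :=
    Ring.HasFiniteQuotients.finiteQuotient (Ideal.span_singleton_eq_bot.not.2 hf)
  rw [← finrank_quotient_span_eq_natDegree_norm b hf, Submodule.cardQuot_apply]
  exact Module.natCard_eq_pow_finrank (K := F) (V := B ⧸ Ideal.span {f})

theorem exists_cardQuot_eq_pow [Finite F] {I : Ideal B} (hI : I ≠ ⊥) [Module.Finite F[X] B] :
    ∃ j, Submodule.cardQuot I = Nat.card F ^ j := by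
  let _ : Algebra F B := Algebra.compHom B (algebraMap F F[X])
  have : Ring.HasFiniteQuotients B := .of_module_finite F[X] B
  have : Finite (B ⧸ I) := Ring.HasFiniteQuotients.finiteQuotient hI
  exact ⟨_, Module.natCard_eq_pow_finrank (K := F) (V := B ⧸ I)⟩

/-- Pigeonhole, in the role of Minkowski's theorem: two elements of the box agree modulo `I`, and
their difference is again in the box. -/
theorem exists_ne_zero_mem_coordBox [Finite F] [Module.Finite F[X] B] {I : Ideal B} (hI : I ≠ ⊥)
    {m : ℕ} (h : Submodule.cardQuot I < Nat.card F ^ (Fintype.card ι * m)) :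
    ∃ x ∈ coordBox b m, x ≠ 0 ∧ x ∈ I := by
  have : Ring.HasFiniteQuotients B := .of_module_finite F[X] B
  have : Finite (B ⧸ I) := Ring.HasFiniteQuotients.finiteQuotient hI
  have := finite_coordBox b m
  by_contra! hcon
  have hinj : Function.Injective fun x : coordBox b m => Ideal.Quotient.mk I x.1 := by
    intro x y hxy
    by_contra hne
    exact hcon (x.1 - y.1) (AddSubgroup.sub_mem _ x.2 y.2)
      (sub_ne_zero.2 fun h => hne (Subtype.ext h)) (Ideal.Quotient.eq.1 hxy)
  have := Nat.card_le_card_of_injective _ hinj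
  rw [card_coordBox] at this
  exact absurd h (not_lt.2 this)

theorem natDegree_norm_add_of_mem_coordBox {m e : ℕ} {x : B} (hm : e < m)
    (hx : ∀ i j, (Algebra.leftMulMatrix b x i j).natDegree ≤ e) :
    (Algebra.norm F[X] (algebraMap F[X] B (X ^ m) + x)).natDegree = Fintype.card ι * m := by
  rw [Algebra.norm_eq_matrix_det b, map_add, AlgHom.commutes, Algebra.algebraMap_eq_smul_one]
  exact natDegree_det_scalar_add fun i j => (hx i j).trans_lt hm

/-- If `u` is a unit with `(X^m + x) u = X^m + y`, then `(X^m + x)(u - 1) = y - x`. For `x ≠ y` the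
norm of the left side has degree at least `card ι * m`, that of the right side at most `card ι * e`.
-/
theorem injOn_span_add [Nonempty ι] {m e m' : ℕ} (hm : e < m)
    (hx : ∀ x ∈ coordBox b m', ∀ i j, (Algebra.leftMulMatrix b x i j).natDegree ≤ e) :
    Set.InjOn (fun x => Ideal.span {algebraMap F[X] B (X ^ m) + x}) (coordBox b m' : Set B) := by
  have := Module.Finite.of_basis b
  have := Module.Free.of_basis b
  intro x hx' y hy' hxy
  obtain ⟨u, hu⟩ := Ideal.span_singleton_eq_span_singleton.1 hxy
  by_contra hne
  have heq : (algebraMap F[X] B (X ^ m) + x) * ((u : B) - 1) = y - x := by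
    linear_combination hu
  have hyx : y - x ≠ 0 := sub_ne_zero.2 (Ne.symm hne)
  have hn := congrArg (fun z => (Algebra.norm F[X] z).natDegree) heq
  simp only [map_mul] at hn
  have h0 : Algebra.norm F[X] (y - x) ≠ 0 := Algebra.norm_ne_zero_iff.2 hyx
  rw [← heq, map_mul] at h0
  rw [natDegree_mul (left_ne_zero_of_mul h0) (right_ne_zero_of_mul h0),
    natDegree_norm_add_of_mem_coordBox b hm (hx x hx')] at hn
  have hle : (Algebra.norm F[X] (y - x)).natDegree ≤ Fintype.card ι * e := by
    rw [Algebra.norm_eq_matrix_det b]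
    exact natDegree_det_le (hx _ (AddSubgroup.sub_mem _ hy' hx'))
  have : Fintype.card ι * e < Fintype.card ι * m := Nat.mul_lt_mul_of_pos_left hm Fintype.card_pos
  omega

end

variable [IsDedekindDomain B]

/-- Such an ideal `I` contains a non-zero `x` from a box with about `q^j` elements. Then `(x) = I *
J` with `J` of bounded norm, and `I` is recovered from the pair `(x, J)`. -/
theorem exists_ncard_cardQuot_eq_le (b : Basis ι F[X] B) [Finite F] [Nonempty ι]
    [Ring.HasFiniteQuotients B] [Infinite B] :
    ∃ D : ℕ, ∀ j : ℕ, {I : {I : Ideal B // I ≠ ⊥} |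
      nonzeroIdealNorm B I = Nat.card F ^ j}.ncard ≤ D * Nat.card F ^ j := by
  have := Module.Finite.of_basis b
  obtain ⟨c₀, hc₀⟩ := exists_natDegree_leftMulMatrix_le b
  set q := Nat.card F with hq
  set d := Fintype.card ι with hd
  have hd0 : 0 < d := Fintype.card_pos
  have hq1 : 1 < q := Finite.one_lt_card
  have hfinJ := Ring.HasFiniteQuotients.finite_cardQuot_le (R := B) (q ^ (d + d * c₀))
  have := hfinJ.to_subtype
  refine ⟨q ^ d * Nat.card {J : Ideal B | J.cardQuot ≤ q ^ (d + d * c₀)}, fun j => ?_⟩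
  -- The least box with more than `q ^ j` elements, as the pigeonhole argument requires.
  set m := j / d + 1
  have hm : j < d * m := Nat.lt_mul_div_succ j hd0
  have hm' : d * m ≤ j + d := by
    rw [mul_add, mul_one]; exact Nat.add_le_add_right (Nat.mul_div_le j d) d
  have := finite_coordBox b m
  have key : ∀ I : {I : {I : Ideal B // I ≠ ⊥} | nonzeroIdealNorm B I = q ^ j},
      ∃ P : coordBox b m × {J : Ideal B | J.cardQuot ≤ q ^ (d + d * c₀)},
        P.2.1 ≠ ⊥ ∧ I.1.1 * P.2.1 = Ideal.span {P.1.1} := by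
    rintro ⟨⟨I, hI⟩, hIj⟩
    replace hIj : Submodule.cardQuot I = q ^ j := hIj
    obtain ⟨x, hx, hx0, hxI⟩ := exists_ne_zero_mem_coordBox b hI (m := m)
      (by rw [hIj]; exact Nat.pow_lt_pow_right hq1 hm)
    obtain ⟨J, hJ⟩ := Ideal.dvd_iff_le.2 ((Ideal.span_singleton_le_iff_mem I).2 hxI)
    have hcard := cardQuot_span_singleton b hx0
    have hdeg : (Algebra.norm F[X] x).natDegree ≤ d * (m + c₀) := by
      rw [Algebra.norm_eq_matrix_det b]
      exact natDegree_det_le (hc₀ m x hx)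
    rw [hJ, cardQuot_mul_of_infinite, hIj] at hcard
    have hle : q ^ j * Submodule.cardQuot J ≤ q ^ j * q ^ (d + d * c₀) := by
      rw [hcard, ← pow_add]
      exact Nat.pow_le_pow_right hq1.le (hdeg.trans (by rw [mul_add]; omega))
    refine ⟨⟨⟨x, hx⟩, ⟨J, Nat.le_of_mul_le_mul_left hle (by positivity)⟩⟩, ?_, hJ.symm⟩
    rintro rfl
    rw [Ideal.mul_bot, Ideal.span_singleton_eq_bot] at hJ
    exact hx0 hJ
  choose P hP0 hP using key
  have hinj : Function.Injective P := fun I I' h => by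
    have h1 := hP I
    rw [h, ← hP I'] at h1
    exact Subtype.ext (Subtype.ext (mul_right_cancel₀ (hP0 I') h1))
  have hcard := Nat.card_le_card_of_injective P hinj
  rw [Nat.card_prod, card_coordBox] at hcard
  rw [← Nat.card_coe_set_eq]
  calc _ ≤ _ := hcard
    _ ≤ q ^ (j + d) * _ := Nat.mul_le_mul_right _ (Nat.pow_le_pow_right hq1.le hm')
    _ = _ := by rw [pow_add]; ring

/-- In a Dedekind domain that is finite and free over `F[X]`, for a finite field `F`, the number of
ideals of norm at most `n` grows linearly with `n`. -/
theorem hasLinearCount_of_basis (b : Basis ι F[X] B) [Finite F] [Nonempty ι]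
    [Ring.HasFiniteQuotients B] [Infinite B] : HasLinearCount (nonzeroIdealNorm B) := by
  have := Module.Finite.of_basis b
  have := Module.Free.of_basis b
  have hfin : ∀ n : ℕ, {I | nonzeroIdealNorm B I ≤ n}.Finite := fun n =>
    (Ring.HasFiniteQuotients.finite_cardQuot_le (R := B) n).preimage Subtype.val_injective.injOn
  set q := Nat.card F with hq
  set d := Fintype.card ι with hd
  have hd0 : 0 < d := Fintype.card_pos
  have hq1 : 1 < q := Finite.one_lt_card
  refine ⟨fun I => Ring.HasFiniteQuotients.cardQuot_pos I.1 I.2, hfin, ?_, ?_⟩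
  · obtain ⟨c₀, hc₀⟩ := exists_natDegree_leftMulMatrix_le b
    refine ⟨1 / (q : ℝ) ^ (d * (c₀ + 2)), by positivity, fun n hn => ?_⟩
    set m := Nat.log (q ^ d) n
    have hqd : 1 < q ^ d := Nat.one_lt_pow hd0.ne' hq1
    have hnlt : n < (q ^ d) ^ (m + 1) := Nat.lt_pow_succ_log_self hqd n
    have hnle : (q ^ d) ^ m ≤ n := Nat.pow_log_le_self _ (by omega)
    suffices h : n ≤ {I | nonzeroIdealNorm B I ≤ n}.ncard * q ^ (d * (c₀ + 2)) by
      rw [one_div_mul_eq_div, div_le_iff₀ (by positivity)]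
      exact_mod_cast h
    rcases le_or_gt (c₀ + 1) m with hm | hm
    -- The ideals counted are the principal ideals `(X^m + x)`. With `m' = m - c₀ - 1` the
    -- multiplication matrices of the `x` in the box have entries of degree at most `m - 1`, so each
    -- ideal has norm `q ^ (d * m) ≤ n` and distinct `x` give distinct ideals.
    · obtain ⟨m', hm'⟩ := Nat.exists_eq_add_of_le' hm
      have hbox : ∀ x ∈ coordBox b m', ∀ i j,
          (Algebra.leftMulMatrix b x i j).natDegree ≤ m - 1 := fun x hx i j =>
        (hc₀ m' x hx i j).trans (by omega)
      have hlt : m - 1 < m := by omega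
      have hne : ∀ x ∈ coordBox b m', algebraMap F[X] B (X ^ m) + x ≠ 0 := fun x hx h => by
        have := natDegree_norm_add_of_mem_coordBox b hlt (hbox x hx)
        rw [h, Algebra.norm_zero, natDegree_zero] at this
        have : 0 < Fintype.card ι * m := Nat.mul_pos hd0 (by omega)
        omega
      have hcard : ∀ x ∈ coordBox b m',
          Submodule.cardQuot (Ideal.span {algebraMap F[X] B (X ^ m) + x}) ≤ n := fun x hx => by
        rw [cardQuot_span_singleton b (hne x hx),
          natDegree_norm_add_of_mem_coordBox b hlt (hbox x hx), pow_mul]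
        exact hnle
      have hinj := injOn_span_add b hlt hbox
      have := (hfin n).to_subtype
      have hcount := Nat.card_le_card_of_injective
        (fun x : coordBox b m' => (⟨⟨Ideal.span {algebraMap F[X] B (X ^ m) + x.1},
          mt Ideal.span_singleton_eq_bot.1 (hne x.1 x.2)⟩, hcard x.1 x.2⟩ :
            {I | nonzeroIdealNorm B I ≤ n}))
        fun x y hxy => Subtype.ext (hinj x.2 y.2 (congrArg (fun I => I.1.1) hxy))
      rw [card_coordBox, Nat.card_coe_set_eq] at hcount
      calc n ≤ (q ^ d) ^ (m + 1) := hnlt.le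
        _ = q ^ (d * m') * q ^ (d * (c₀ + 2)) := by
            rw [← pow_mul, ← pow_add, hm']; ring_nf
        _ ≤ _ := Nat.mul_le_mul_right _ hcount
    -- For `m ≤ c₀` the number `n` is bounded and the unit ideal alone suffices.
    · have h1 : 1 ≤ {I | nonzeroIdealNorm B I ≤ n}.ncard := by
        refine (Set.ncard_pos (hfin n)).2 ?_
        refine ⟨⟨⊤, top_ne_bot⟩, ?_⟩
        simpa [nonzeroIdealNorm] using hn
      calc n ≤ (q ^ d) ^ (m + 1) := hnlt.le
        _ ≤ 1 * q ^ (d * (c₀ + 2)) := by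
            rw [← pow_mul, one_mul]
            exact Nat.pow_le_pow_right hq1.le (Nat.mul_le_mul_left _ (by omega))
        _ ≤ _ := Nat.mul_le_mul_right _ h1
  · obtain ⟨D, hD⟩ := exists_ncard_cardQuot_eq_le b
    refine ⟨2 * D + 1, by positivity, fun n hn => ?_⟩
    set J := Nat.log q n
    -- All norms are powers of `q`, so the count is dominated by a geometric sum.
    have hsub : {I | nonzeroIdealNorm B I ≤ n} ⊆
        ⋃ j ∈ Finset.range (J + 1), {I | nonzeroIdealNorm B I = q ^ j} := by
      rintro ⟨I, hI⟩ hIn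
      obtain ⟨j, hj⟩ := exists_cardQuot_eq_pow (F := F) hI
      refine Set.mem_biUnion (x := j) ?_ hj
      have : q ^ j ≤ n := hj ▸ hIn
      simpa [Nat.lt_succ_iff] using (Nat.le_log_iff_pow_le hq1 (by omega)).2 this
    have hfin' : (⋃ j ∈ Finset.range (J + 1), {I | nonzeroIdealNorm B I = q ^ j}).Finite :=
      Set.Finite.biUnion (Finset.finite_toSet _) fun j _ =>
        (hfin (q ^ j)).subset fun I hI => le_of_eq hI
    have hle : {I | nonzeroIdealNorm B I ≤ n}.ncard ≤ 2 * D * n := by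
      calc _ ≤ _ := Set.ncard_le_ncard hsub hfin'
        _ ≤ ∑ j ∈ Finset.range (J + 1), {I | nonzeroIdealNorm B I = q ^ j}.ncard :=
            Finset.set_ncard_biUnion_le _ _
        _ ≤ ∑ j ∈ Finset.range (J + 1), D * q ^ j := Finset.sum_le_sum fun j _ => hD j
        _ = D * (q ^ J + ∑ j ∈ Finset.range J, q ^ j) := by
            rw [← Finset.mul_sum, Finset.sum_range_succ, add_comm]
        _ ≤ D * (n + n) := by
            have h1 : q ^ J ≤ n := Nat.pow_log_le_self _ (by omega)
            have h2 : ∑ j ∈ Finset.range J, q ^ j < q ^ J :=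
              Nat.geomSum_lt hq1 fun k hk => Finset.mem_range.1 hk
            gcongr
            omega
        _ = 2 * D * n := by ring
    have : ({I | nonzeroIdealNorm B I ≤ n}.ncard : ℝ) ≤ 2 * D * n := by exact_mod_cast hle
    nlinarith [(Nat.cast_nonneg n : (0 : ℝ) ≤ n)]

end FunctionFieldCount

/-! ### Counting ideals in rings of integers -/

section NumberFieldCount

open scoped Topology nonZeroDivisors

/-- The number of ideals of norm at most `n`, divided by `n`, tends to the positive residue `κ`. The
finitely many `n` below the threshold `n₀` are covered by the unit ideal from below and by
monotonicity from above. -/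
theorem hasLinearCount_ringOfIntegers (K : Type*) [Field K] [NumberField K] :
    HasLinearCount (nonzeroIdealNorm (NumberField.RingOfIntegers K)) := by
  set O := NumberField.RingOfIntegers K
  have hfin : ∀ n : ℕ, {I | nonzeroIdealNorm O I ≤ n}.Finite := fun n =>
    (Ring.HasFiniteQuotients.finite_cardQuot_le (R := O) n).preimage Subtype.val_injective.injOn
  have h1le : ∀ I, 1 ≤ nonzeroIdealNorm O I :=
    fun I => Ring.HasFiniteQuotients.cardQuot_pos I.1 I.2
  have hlim := NumberField.Ideal.tendsto_norm_le_div_atTop₀ K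
  have hpos := NumberField.dedekindZeta_residue_pos K
  rw [NumberField.dedekindZeta_residue_def] at hpos
  set κ := (2 ^ NumberField.InfinitePlace.nrRealPlaces K * (2 * Real.pi) ^
    NumberField.InfinitePlace.nrComplexPlaces K * NumberField.Units.regulator K *
      NumberField.classNumber K) / (NumberField.Units.torsionOrder K *
        Real.sqrt |NumberField.discr K|)
  have hcard : ∀ n : ℕ, (Nat.card {I : (Ideal O)⁰ // Ideal.absNorm (I : Ideal O) ≤ (n : ℝ)}) =
      {I | nonzeroIdealNorm O I ≤ n}.ncard := fun n => by
    rw [← Nat.card_coe_set_eq]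
    refine Nat.card_congr
      { toFun := fun I => ⟨⟨I.1.1, nonZeroDivisors.ne_zero I.1.2⟩, by exact_mod_cast I.2⟩
        invFun := fun I => ⟨⟨I.1.1, mem_nonZeroDivisors_of_ne_zero I.1.2⟩, by exact_mod_cast I.2⟩
        left_inv := fun I => rfl
        right_inv := fun I => rfl }
  have hev := (hlim.comp tendsto_natCast_atTop_atTop).eventually
    (Icc_mem_nhds (half_lt_self hpos) (show κ < 2 * κ by linarith))
  obtain ⟨n₀, hn₀⟩ := eventually_atTop.1 hev
  have hbig : ∀ n, n₀ ≤ n → 1 ≤ n → κ / 2 * n ≤ ({I | nonzeroIdealNorm O I ≤ n}.ncard : ℝ) ∧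
      ({I | nonzeroIdealNorm O I ≤ n}.ncard : ℝ) ≤ 2 * κ * n := fun n hn hn1 => by
    have hn' : (0 : ℝ) < n := by exact_mod_cast hn1
    obtain ⟨h1, h2⟩ := hn₀ n hn
    rw [← hcard]
    exact ⟨(le_div_iff₀ hn').1 h1, (div_le_iff₀ hn').1 h2⟩
  have hmono : ∀ {m n : ℕ}, m ≤ n →
      {I | nonzeroIdealNorm O I ≤ m}.ncard ≤ {I | nonzeroIdealNorm O I ≤ n}.ncard :=
    fun {m n} h => Set.ncard_le_ncard (fun I hI => le_trans hI h) (hfin n)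
  refine ⟨h1le, hfin, ⟨min (κ / 2) (1 / (n₀ + 1)), by positivity, fun n hn => ?_⟩,
    ⟨2 * κ * (n₀ + 1), by positivity, fun n hn => ?_⟩⟩
  · rcases le_total n₀ n with h | h
    · refine le_trans ?_ (hbig n h hn).1
      gcongr
      exact min_le_left _ _
    · have h1 : 1 ≤ {I | nonzeroIdealNorm O I ≤ n}.ncard := by
        refine (Set.ncard_pos (hfin n)).2 ⟨⟨⊤, top_ne_bot⟩, ?_⟩
        simpa [nonzeroIdealNorm] using hn
      have h2 : min (κ / 2) (1 / (n₀ + 1 : ℝ)) * n ≤ 1 / (n₀ + 1) * n₀ := by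
        gcongr
        exact min_le_right _ _
      have h3 : 1 / (n₀ + 1 : ℝ) * n₀ ≤ 1 := by
        rw [one_div_mul_eq_div, div_le_one (by positivity)]; linarith
      have h4 : (1 : ℝ) ≤ ({I | nonzeroIdealNorm O I ≤ n}.ncard : ℝ) := by exact_mod_cast h1
      linarith
  · have h1 : (1 : ℝ) ≤ n := by exact_mod_cast hn
    have h2 := (hbig (max n (n₀ + 1)) (by omega) (by omega)).2
    have h3 : ({I | nonzeroIdealNorm O I ≤ n}.ncard : ℝ) ≤
        ({I | nonzeroIdealNorm O I ≤ max n (n₀ + 1)}.ncard : ℝ) := by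
      exact_mod_cast hmono (le_max_left _ _)
    have h4 : ((max n (n₀ + 1) : ℕ) : ℝ) ≤ (n₀ + 1) * n := by
      rw [Nat.cast_max]
      refine max_le ?_ ?_
      · nlinarith [(Nat.cast_nonneg n₀ : (0 : ℝ) ≤ n₀)]
      · push_cast
        nlinarith [(Nat.cast_nonneg n₀ : (0 : ℝ) ≤ n₀)]
    calc _ ≤ _ := h3.trans h2
      _ ≤ 2 * κ * ((n₀ + 1) * n) := by gcongr
      _ = _ := by ring

end NumberFieldCount

/-! ### Separating elements via derivations -/

section SeparatingElement

open IntermediateField Polynomial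

open scoped KaehlerDifferential

variable {F k : Type*} [Field F] [Field k] [Algebra F k]

/-- A derivation killing `x` kills `F(x)`, hence is `F(x)`-linear and factors through `Ω[k⁄F(x)] =
0`. -/
theorem Derivation.eq_zero_of_formallyUnramified_adjoin_simple {N : Type*} [AddCommGroup N]
    [Module F N] [Module k N] [IsScalarTower F k N] {x : k} [Algebra.FormallyUnramified F⟮x⟯ k]
    (D : Derivation F k N) (hD : D x = 0) : D = 0 := by
  have hpoly : ∀ r : F[X], D (aeval x r) = 0 := fun r => by
    rw [Derivation.map_aeval, hD, smul_zero]
  have hD' : ∀ c ∈ F⟮x⟯, D c = 0 := fun c hc => by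
    obtain ⟨r, s, rfl⟩ := (mem_adjoin_simple_iff F c).1 hc
    rw [Derivation.leibniz_div, hpoly, hpoly]; simp
  let E : Derivation F⟮x⟯ k N := Derivation.mk'
    { toFun := D
      map_add' := map_add D
      map_smul' := fun c z => by
        rw [Algebra.smul_def, Derivation.leibniz]
        change _ + z • D (c : k) = _
        rw [hD' c c.2, smul_zero, add_zero]; rfl }
    fun a b => D.leibniz a b
  ext z
  change E z = 0
  have hsub : Subsingleton (Ω[k⁄F⟮x⟯]) := Algebra.FormallyUnramified.subsingleton_kaehlerDifferential
  rw [← E.liftKaehlerDifferential_comp_D z, Subsingleton.elim (KaehlerDifferential.D F⟮x⟯ k z) 0,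
    map_zero]

/-- A derivation over `F` is determined by its value at `x`, so the universal derivation `d` over
`F(y)` is `D` times `(D x)⁻¹ • d x`. At `y` this reads `0 = D y • (D x)⁻¹ • d x`, whence `d x = 0`
and `d = 0`. -/
theorem formallyUnramified_adjoin_simple_of_derivation {x y : k}
    [Algebra.FormallyUnramified F⟮x⟯ k] (D : Derivation F k k) (hD : D y ≠ 0) :
    Algebra.FormallyUnramified F⟮y⟯ k := by
  have hx : D x ≠ 0 := fun h => hD (by
    rw [Derivation.eq_zero_of_formallyUnramified_adjoin_simple D h]; rfl)
  let d : Derivation F k (Ω[k⁄F⟮y⟯]) := (KaehlerDifferential.D F⟮y⟯ k).restrictScalars F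
  have hdy : d y = 0 := (KaehlerDifferential.D F⟮y⟯ k).map_algebraMap
    (⟨y, mem_adjoin_simple_self F y⟩ : F⟮y⟯)
  have hd := Derivation.eq_zero_of_formallyUnramified_adjoin_simple (x := x)
    (d - (LinearMap.toSpanSingleton k _ ((D x)⁻¹ • d x)).compDer D) (by
      simp [smul_smul, hx])
  have hz : ∀ z, d z = D z • (D x)⁻¹ • d x := fun z => by
    have := DFunLike.congr_fun hd z
    simpa [sub_eq_zero] using this
  have hdx : d x = 0 := by
    have := hz y
    rw [hdy, eq_comm, smul_eq_zero, smul_eq_zero] at this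
    simpa [hD, hx] using this
  have : (⊤ : Submodule k (Ω[k⁄F⟮y⟯])) ≤ ⊥ := by
    rw [← KaehlerDifferential.span_range_derivation, Submodule.span_le]
    rintro _ ⟨z, rfl⟩
    change d z = 0
    rw [hz, hdx, smul_zero, smul_zero]
  refine ⟨?_⟩
  exact subsingleton_of_forall_eq 0 fun w => this Submodule.mem_top

/-- A field that is finitely generated and of transcendence degree `1` over a perfect field is
separable over the field generated by some element of any ring of which it is the fraction field. -/
theorem exists_separating_element [PerfectField F] [Algebra.EssFiniteType F k]
    (htr : Algebra.trdeg F k = 1) (A : Type*) [CommRing A] [IsDomain A] [Algebra A k]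
    [IsFractionRing A k] :
    ∃ a : A, Algebra.FormallyUnramified F⟮algebraMap A k a⟯ k := by
  obtain ⟨s, hs, hsep⟩ := exists_isTranscendenceBasis_and_isSeparable_of_perfectField F k
  have hcard := hs.cardinalMk_eq_trdeg
  rw [htr] at hcard
  obtain ⟨x, rfl⟩ : ∃ x, s = {x} := by
    rw [← Finset.card_eq_one]
    simpa using hcard
  rw [Finset.coe_singleton] at hsep
  have : Algebra.EssFiniteType F⟮x⟯ k := Algebra.EssFiniteType.of_comp F F⟮x⟯ k
  have : Algebra.FormallyUnramified F⟮x⟯ k :=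
    (Algebra.FormallyUnramified.iff_isSeparable F⟮x⟯ k).2 hsep
  -- Otherwise `k` would be algebraic over `F`. This yields `d x ≠ 0`, and a linear form then gives
  -- a derivation `D` of `k` with `D x ≠ 0`.
  have hnot : ¬ Algebra.FormallyUnramified F k := fun h => by
    have := (Algebra.FormallyUnramified.iff_isSeparable F k).1 h
    have halg : Algebra.IsAlgebraic F k := inferInstance
    rw [trdeg_eq_zero_iff.2 halg] at htr
    exact zero_ne_one htr
  have hdx : KaehlerDifferential.D F k x ≠ 0 := fun h => hnot (by
    have h0 := Derivation.eq_zero_of_formallyUnramified_adjoin_simple _ h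
    refine ⟨?_⟩
    have : (⊤ : Submodule k (Ω[k⁄F])) ≤ ⊥ := by
      rw [← KaehlerDifferential.span_range_derivation, Submodule.span_le]
      rintro _ ⟨z, rfl⟩
      rw [h0]; rfl
    exact subsingleton_of_forall_eq 0 fun w => this Submodule.mem_top)
  obtain ⟨φ, hφ⟩ : ∃ φ : Module.Dual k (Ω[k⁄F]), φ (KaehlerDifferential.D F k x) ≠ 0 := by
    by_contra! h
    exact hdx ((Module.forall_dual_apply_eq_zero_iff k _).1 h)
  set D : Derivation F k k := φ.compDer (KaehlerDifferential.D F k)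
  have hD : D x ≠ 0 := hφ
  -- By the quotient rule `D` cannot vanish on both numerator and denominator of `x`, so one of them
  -- is separating.
  obtain ⟨a, b, -, hab⟩ := IsFractionRing.div_surjective (A := A) x
  by_cases ha : D (algebraMap A k a) = 0
  · by_cases hb : D (algebraMap A k b) = 0
    · exact absurd (by rw [← hab, Derivation.leibniz_div, ha, hb]; simp) hD
    · exact ⟨b, formallyUnramified_adjoin_simple_of_derivation (x := x) D hb⟩
  · exact ⟨a, formallyUnramified_adjoin_simple_of_derivation (x := x) D ha⟩

end SeparatingElement

/-! ### Integral closures inside an integrally closed ring -/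

section GlobalFieldModel

open IntermediateField Polynomial

/-- `A` contains `B` and is contained in the fraction field of `B`. -/
structure IsBirational (B A : Type*) [CommRing B] [CommRing A] [Algebra B A] : Prop where
  injective : Function.Injective (algebraMap B A)
  exists_mul_eq : ∀ a : A, ∃ b s : B, s ≠ 0 ∧ algebraMap B A s * a = algebraMap B A b

variable {A : Type*} [CommRing A] [IsDomain A] [IsIntegrallyClosed A]
  {k : Type*} [Field k] [Algebra A k] [IsFractionRing A k]

theorem exists_ringHom_of_forall_mem_range {R : Type*} [CommRing R] (φ : R →+* k)
    (h : ∀ r, ∃ a, algebraMap A k a = φ r) :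
    ∃ g : R →+* A, ∀ r, algebraMap A k (g r) = φ r := by
  choose f hf using h
  have hinj := IsFractionRing.injective A k
  exact ⟨{
    toFun := f
    map_one' := hinj (by rw [hf]; simp)
    map_zero' := hinj (by rw [hf]; simp)
    map_add' := fun a b => hinj (by simp [hf])
    map_mul' := fun a b => hinj (by simp [hf]) }, hf⟩

/-- Elements integral over `R` are integral over `A`, hence lie in `A`. Conversely every element of
`k`, being algebraic over `R`, has a non-zero `R`-multiple that is integral. -/
theorem exists_algebra_integralClosure_isBirational (R : Type*) [CommRing R] [IsDomain R]
    [Algebra R A] [Algebra R k] [IsScalarTower R A k] [FaithfulSMul R k]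
    [Algebra.IsAlgebraic R k] :
    ∃ _ : Algebra (integralClosure R k) A, IsBirational (integralClosure R k) A := by
  have hinj := IsFractionRing.injective A k
  obtain ⟨g, hg⟩ := exists_ringHom_of_forall_mem_range (A := A)
    (integralClosure R k).val.toRingHom fun (b : integralClosure R k) => IsIntegrallyClosed.isIntegral_iff.1 (b.2.tower_top (A := A))
  let _ := g.toAlgebra
  refine ⟨g.toAlgebra, fun a b hab => ?_, fun a => ?_⟩
  · have hab' : g a = g b := hab
    have h' := hg a
    rw [hab', hg b] at h'
    exact Subtype.ext h'.symm
  · obtain ⟨r, hr, hint⟩ :=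
      (Algebra.IsAlgebraic.isAlgebraic (R := R) (algebraMap A k a)).exists_integral_multiple
    refine ⟨⟨r • algebraMap A k a, hint⟩, algebraMap R _ r, fun h => hr ?_, hinj ?_⟩
    · have h' := congrArg Subtype.val h
      exact FaithfulSMul.algebraMap_injective R k (by simpa using h')
    · rw [map_mul]
      change algebraMap A k (g _) * _ = algebraMap A k (g _)
      rw [hg, hg]
      change algebraMap R k r * _ = r • _
      rw [Algebra.smul_def]

/-- `A` is not assumed to contain `F`, but the elements of a finite field are integral over `ℤ`.
This places `F[a]` inside `A`. -/
theorem isIntegral_aeval_polynomial {F : Type*} [Field F] [Finite F] [Algebra F k] (a : A)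
    (r : F[X]) : IsIntegral A (aeval (algebraMap A k a) r) := by
  induction r using Polynomial.induction_on' with
  | add p q hp hq => rw [map_add]; exact hp.add hq
  | monomial n c =>
    rw [aeval_monomial]
    refine IsIntegral.mul ?_ (isIntegral_algebraMap.pow n)
    have : Algebra.IsIntegral ℤ F := Algebra.IsIntegral.of_finite ℤ F
    have h := (Algebra.IsIntegral.isIntegral (R := ℤ) c).map (algebraMap F k).toIntAlgHom
    exact h.tower_top

end GlobalFieldModel

/-! ### A subring with linear ideal count -/

section

open IntermediateField Polynomial

/-- The ring is the integral closure of `F[y]` in `k`. Choosing `y` in `A` puts it inside `A`;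
choosing `y` separating makes it finite over `F[y]`, which matters because `k` may be inseparable
over the rational function field it was given with. -/
theorem exists_birational_subring_of_trdeg_eq_one {F : Type*} [Field F] [Finite F]
    (A : Type u) [CommRing A] [IsDedekindDomain A] (k : Type v) [Field k] [Algebra A k]
    [IsFractionRing A k] [Algebra F k] [Algebra.EssFiniteType F k] (htr : Algebra.trdeg F k = 1) :
    ∃ (B : Type v) (_ : CommRing B) (_ : IsDedekindDomain B) (_ : Infinite B)
      (_ : Ring.HasFiniteQuotients B) (_ : Algebra B A),
      HasLinearCount (nonzeroIdealNorm B) ∧ IsBirational B A := by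
  classical
  obtain ⟨a, ha⟩ := exists_separating_element (F := F) (k := k) htr A
  set y := algebraMap A k a with hy
  have : Algebra.EssFiniteType F⟮y⟯ k := Algebra.EssFiniteType.of_comp F F⟮y⟯ k
  have hsep : Algebra.IsSeparable F⟮y⟯ k := Algebra.FormallyUnramified.isSeparable _ _
  have hfin : Module.Finite F⟮y⟯ k := Algebra.FormallyUnramified.finite_of_free _ _
  have htrans : Transcendental F y := fun h => by
    have : Algebra.IsAlgebraic F F⟮y⟯ := isAlgebraic_adjoin_simple h.isIntegral
    have halg : Algebra.IsAlgebraic F k := Algebra.IsAlgebraic.trans F F⟮y⟯ k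
    rw [trdeg_eq_zero_iff.2 halg] at htr
    exact zero_ne_one htr
  let _ : Algebra F[X] F⟮y⟯ := (aeval (AdjoinSimple.gen F y)).toRingHom.toAlgebra
  let _ : Algebra F[X] k := (aeval y).toRingHom.toAlgebra
  have hmapk : ∀ r : F[X], algebraMap F[X] k r = aeval y r := fun r => rfl
  have hmapy : ∀ r : F[X], (algebraMap F[X] F⟮y⟯ r : k) = aeval y r := fun r => by
    exact (aeval_algHom_apply F⟮y⟯.val (AdjoinSimple.gen F y) r).symm
  have : IsScalarTower F[X] F⟮y⟯ k := IsScalarTower.of_algebraMap_eq fun r => (hmapy r).symm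
  have hinj : Function.Injective (algebraMap F[X] k) := transcendental_iff_injective.1 htrans
  have : FaithfulSMul F[X] k := (faithfulSMul_iff_algebraMap_injective _ _).2 hinj
  have : FaithfulSMul F[X] F⟮y⟯ := (faithfulSMul_iff_algebraMap_injective _ _).2 fun r s h =>
    hinj (by rw [hmapk, hmapk, ← hmapy, ← hmapy, h])
  have : IsFractionRing F[X] F⟮y⟯ := IsFractionRing.of_field _ _ fun z => by
    obtain ⟨r, s, hrs⟩ := (mem_adjoin_simple_iff F (z : k)).1 z.2
    refine ⟨r, s, Subtype.ext ?_⟩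
    rw [hrs, IntermediateField.coe_div, hmapy, hmapy]
  obtain ⟨g, hg⟩ := exists_ringHom_of_forall_mem_range (A := A) (algebraMap F[X] k) fun r =>
    IsIntegrallyClosed.isIntegral_iff.1 (isIntegral_aeval_polynomial a r)
  let _ : Algebra F[X] A := g.toAlgebra
  have : IsScalarTower F[X] A k := IsScalarTower.of_algebraMap_eq fun r => (hg r).symm
  have : Algebra.IsAlgebraic F[X] k :=
    (IsFractionRing.comap_isAlgebraic_iff (A := F[X]) (K := F⟮y⟯) (C := k)).2 inferInstance
  obtain ⟨i, hi⟩ := exists_algebra_integralClosure_isBirational (A := A) (k := k) F[X]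
  have : Module.Finite F[X] (integralClosure F[X] k) := IsIntegralClosure.finite F[X] F⟮y⟯ k _
  have : Module.Free F[X] (integralClosure F[X] k) := IsIntegralClosure.module_free F[X] F⟮y⟯ k _
  have hded : IsDedekindDomain (integralClosure F[X] k) :=
    integralClosure.isDedekindDomain F[X] F⟮y⟯ k
  have hinf : Infinite (integralClosure F[X] k) := Module.Free.infinite F[X] _
  have hq : Ring.HasFiniteQuotients (integralClosure F[X] k) := .of_module_finite F[X] _
  let b := Module.Free.chooseBasis F[X] (integralClosure F[X] k)
  have : Nonempty (Module.Free.ChooseBasisIndex F[X] (integralClosure F[X] k)) := b.index_nonempty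
  exact ⟨integralClosure F[X] k, inferInstance, hded, hinf, hq, i, hasLinearCount_of_basis b, hi⟩

/-- The ring of integers of a global field `k`, embedded in a given integrally closed ring with
fraction field `k`. -/
theorem IsGlobalField.exists_birational_subring (A : Type u) [CommRing A] [IsDedekindDomain A]
    (k : Type v) [Field k] [Algebra A k] [IsFractionRing A k] (hk : IsGlobalField k) :
    ∃ (B : Type v) (_ : CommRing B) (_ : IsDedekindDomain B) (_ : Infinite B)
      (_ : Ring.HasFiniteQuotients B) (_ : Algebra B A),
      HasLinearCount (nonzeroIdealNorm B) ∧ IsBirational B A := by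
  obtain hk | ⟨p, hp, halg, hfin⟩ := hk
  · have : Algebra.IsAlgebraic ℤ k :=
      (IsFractionRing.comap_isAlgebraic_iff (A := ℤ) (K := ℚ) (C := k)).2 inferInstance
    obtain ⟨i, hi⟩ := exists_algebra_integralClosure_isBirational (A := A) (k := k) ℤ
    exact ⟨NumberField.RingOfIntegers k, inferInstance, inferInstance,
      Module.Free.infinite ℤ _, inferInstance, i, hasLinearCount_ringOfIntegers k, hi⟩
  · let _ : Algebra (ZMod p) k := Algebra.compHom k (algebraMap (ZMod p) (RatFunc (ZMod p)))
    have : IsScalarTower (ZMod p) (RatFunc (ZMod p)) k := IsScalarTower.of_algebraMap_eq fun _ => rfl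
    let _ : Algebra (ZMod p)[X] k := Algebra.compHom k (algebraMap (ZMod p)[X] (RatFunc (ZMod p)))
    have : IsScalarTower (ZMod p)[X] (RatFunc (ZMod p)) k :=
      IsScalarTower.of_algebraMap_eq fun _ => rfl
    have : IsScalarTower (ZMod p) (ZMod p)[X] k := IsScalarTower.of_algebraMap_eq fun x => by
      rw [IsScalarTower.algebraMap_apply (ZMod p)[X] (RatFunc (ZMod p)) k,
        ← IsScalarTower.algebraMap_apply (ZMod p) (ZMod p)[X] (RatFunc (ZMod p))]; rfl
    have : Algebra.EssFiniteType (ZMod p)[X] (RatFunc (ZMod p)) :=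
      Algebra.EssFiniteType.of_isLocalization _ (nonZeroDivisors (ZMod p)[X])
    have : Algebra.EssFiniteType (ZMod p) (RatFunc (ZMod p)) :=
      Algebra.EssFiniteType.comp (ZMod p) (ZMod p)[X] (RatFunc (ZMod p))
    have : Algebra.EssFiniteType (ZMod p) k :=
      Algebra.EssFiniteType.comp (ZMod p) (RatFunc (ZMod p)) k
    have : FaithfulSMul (ZMod p)[X] k := (faithfulSMul_iff_algebraMap_injective _ _).2 <| by
      rw [IsScalarTower.algebraMap_eq (ZMod p)[X] (RatFunc (ZMod p)) k]
      exact (algebraMap (RatFunc (ZMod p)) k).injective.comp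
        (FaithfulSMul.algebraMap_injective _ _)
    have : Algebra.IsAlgebraic (ZMod p)[X] k :=
      (IsFractionRing.comap_isAlgebraic_iff (A := (ZMod p)[X]) (K := RatFunc (ZMod p))
        (C := k)).2 inferInstance
    have htr := lift_trdeg_add_eq (ZMod p) (ZMod p)[X] k
    rw [Polynomial.trdeg_of_isDomain, trdeg_eq_zero] at htr
    exact exists_birational_subring_of_trdeg_eq_one (F := ZMod p) A k (by simpa using htr.symm)

end

/-! ### Comparing the primes of `B` and `A` -/

section Birational

open IsDedekindDomain

variable {B A : Type*} [CommRing B] [IsDedekindDomain B] [CommRing A] [IsDedekindDomain A]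
  [Algebra B A]

/-- The localization at `P` is a valuation ring, so it contains `b / s` or `s / b`. -/
theorem exists_notMem_mul_eq_or (P : HeightOneSpectrum B) (b s : B) :
    ∃ u t : B, u ∉ P.asIdeal ∧ (b * u = s * t ∨ s * u = b * t) := by
  have := P.isPrime
  have : IsDiscreteValuationRing (Localization.AtPrime P.asIdeal) :=
    IsLocalization.AtPrime.isDiscreteValuationRing_of_dedekind_domain B P.ne_bot _
  have hinj : Function.Injective (algebraMap B (Localization.AtPrime P.asIdeal)) :=
    IsLocalization.injective _ P.asIdeal.primeCompl_le_nonZeroDivisors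
  obtain ⟨c, hc⟩ := ValuationRing.cond (algebraMap B (Localization.AtPrime P.asIdeal) b)
    (algebraMap B _ s)
  obtain ⟨⟨t, u⟩, hu⟩ := IsLocalization.surj P.asIdeal.primeCompl c
  simp only at hu
  refine ⟨u, t, u.2, ?_⟩
  rcases hc with hc | hc
  · right
    apply hinj
    rw [map_mul, map_mul, ← hu, ← hc, mul_assoc]
  · left
    apply hinj
    rw [map_mul, map_mul, ← hu, ← hc, mul_assoc]

namespace IsBirational

variable (h : IsBirational B A)
include h

theorem comap_ne_bot {I : Ideal A} (hI : I ≠ ⊥) : I.comap (algebraMap B A) ≠ ⊥ := by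
  obtain ⟨a, haI, ha⟩ := Submodule.exists_mem_ne_zero_of_ne_bot hI
  obtain ⟨b, s, hs, hsa⟩ := h.exists_mul_eq a
  have hs' : algebraMap B A s ≠ 0 := by
    rwa [Ne, map_eq_zero_iff _ h.injective]
  intro hbot
  have hb : b ∈ I.comap (algebraMap B A) := by
    rw [Ideal.mem_comap, ← hsa]; exact I.mul_mem_left _ haI
  rw [hbot, Ideal.mem_bot] at hb
  rw [hb, map_zero] at hsa
  exact mul_ne_zero hs' ha hsa

omit h in
/-- The prime of `B` below a prime of `A`. -/
def primeBelow (h : IsBirational B A) (v : HeightOneSpectrum A) : HeightOneSpectrum B where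
  asIdeal := v.asIdeal.comap (algebraMap B A)
  isPrime := v.isPrime.comap _
  ne_bot := h.comap_ne_bot v.ne_bot

theorem mem_primeBelow (v : HeightOneSpectrum A) (b : B) :
    b ∈ (h.primeBelow v).asIdeal ↔ algebraMap B A b ∈ v.asIdeal := Iff.rfl

/-- `A` lies in the localization of `B` at the prime below `v`. If `a⁻¹ = t / u` is what the
valuation ring provides, then `t` is also outside the prime, since `u = t * a`. Consequently `v` and
its residue field are determined by the prime below. -/
theorem exists_notMem_mul_eq (v : HeightOneSpectrum A) (a : A) :
    ∃ u b : B, u ∉ (h.primeBelow v).asIdeal ∧ algebraMap B A u * a = algebraMap B A b := by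
  obtain ⟨b, s, hs, hsa⟩ := h.exists_mul_eq a
  have hs' : algebraMap B A s ≠ 0 := by
    rwa [Ne, map_eq_zero_iff _ h.injective]
  obtain ⟨u, t, hu, hut | hut⟩ := exists_notMem_mul_eq_or (h.primeBelow v) b s
  · refine ⟨u, t, hu, mul_left_cancel₀ hs' ?_⟩
    rw [← map_mul, ← hut, map_mul, ← hsa]; ring
  · have hta : algebraMap B A t * a = algebraMap B A u := mul_left_cancel₀ hs' (by
      rw [← map_mul, hut, map_mul, ← hsa]; ring)
    refine ⟨t, u, fun ht => hu ?_, hta⟩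
    rw [mem_primeBelow, ← hta]
    exact v.asIdeal.mul_mem_right _ ht

theorem primeBelow_injective : Function.Injective h.primeBelow := by
  suffices hle : ∀ v w : HeightOneSpectrum A, h.primeBelow v = h.primeBelow w →
      v.asIdeal ≤ w.asIdeal from
    fun v w hvw => HeightOneSpectrum.ext (le_antisymm (hle v w hvw) (hle w v hvw.symm))
  intro v w hvw a ha
  obtain ⟨u, b, hu, hub⟩ := h.exists_notMem_mul_eq v a
  have hb : b ∈ (h.primeBelow v).asIdeal := by
    rw [mem_primeBelow, ← hub]; exact v.asIdeal.mul_mem_left _ ha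
  rw [hvw] at hb hu
  rw [mem_primeBelow] at hb hu
  rw [← hub] at hb
  exact (w.isPrime.mem_or_mem hb).resolve_left hu

theorem cardQuot_primeBelow (v : HeightOneSpectrum A) :
    Submodule.cardQuot (h.primeBelow v).asIdeal = Submodule.cardQuot v.asIdeal := by
  rw [Submodule.cardQuot_apply, Submodule.cardQuot_apply]
  change Nat.card (B ⧸ v.asIdeal.comap (algebraMap B A)) = _
  refine Nat.card_congr (Equiv.ofBijective
    (Ideal.quotientMap v.asIdeal (algebraMap B A) le_rfl) ⟨?_, fun x => ?_⟩)
  · exact Ideal.quotientMap_injective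
  · obtain ⟨a, rfl⟩ := Ideal.Quotient.mk_surjective x
    obtain ⟨u, b, hu, hub⟩ := h.exists_notMem_mul_eq v a
    obtain ⟨w, hw⟩ := (h.primeBelow v).isMaximal.exists_inv hu
    obtain ⟨i, hi, hwi⟩ := hw
    refine ⟨Ideal.Quotient.mk (v.asIdeal.comap (algebraMap B A)) (w * b), ?_⟩
    rw [Ideal.quotientMap_mk, Ideal.Quotient.eq]
    have hi' : algebraMap B A i ∈ v.asIdeal := hi
    have e : algebraMap B A w * algebraMap B A u + algebraMap B A i = 1 := by
      rw [← map_mul, ← map_add, hwi, map_one]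
    have : algebraMap B A (w * b) - a = -(algebraMap B A i * a) := by
      rw [map_mul, ← hub]
      linear_combination a * e
    rw [this]
    exact v.asIdeal.neg_mem (v.asIdeal.mul_mem_right _ hi')

/-- Multiplicativity of the norm reduces the claim to prime ideals, whose residue fields are residue
fields of `B`. -/
theorem hasFiniteQuotients [Infinite B] [Ring.HasFiniteQuotients B] :
    Ring.HasFiniteQuotients A where
  finiteQuotient {I} hI := by
    have : Infinite A := Infinite.of_injective _ h.injective
    suffices hpos : Submodule.cardQuot I ≠ 0 from Nat.finite_of_card_ne_zero hpos
    induction I using UniqueFactorizationMonoid.induction_on_prime with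
    | h₁ => exact absurd rfl hI
    | h₂ I hunit => rw [Ideal.isUnit_iff.1 hunit, Submodule.cardQuot_top]; exact one_ne_zero
    | h₃ I P hI0 hP ih =>
      rw [cardQuot_mul_of_infinite]
      have hv := h.cardQuot_primeBelow ⟨P, Ideal.isPrime_of_prime hP, hP.ne_zero⟩
      have := Ring.HasFiniteQuotients.cardQuot_pos _
        (h.primeBelow ⟨P, Ideal.isPrime_of_prime hP, hP.ne_zero⟩).ne_bot
      exact mul_ne_zero (hv ▸ this.ne') (ih hI0)

theorem sum_primeBelow (f : ℕ → ℝ) (S : Finset (HeightOneSpectrum A)) :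
    ∑ P ∈ S.map ⟨h.primeBelow, h.primeBelow_injective⟩, f (Submodule.cardQuot P.asIdeal) =
      ∑ v ∈ S, f (Submodule.cardQuot v.asIdeal) := by
  rw [Finset.sum_map]
  exact Finset.sum_congr rfl fun v _ => by
    rw [Function.Embedding.coeFn_mk, h.cardQuot_primeBelow]

/-- All but finitely many primes of `B` lie below a prime of `A`, if `A` is finitely generated. -/
theorem exists_ne_zero_forall_exists_primeBelow_eq (hA : Algebra.FiniteType ℤ A) :
    ∃ s : B, s ≠ 0 ∧ ∀ P : HeightOneSpectrum B, s ∉ P.asIdeal →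
      ∃ v : HeightOneSpectrum A, h.primeBelow v = P := by
  classical
  obtain ⟨t, ht⟩ := hA.out
  choose num den hden hnum using h.exists_mul_eq
  -- A common denominator of the generators: powers of `s` carry all of `A` into `B`.
  set s := ∏ a ∈ t, den a
  have hs : s ≠ 0 := Finset.prod_ne_zero_iff.2 fun a _ => hden a
  have hgen : ∀ a : A, ∃ (n : ℕ) (b : B), algebraMap B A s ^ n * a = algebraMap B A b := by
    intro a
    have ha : a ∈ Algebra.adjoin ℤ (t : Set A) := ht ▸ Algebra.mem_top
    induction ha using Algebra.adjoin_induction with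
    | mem a ha =>
      refine ⟨1, (∏ a ∈ t.erase a, den a) * num a, ?_⟩
      rw [pow_one, map_mul, ← hnum, ← mul_assoc, ← map_mul, Finset.prod_erase_mul _ _ ha]
    | algebraMap r => exact ⟨0, r, by simp⟩
    | add x y _ _ hx hy =>
      obtain ⟨n, b, hb⟩ := hx
      obtain ⟨m, c, hc⟩ := hy
      refine ⟨n + m, s ^ m * b + s ^ n * c, ?_⟩
      rw [map_add, map_mul, map_mul, ← hb, ← hc, map_pow, map_pow]
      ring
    | mul x y _ _ hx hy =>
      obtain ⟨n, b, hb⟩ := hx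
      obtain ⟨m, c, hc⟩ := hy
      refine ⟨n + m, b * c, ?_⟩
      rw [map_mul, ← hb, ← hc]
      ring
  refine ⟨s, hs, fun P hsP => ?_⟩
  have hP := P.isPrime
  -- Clearing denominators in the extended ideal. If it contained `1`, some power of `s` would lie
  -- in `P`; so it is proper, and a maximal ideal above it lies over `P`.
  have hmem : ∀ x ∈ P.asIdeal.map (algebraMap B A),
      ∃ (n : ℕ), ∃ b ∈ P.asIdeal, algebraMap B A s ^ n * x = algebraMap B A b := by
    intro x hx
    induction hx using Submodule.span_induction with
    | mem x hx =>
      obtain ⟨b, hb, rfl⟩ := hx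
      exact ⟨0, b, hb, by simp⟩
    | zero => exact ⟨0, 0, P.asIdeal.zero_mem, by simp⟩
    | add x y _ _ hx hy =>
      obtain ⟨n, b, hbP, hb⟩ := hx
      obtain ⟨m, c, hcP, hc⟩ := hy
      refine ⟨n + m, s ^ m * b + s ^ n * c, P.asIdeal.add_mem (P.asIdeal.mul_mem_left _ hbP)
        (P.asIdeal.mul_mem_left _ hcP), ?_⟩
      rw [map_add, map_mul, map_mul, ← hb, ← hc, map_pow, map_pow]
      ring
    | smul a x _ hx =>
      obtain ⟨n, b, hbP, hb⟩ := hx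
      obtain ⟨m, c, hc⟩ := hgen a
      refine ⟨m + n, c * b, P.asIdeal.mul_mem_left _ hbP, ?_⟩
      rw [map_mul, ← hb, ← hc, smul_eq_mul]
      ring
  have hne : P.asIdeal.map (algebraMap B A) ≠ ⊤ := fun htop => by
    obtain ⟨n, b, hb, hnb⟩ := hmem 1 (htop ▸ Submodule.mem_top)
    rw [mul_one, ← map_pow] at hnb
    exact hsP (hP.mem_of_pow_mem n (h.injective hnb ▸ hb))
  obtain ⟨m, hm, hle⟩ := Ideal.exists_le_maximal _ hne
  have hle' : P.asIdeal ≤ m.comap (algebraMap B A) := Ideal.map_le_iff_le_comap.1 hle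
  have hm0 : m ≠ ⊥ := by
    rintro rfl
    refine P.ne_bot (le_bot_iff.1 (hle'.trans fun b hb => ?_))
    have hb' : algebraMap B A b = 0 := hb
    exact (map_eq_zero_iff _ h.injective).1 hb'
  exact ⟨⟨m, hm.isPrime, hm0⟩, (HeightOneSpectrum.eq_of_le hle').symm⟩

end IsBirational

end Birational

/-! ### Mertens estimates over a global field -/

section MertensGlobal

open IsDedekindDomain

/-- The estimates for the primes of a Dedekind domain that enter the bounds for torsion. -/
structure HasMertensBounds (A : Type*) [CommRing A] : Prop where
  hasFiniteQuotients : Ring.HasFiniteQuotients A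
  infinite : Infinite A
  sum_inv_le : ∃ C : ℝ, ∀ x : ℝ, 3 ≤ x → ∀ S : Finset (HeightOneSpectrum A),
    (∀ v ∈ S, (Submodule.cardQuot v.asIdeal : ℝ) ≤ x) →
      ∑ v ∈ S, (1 / Submodule.cardQuot v.asIdeal : ℝ) ≤ Real.log (Real.log x) + C
  sum_inv_sq_le : ∃ C : ℝ, ∀ S : Finset (HeightOneSpectrum A),
    ∑ v ∈ S, (1 / (Submodule.cardQuot v.asIdeal : ℝ) ^ 2) ≤ C
  card_le : ∃ C : ℝ, ∀ n : ℕ, 1 ≤ n → ∀ S : Finset (HeightOneSpectrum A),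
    (∀ v ∈ S, Submodule.cardQuot v.asIdeal ≤ n) → (S.card : ℝ) ≤ C * n
  le_sum_inv : Algebra.FiniteType ℤ A → ∃ C : ℝ, ∀ n : ℕ, 3 ≤ n →
    ∀ S : Finset (HeightOneSpectrum A), (∀ v, v ∈ S ↔ Submodule.cardQuot v.asIdeal ≤ n) →
      Real.log (Real.log n) - C ≤ ∑ v ∈ S, (1 / Submodule.cardQuot v.asIdeal : ℝ)

theorem IsBirational.hasMertensBounds {B A : Type*} [CommRing B] [IsDedekindDomain B] [CommRing A]
    [IsDedekindDomain A] [Algebra B A] [Infinite B] [Ring.HasFiniteQuotients B]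
    (h : IsBirational B A) (hB : HasLinearCount (nonzeroIdealNorm B)) : HasMertensBounds A := by
  classical
  have hfq := h.hasFiniteQuotients
  obtain ⟨C, hup, hlow⟩ := exists_mertens_of_hasLinearCount hB
  set e : HeightOneSpectrum A ↪ HeightOneSpectrum B := ⟨h.primeBelow, h.primeBelow_injective⟩
  refine ⟨hfq, Infinite.of_injective _ h.injective, ⟨C, fun x hx S hS => ?_⟩, ?_, ?_, fun hA => ?_⟩
  · rw [← h.sum_primeBelow (fun n => (1 / n : ℝ))]
    refine hup x hx _ fun P hP => ?_
    obtain ⟨v, hv, rfl⟩ := Finset.mem_map.1 hP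
    rw [Function.Embedding.coeFn_mk, h.cardQuot_primeBelow]
    exact hS v hv
  · refine ⟨∑' P : HeightOneSpectrum B, (Submodule.cardQuot P.asIdeal : ℝ) ^ (-2 : ℝ),
      fun S => ?_⟩
    rw [← h.sum_primeBelow (fun n => (1 / (n : ℝ) ^ 2))]
    refine le_trans (le_of_eq (Finset.sum_congr rfl fun P _ => ?_))
      ((heightOneSpectrum_summable (hB.summable (by norm_num))).sum_le_tsum _
        fun P _ => by positivity)
    rw [Real.rpow_neg (by positivity), one_div]
    norm_cast
  · obtain ⟨D, hD, hcount⟩ := hB.upper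
    refine ⟨D, fun n hn S hS => le_trans ?_ (hcount n hn)⟩
    have hsub : ((S.map e).image fun P => (⟨P.asIdeal, P.ne_bot⟩ : {I : Ideal B // I ≠ ⊥})) ⊆
        (hB.finite n).toFinset := by
      intro I hI
      simp only [Finset.mem_image, Finset.mem_map] at hI
      obtain ⟨P, ⟨v, hv, rfl⟩, rfl⟩ := hI
      simp only [Set.Finite.mem_toFinset, Set.mem_ofPred_eq, nonzeroIdealNorm]
      exact (h.cardQuot_primeBelow v).le.trans (hS v hv)
    have hc := Finset.card_le_card hsub
    rw [Finset.card_image_of_injective _ fun P Q hPQ =>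
      HeightOneSpectrum.ext (congrArg Subtype.val hPQ), Finset.card_map,
      ← Set.ncard_eq_toFinset_card _ (hB.finite n)] at hc
    exact_mod_cast hc
  · obtain ⟨s, hs, hlift⟩ := h.exists_ne_zero_forall_exists_primeBelow_eq hA
    -- Only the primes containing `s` can fail to come from `A`; their total contribution is the
    -- constant `K`.
    have hfin : {P : HeightOneSpectrum B | s ∈ P.asIdeal}.Finite := by
      have := finite_heightOneSpectrum_ge (mt Ideal.span_singleton_eq_bot.1 hs)
      simpa [Ideal.span_singleton_le_iff_mem] using this
    set K := ∑ P ∈ hfin.toFinset, (1 / Submodule.cardQuot P.asIdeal : ℝ)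
    refine ⟨C + K, fun n hn S hS => ?_⟩
    have hsub : (Ring.HasFiniteQuotients.finite_cardQuot_heightOneSpectrum_le (R := B) n).toFinset ⊆
        S.map e ∪ hfin.toFinset := by
      intro P hP
      by_cases hsP : s ∈ P.asIdeal
      · exact Finset.mem_union_right _ (by simpa using hsP)
      · obtain ⟨v, rfl⟩ := hlift P hsP
        refine Finset.mem_union_left _ (Finset.mem_map.2 ⟨v, (hS v).2 ?_, rfl⟩)
        rw [← h.cardQuot_primeBelow]
        simpa using hP
    have h1 := hlow n hn
    have h2 : ∑ P ∈ S.map e ∪ hfin.toFinset, (1 / Submodule.cardQuot P.asIdeal : ℝ) ≤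
        ∑ P ∈ S.map e, (1 / Submodule.cardQuot P.asIdeal : ℝ) + K := by
      rw [← Finset.sum_union_inter]
      exact le_add_of_nonneg_right (Finset.sum_nonneg fun _ _ => by positivity)
    have h3 := Finset.sum_le_sum_of_subset_of_nonneg hsub
      (f := fun P => (1 / Submodule.cardQuot P.asIdeal : ℝ)) fun _ _ _ => by positivity
    rw [← h.sum_primeBelow (fun n => (1 / n : ℝ))]
    linarith

theorem IsGlobalField.hasMertensBounds (A : Type u) [CommRing A] [IsDedekindDomain A]
    (k : Type v) [Field k] [Algebra A k] [IsFractionRing A k] (hk : IsGlobalField k) :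
    HasMertensBounds A := by
  obtain ⟨B, _, _, _, _, _, hcount, hbir⟩ := hk.exists_birational_subring A k
  exact hbir.hasMertensBounds hcount

end MertensGlobal

/-! ### Counting homomorphisms and pointwise stabilizers -/

section HomCard

variable {A : Type*} [CommRing A]

theorem finite_linearMap (Q N : Type*) [AddCommGroup Q] [Module A Q] [AddCommGroup N] [Module A N]
    [Finite Q] [Finite N] : Finite (Q →ₗ[A] N) :=
  Finite.of_injective (fun f => (f : Q → N)) DFunLike.coe_injective

variable [IsDedekindDomain A]

/-- In `A ⧸ 𝔞`, the elements killed by `𝔟` are at most as many as the elements of `A ⧸ 𝔟`. -/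
theorem card_killed_le {𝔞 𝔟 : Ideal A} (h𝔞 : 𝔞 ≠ ⊥) [Finite (A ⧸ 𝔟)] :
    {z : A ⧸ 𝔞 | ∀ b ∈ 𝔟, b • z = 0}.ncard ≤ Nat.card (A ⧸ 𝔟) := by
  -- With `𝔞 = (𝔞 + 𝔟)𝔠`, the elements killed by `𝔟` form `𝔠/𝔞`. Ideals of `A/𝔞` are principal, so
  -- this is generated by the class of one `y`, and `c ↦ c y` maps `A/𝔟` onto it.
  obtain ⟨𝔠, h𝔠⟩ : 𝔞 ⊔ 𝔟 ∣ 𝔞 := Ideal.dvd_iff_le.2 le_sup_left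
  have h𝔡 : 𝔞 ⊔ 𝔟 ≠ 0 := fun h => h𝔞 (le_bot_iff.1 (le_sup_left.trans h.le))
  obtain ⟨y, hy⟩ := IsDedekindDomain.exists_sup_span_eq (I := 𝔞) (J := 𝔠)
    (h𝔠.le.trans Ideal.mul_le_right) h𝔞
  have hy𝔠 : y ∈ 𝔠 := hy ▸ Ideal.mem_sup_right (Ideal.mem_span_singleton_self y)
  have hker : 𝔟 ≤ (LinearMap.toSpanSingleton A (A ⧸ 𝔞) (Ideal.Quotient.mk 𝔞 y)).ker := by
    intro b hb
    rw [LinearMap.mem_ker, LinearMap.toSpanSingleton_apply, Algebra.smul_def,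
      Ideal.Quotient.algebraMap_eq, ← map_mul, Ideal.Quotient.eq_zero_iff_mem, h𝔠]
    exact Ideal.mul_mem_mul (Ideal.mem_sup_right hb) hy𝔠
  set f : (A ⧸ 𝔟) →ₗ[A] (A ⧸ 𝔞) := Submodule.liftQ 𝔟 _ hker
  have hsub : {z : A ⧸ 𝔞 | ∀ b ∈ 𝔟, b • z = 0} ⊆ Set.range f := by
    intro z hz
    obtain ⟨z, rfl⟩ := Ideal.Quotient.mk_surjective z
    have hz' : ∀ d ∈ 𝔞 ⊔ 𝔟, d * z ∈ 𝔞 := by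
      intro d hd
      obtain ⟨a, ha, b, hb, rfl⟩ := Submodule.mem_sup.1 hd
      rw [add_mul]
      refine 𝔞.add_mem (𝔞.mul_mem_right _ ha) ?_
      have := hz b hb
      rwa [Algebra.smul_def, Ideal.Quotient.algebraMap_eq, ← map_mul,
        Ideal.Quotient.eq_zero_iff_mem] at this
    have hz𝔠 : z ∈ 𝔠 := by
      rw [← Ideal.span_singleton_le_iff_mem, ← Ideal.dvd_iff_le]
      refine (mul_dvd_mul_iff_left h𝔡).1 ?_
      rw [← h𝔠, Ideal.dvd_iff_le, Ideal.mul_le]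
      intro d hd w hw
      obtain ⟨c, rfl⟩ := Ideal.mem_span_singleton'.1 hw
      rw [mul_left_comm]
      exact 𝔞.mul_mem_left _ (hz' d hd)
    rw [← hy] at hz𝔠
    obtain ⟨a, ha, w, hw, hz2⟩ := Submodule.mem_sup.1 hz𝔠
    obtain ⟨c, rfl⟩ := Ideal.mem_span_singleton'.1 hw
    refine ⟨Ideal.Quotient.mk 𝔟 c, ?_⟩
    change c • Ideal.Quotient.mk 𝔞 y = _
    rw [Algebra.smul_def, Ideal.Quotient.algebraMap_eq, ← map_mul, ← hz2, map_add,
      Ideal.Quotient.eq_zero_iff_mem.2 ha, zero_add]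
  calc _ ≤ (Set.range f).ncard := Set.ncard_le_ncard hsub (Set.finite_range f)
    _ ≤ _ := by
      rw [← Nat.card_coe_set_eq]
      exact Finite.card_range_le f

/-- Induction on `|Q|`. For a cyclic submodule `N ≅ A/𝔟`, restriction to `N` gives `|Hom(Q)| ≤
|Hom(Q/N)| |Hom(N)|`, and a homomorphism from `N` is given by an element of `A/𝔞` killed by `𝔟`. -/
theorem card_linearMap_quotient_le {𝔞 : Ideal A} (h𝔞 : 𝔞 ≠ ⊥) [Finite (A ⧸ 𝔞)]
    (Q : Type*) [AddCommGroup Q] [Module A Q] [Finite Q] :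
    Nat.card (Q →ₗ[A] A ⧸ 𝔞) ≤ Nat.card Q := by
  induction hn : Nat.card Q using Nat.strong_induction_on generalizing Q with
  | _ n ih =>
    subst hn
    rcases subsingleton_or_nontrivial Q with hQ | hQ
    · have : Subsingleton (Q →ₗ[A] A ⧸ 𝔞) :=
        ⟨fun f g => LinearMap.ext fun x => by rw [Subsingleton.elim x 0, map_zero, map_zero]⟩
      exact (Finite.card_le_one_iff_subsingleton.2 this).trans Nat.card_pos
    obtain ⟨x, hx⟩ := exists_ne (0 : Q)
    set N := Submodule.span A {x}
    have hN : 1 < Nat.card N := by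
      rw [Finite.one_lt_card_iff_nontrivial]
      exact ⟨⟨⟨x, Submodule.mem_span_singleton_self x⟩, 0, fun h => hx (congrArg Subtype.val h)⟩⟩
    have hcard := Submodule.card_eq_card_quotient_mul_card N
    have : Finite (Q ⧸ N) := Finite.of_surjective N.mkQ N.mkQ_surjective
    have hpos : 0 < Nat.card (Q ⧸ N) := Nat.card_pos
    have hlt : Nat.card (Q ⧸ N) < Nat.card Q := by rw [hcard]; nlinarith
    have hquot := ih _ hlt (Q ⧸ N) rfl
    have e := Ideal.quotTorsionOfEquivSpanSingleton A Q x
    have hfin : Finite (A ⧸ Ideal.torsionOf A Q x) := Finite.of_equiv _ e.symm.toEquiv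
    have hcyc : Nat.card (N →ₗ[A] A ⧸ 𝔞) ≤ Nat.card N := by
      rw [← Nat.card_congr e.toEquiv]
      refine le_trans ?_ (card_killed_le (𝔟 := Ideal.torsionOf A Q x) h𝔞)
      rw [← Nat.card_coe_set_eq]
      have hxN : x ∈ N := Submodule.mem_span_singleton_self x
      refine Nat.card_le_card_of_injective
        (fun φ => ⟨φ ⟨x, hxN⟩, fun b hb => ?_⟩) fun φ ψ h => ?_
      · rw [← map_smul]
        have : b • (⟨x, hxN⟩ : N) = 0 := Subtype.ext ((Ideal.mem_torsionOf_iff x b).1 hb)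
        rw [this, map_zero]
      · have h' : φ ⟨x, hxN⟩ = ψ ⟨x, hxN⟩ := congrArg Subtype.val h
        ext ⟨z, hz⟩
        obtain ⟨c, rfl⟩ := Submodule.mem_span_singleton.1 hz
        have : (⟨c • x, hz⟩ : N) = c • ⟨x, hxN⟩ := rfl
        rw [this, map_smul, map_smul, h']
    have := finite_linearMap (A := A) N (A ⧸ 𝔞)
    have := finite_linearMap (A := A) (Q ⧸ N) (A ⧸ 𝔞)
    have := finite_linearMap (A := A) Q (A ⧸ 𝔞)
    let res : (Q →ₗ[A] A ⧸ 𝔞) →ₗ[A] (N →ₗ[A] A ⧸ 𝔞) := LinearMap.lcomp A _ N.subtype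
    have hker : Nat.card res.ker ≤ Nat.card ((Q ⧸ N) →ₗ[A] A ⧸ 𝔞) := by
      have hle : ∀ φ : res.ker, N ≤ φ.1.ker := fun φ z hz =>
        LinearMap.congr_fun (LinearMap.mem_ker.1 φ.2) ⟨z, hz⟩
      refine Nat.card_le_card_of_injective (fun φ => N.liftQ φ.1 (hle φ)) fun φ ψ h => ?_
      refine Subtype.ext (LinearMap.ext fun z => ?_)
      exact LinearMap.congr_fun h (N.mkQ z)
    have hrange : Nat.card ((Q →ₗ[A] A ⧸ 𝔞) ⧸ res.ker) ≤ Nat.card (N →ₗ[A] A ⧸ 𝔞) := by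
      rw [Nat.card_congr res.quotKerEquivRange.toEquiv]
      exact Nat.card_le_card_of_injective _ Subtype.val_injective
    rw [Submodule.card_eq_card_quotient_mul_card res.ker, hcard, mul_comm (Nat.card N)]
    exact Nat.mul_le_mul (hker.trans hquot) (hrange.trans hcyc)

theorem card_linearMap_pi_le {𝔞 : Ideal A} (h𝔞 : 𝔞 ≠ ⊥) [Finite (A ⧸ 𝔞)] (r : ℕ)
    (Q : Type*) [AddCommGroup Q] [Module A Q] [Finite Q] :
    Nat.card (Q →ₗ[A] (Fin r → A ⧸ 𝔞)) ≤ Nat.card Q ^ r := by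
  have := finite_linearMap (A := A) Q (A ⧸ 𝔞)
  calc _ ≤ Nat.card (Fin r → (Q →ₗ[A] A ⧸ 𝔞)) :=
        Nat.card_le_card_of_injective (fun φ i => (LinearMap.proj i).comp φ) fun φ ψ h =>
          LinearMap.ext fun x => funext fun i => LinearMap.congr_fun (congrFun h i) x
    _ = Nat.card (Q →ₗ[A] A ⧸ 𝔞) ^ r := by rw [Nat.card_fun, Nat.card_fin]
    _ ≤ _ := Nat.pow_le_pow_left (card_linearMap_quotient_le h𝔞 Q) r

/-- The automorphisms of a free `A ⧸ 𝔞`-module that fix a submodule pointwise. -/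
theorem card_fixingSubgroup_mul_le {𝔞 : Ideal A} (h𝔞 : 𝔞 ≠ ⊥) [Finite (A ⧸ 𝔞)] {r : ℕ}
    {T : Type*} [AddCommGroup T] [Module A T] (e : T ≃ₗ[A] (Fin r → A ⧸ 𝔞)) (H : Submodule A T) :
    Nat.card (fixingSubgroup (T ≃ₗ[A] T) (H : Set T)) * Nat.card H ^ r ≤
      Nat.card (A ⧸ 𝔞) ^ (r * r) := by
  have : Finite T := Finite.of_equiv _ e.symm.toEquiv
  have : Finite (T ⧸ H) := Finite.of_surjective H.mkQ H.mkQ_surjective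
  have := finite_linearMap (A := A) (T ⧸ H) (Fin r → A ⧸ 𝔞)
  -- If `g` fixes `H`, then `g - 1` kills `H` and descends to `T/H`; it determines `g`.
  have hle : ∀ g : fixingSubgroup (T ≃ₗ[A] T) (H : Set T),
      H ≤ (e.toLinearMap.comp ((g : T ≃ₗ[A] T).toLinearMap - LinearMap.id)).ker := fun g x hx => by
    have := (mem_fixingSubgroup_iff _).1 g.2 x hx
    rw [LinearEquiv.smul_def] at this
    simp [this]
  have h1 : Nat.card (fixingSubgroup (T ≃ₗ[A] T) (H : Set T)) ≤ Nat.card (T ⧸ H) ^ r := by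
    refine le_trans (Nat.card_le_card_of_injective (fun g => H.liftQ _ (hle g)) fun g g' h => ?_)
      (card_linearMap_pi_le h𝔞 r (T ⧸ H))
    refine Subtype.ext (LinearEquiv.ext fun x => ?_)
    have := LinearMap.congr_fun h (H.mkQ x)
    have h' : e ((g : T ≃ₗ[A] T) x - x) = e ((g' : T ≃ₗ[A] T) x - x) := this
    exact sub_left_injective (e.injective h')
  calc _ ≤ Nat.card (T ⧸ H) ^ r * Nat.card H ^ r := Nat.mul_le_mul_right _ h1
    _ = Nat.card T ^ r := by
      rw [← mul_pow, Submodule.card_eq_card_quotient_mul_card H, mul_comm]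
    _ = _ := by rw [Nat.card_congr e.toEquiv, Nat.card_fun, Nat.card_fin, ← pow_mul]

end HomCard

/-! ### The order of `GL_r(A/𝔞)` and the index inequality -/

section GLCard

open IsDedekindDomain Matrix

theorem card_preimage_mul_card {G H : Type*} [AddGroup G] [AddGroup H] (f : G →+ H)
    (hf : Function.Surjective f) (U : Set H) :
    Nat.card (f ⁻¹' U) * Nat.card H = Nat.card U * Nat.card G := by
  have hs : ∀ (v : H) (k : f.ker), f (Function.surjInv hf v + k) = v := fun v k => by
    rw [map_add, Function.surjInv_eq hf, AddMonoidHom.mem_ker.1 k.2, add_zero]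
  have hk : ∀ g : G, -Function.surjInv hf (f g) + g ∈ f.ker := fun g => by
    rw [AddMonoidHom.mem_ker, map_add, map_neg, Function.surjInv_eq hf, neg_add_cancel]
  have key : ∀ V : Set H, Nat.card (f ⁻¹' V) = Nat.card V * Nat.card f.ker := fun V => by
    rw [← Nat.card_prod]
    let e : V × f.ker ≃ f ⁻¹' V :=
      { toFun := fun p => ⟨Function.surjInv hf p.1 + p.2,
          Set.mem_preimage.2 ((hs p.1 p.2).symm ▸ p.1.2)⟩
        invFun := fun g => ⟨⟨f g, g.2⟩, ⟨-Function.surjInv hf (f g) + g, hk g⟩⟩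
        left_inv := fun p => by
          refine Prod.ext (Subtype.ext (hs p.1 p.2)) (Subtype.ext ?_)
          simp only [hs, neg_add_cancel_left]
        right_inv := fun g => Subtype.ext (add_neg_cancel_left _ _) }
    exact (Nat.card_congr e).symm
  have h1 := key Set.univ
  rw [Set.preimage_univ, Nat.card_univ, Nat.card_univ] at h1
  rw [key U, h1]
  ring

/-- The proportion of invertible matrices among all `r × r` matrices over a field with `q`
elements. -/
noncomputable def glDensity (q r : ℕ) : ℝ := ∏ i ∈ Finset.range r, (1 - 1 / (q : ℝ) ^ (i + 1))

theorem card_GL_field_eq (F : Type*) [Field F] [Finite F] (r : ℕ) :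
    (Nat.card (GL (Fin r) F) : ℝ) = (Nat.card F : ℝ) ^ (r * r) * glDensity (Nat.card F) r := by
  have := Fintype.ofFinite F
  have hq : 0 < Fintype.card F := Fintype.card_pos
  rw [Matrix.card_GL_field, Nat.card_eq_fintype_card, glDensity, Nat.cast_prod,
    ← Finset.prod_range_reflect, Finset.prod_range (n := r), pow_mul,
    ← Fin.prod_const r ((Fintype.card F : ℝ) ^ r), ← Finset.prod_mul_distrib]
  refine Finset.prod_congr rfl fun i _ => ?_
  have hi := i.2
  rw [Nat.cast_sub (Nat.pow_le_pow_right hq hi.le), mul_sub, mul_one, mul_one_div]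
  push_cast
  congr 1
  rw [eq_div_iff (by positivity), ← pow_add]
  congr 1
  omega

variable {A : Type*} [CommRing A] [IsDedekindDomain A] {𝔞 : Ideal A}

theorem isUnit_quotient_iff (h𝔞 : 𝔞 ≠ ⊥) (x : A ⧸ 𝔞) :
    IsUnit x ↔ ∀ (v : HeightOneSpectrum A) (hv : 𝔞 ≤ v.asIdeal),
      Ideal.Quotient.factor hv x ≠ 0 := by
  obtain ⟨a, rfl⟩ := Ideal.Quotient.mk_surjective x
  constructor
  · intro h v hv h0
    have := v.isPrime
    exact not_isUnit_zero (h0 ▸ h.map (Ideal.Quotient.factor hv))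
  · intro h
    have htop : Ideal.span {a} ⊔ 𝔞 = ⊤ := by
      by_contra hne
      obtain ⟨m, hm, hle⟩ := Ideal.exists_le_maximal _ hne
      have hm𝔞 : 𝔞 ≤ m := le_sup_right.trans hle
      refine h ⟨m, hm.isPrime, fun hb => h𝔞 (le_bot_iff.1 (hb ▸ hm𝔞))⟩ hm𝔞 ?_
      rw [Ideal.Quotient.factor_mk, Ideal.Quotient.eq_zero_iff_mem]
      exact hle (Ideal.mem_sup_left (Ideal.mem_span_singleton_self a))
    obtain ⟨y, hy, z, hz, hyz⟩ := Submodule.mem_sup.1 ((Ideal.eq_top_iff_one _).1 htop)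
    obtain ⟨c, rfl⟩ := Ideal.mem_span_singleton'.1 hy
    refine IsUnit.of_mul_eq_one (Ideal.Quotient.mk 𝔞 c) ?_
    rw [← map_mul, ← map_one (Ideal.Quotient.mk 𝔞), Ideal.Quotient.eq, ← hyz]
    have : a * c - (c * a + z) = -z := by ring
    rw [this]
    exact 𝔞.neg_mem hz

theorem card_GL_eq_card_isUnit (R : Type*) [CommRing R] (r : ℕ) :
    Nat.card (GL (Fin r) R) = Nat.card {M : Matrix (Fin r) (Fin r) R | IsUnit M} :=
  Nat.card_congr (Equiv.ofInjective _ Units.val_injective)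

/-- The order of `GL_r(A/𝔞)`. -/
theorem card_GL_quotient [Ring.HasFiniteQuotients A] (h𝔞 : 𝔞 ≠ ⊥) (r : ℕ)
    {S : Finset (HeightOneSpectrum A)} (hS : ∀ v, v ∈ S ↔ 𝔞 ≤ v.asIdeal) :
    (Nat.card (GL (Fin r) (A ⧸ 𝔞)) : ℝ) =
      (Nat.card (A ⧸ 𝔞) : ℝ) ^ (r * r) * ∏ v ∈ S, glDensity (Submodule.cardQuot v.asIdeal) r := by
  classical
  have hle : ∀ v : S, 𝔞 ≤ v.1.asIdeal := fun v => (hS v).1 v.2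
  -- Reduction modulo all primes containing `𝔞` is onto by the Chinese remainder theorem, and a
  -- matrix is invertible exactly when all its reductions are. All fibres have the same size, so the
  -- proportion of invertible matrices is the product of the proportions over the residue fields.
  let f : Matrix (Fin r) (Fin r) (A ⧸ 𝔞) →+
      ((v : S) → Matrix (Fin r) (Fin r) (A ⧸ v.1.asIdeal)) :=
    AddMonoidHom.mk' (fun M v => M.map (Ideal.Quotient.factor (hle v))) fun M N => by
      ext v i j; simp
  have hsurj : Function.Surjective f := by
    intro N
    have hcrt : ∀ i j, ∃ y : A, ∀ v : S, Ideal.Quotient.mk v.1.asIdeal y = N v i j := by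
      intro i j
      choose x hx using fun v : S => Ideal.Quotient.mk_surjective (N v i j)
      obtain ⟨y, hy⟩ := IsDedekindDomain.exists_forall_sub_mem_ideal (s := S)
        (fun v => v.asIdeal) (fun _ => 1) (fun v _ => v.prime)
        (fun v _ w _ hvw h => hvw (HeightOneSpectrum.ext h)) x
      refine ⟨y, fun v => ?_⟩
      rw [← hx v, Ideal.Quotient.eq]
      simpa using hy v.1 v.2
    choose y hy using hcrt
    refine ⟨Matrix.of fun i j => Ideal.Quotient.mk 𝔞 (y i j), ?_⟩
    ext v i j
    simpa [f] using hy i j v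
  have hunit : {M : Matrix (Fin r) (Fin r) (A ⧸ 𝔞) | IsUnit M} =
      f ⁻¹' (Set.univ.pi fun v => {N | IsUnit N}) := by
    ext M
    simp only [Set.mem_ofPred_eq, Set.mem_preimage, Set.mem_univ_pi]
    rw [Matrix.isUnit_iff_isUnit_det, isUnit_quotient_iff h𝔞]
    have hdet : ∀ v : S, IsUnit (f M v) ↔ Ideal.Quotient.factor (hle v) M.det ≠ 0 := fun v => by
      have := v.1.isMaximal
      let _ := Ideal.Quotient.field v.1.asIdeal
      rw [Matrix.isUnit_iff_isUnit_det, RingHom.map_det, isUnit_iff_ne_zero]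
      rfl
    simp_rw [hdet]
    exact ⟨fun h v => h v.1 (hle v), fun h v hv => h ⟨v, (hS v).2 hv⟩⟩
  have := Ring.HasFiniteQuotients.finiteQuotient h𝔞
  have hfinv : ∀ v : HeightOneSpectrum A, Finite (A ⧸ v.asIdeal) := fun v =>
    Ring.HasFiniteQuotients.finiteQuotient v.ne_bot
  have key := card_preimage_mul_card f hsurj (Set.univ.pi fun v => {N | IsUnit N})
  rw [← hunit, ← card_GL_eq_card_isUnit] at key
  have hpi : Nat.card (Set.univ.pi fun v : S =>
      {N : Matrix (Fin r) (Fin r) (A ⧸ v.1.asIdeal) | IsUnit N}) =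
      ∏ v : S, Nat.card (GL (Fin r) (A ⧸ v.1.asIdeal)) := by
    rw [Nat.card_congr (Equiv.Set.univPi _), Nat.card_pi]
    exact Finset.prod_congr rfl fun v _ => (card_GL_eq_card_isUnit _ r).symm
  have hmat : ∀ R : Type _, Nat.card (Matrix (Fin r) (Fin r) R) = Nat.card R ^ (r * r) := fun R => by
    rw [Matrix, Nat.card_fun, Nat.card_fun, Nat.card_fin, ← pow_mul]
  rw [hpi, Nat.card_pi, hmat] at key
  have hGL : ∀ v : S, (Nat.card (GL (Fin r) (A ⧸ v.1.asIdeal)) : ℝ) =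
      (Nat.card (Matrix (Fin r) (Fin r) (A ⧸ v.1.asIdeal)) : ℝ) *
        glDensity (Submodule.cardQuot v.1.asIdeal) r := fun v => by
    have := v.1.isMaximal
    let _ := Ideal.Quotient.field v.1.asIdeal
    rw [hmat, Nat.cast_pow, Submodule.cardQuot_apply]
    exact card_GL_field_eq (A ⧸ v.1.asIdeal) r
  have key' : (Nat.card (GL (Fin r) (A ⧸ 𝔞)) : ℝ) *
      ∏ v : S, (Nat.card (Matrix (Fin r) (Fin r) (A ⧸ v.1.asIdeal)) : ℝ) =
      (∏ v : S, (Nat.card (GL (Fin r) (A ⧸ v.1.asIdeal)) : ℝ)) * (Nat.card (A ⧸ 𝔞) : ℝ) ^ (r * r) := by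
    exact_mod_cast key
  rw [Finset.prod_congr rfl fun v _ => hGL v, Finset.prod_mul_distrib] at key'
  have hpos : (∏ v : S, (Nat.card (Matrix (Fin r) (Fin r) (A ⧸ v.1.asIdeal)) : ℝ)) ≠ 0 := by
    refine Finset.prod_ne_zero_iff.2 fun v _ => ?_
    have : 0 < Nat.card (Matrix (Fin r) (Fin r) (A ⧸ v.1.asIdeal)) := Nat.card_pos
    positivity
  rw [← Finset.prod_coe_sort S]
  apply mul_right_cancel₀ hpos
  rw [key']
  ring

theorem card_linearEquiv_eq_card_GL {r : ℕ} {T : Type*} [AddCommGroup T] [Module A T]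
    (e : T ≃ₗ[A] (Fin r → A ⧸ 𝔞)) :
    Nat.card (T ≃ₗ[A] T) = Nat.card (GL (Fin r) (A ⧸ 𝔞)) := by
  let e₁ : (T ≃ₗ[A] T) ≃ ((Fin r → A ⧸ 𝔞) ≃ₗ[A] (Fin r → A ⧸ 𝔞)) :=
    { toFun := fun g => e.symm.trans (g.trans e)
      invFun := fun g => e.trans (g.trans e.symm)
      left_inv := fun g => by ext; simp
      right_inv := fun g => by ext; simp }
  have hs : Function.Surjective (algebraMap A (A ⧸ 𝔞)) := Ideal.Quotient.mk_surjective
  let e₂ : ((Fin r → A ⧸ 𝔞) ≃ₗ[A] (Fin r → A ⧸ 𝔞)) ≃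
      ((Fin r → A ⧸ 𝔞) ≃ₗ[A ⧸ 𝔞] (Fin r → A ⧸ 𝔞)) :=
    { toFun := fun g => g.extendScalarsOfSurjective hs
      invFun := fun g => g.restrictScalars A
      left_inv := fun g => rfl
      right_inv := fun g => rfl }
  exact Nat.card_congr ((e₁.trans e₂).trans ((Matrix.GeneralLinearGroup.toLin.trans
    (LinearMap.GeneralLinearGroup.generalLinearEquiv _ _)).symm.toEquiv))

/-- The main inequality: the index of a group of automorphisms of a free `A/𝔞`-module of rank `r`
that fixes the submodule `H` pointwise is almost as large as `|H| ^ r`. -/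
theorem card_pow_mul_prod_glDensity_le_index [Ring.HasFiniteQuotients A] (h𝔞 : 𝔞 ≠ ⊥) {r : ℕ}
    {T : Type*} [AddCommGroup T] [Module A T] (e : T ≃ₗ[A] (Fin r → A ⧸ 𝔞))
    {S : Finset (HeightOneSpectrum A)} (hS : ∀ v, v ∈ S ↔ 𝔞 ≤ v.asIdeal) (H : Submodule A T)
    (G : Subgroup (T ≃ₗ[A] T)) (hG : ∀ g ∈ G, ∀ x ∈ H, g x = x) :
    (Nat.card H : ℝ) ^ r * ∏ v ∈ S, glDensity (Submodule.cardQuot v.asIdeal) r ≤ G.index := by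
  have := Ring.HasFiniteQuotients.finiteQuotient h𝔞
  have : Finite T := Finite.of_equiv _ e.symm.toEquiv
  have hfinAut : Finite (T ≃ₗ[A] T) :=
    Finite.of_injective (fun f => (f : T → T)) DFunLike.coe_injective
  have hle : G ≤ fixingSubgroup (T ≃ₗ[A] T) (H : Set T) := fun g hg =>
    (mem_fixingSubgroup_iff _).2 fun x hx => hG g hg x hx
  set Fx := fixingSubgroup (T ≃ₗ[A] T) (H : Set T)
  have h1 : Fx.index ≤ G.index :=
    Subgroup.index_antitone hle
  have h2 : Fx.index * Nat.card Fx = Nat.card (T ≃ₗ[A] T) := Fx.index_mul_card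
  have h3 : (Nat.card Fx : ℝ) * (Nat.card H : ℝ) ^ r ≤ (Nat.card (A ⧸ 𝔞) : ℝ) ^ (r * r) := by
    exact_mod_cast card_fixingSubgroup_mul_le h𝔞 e H
  have h4 : (Fx.index : ℝ) * (Nat.card Fx : ℝ) = (Nat.card (A ⧸ 𝔞) : ℝ) ^ (r * r) *
      ∏ v ∈ S, glDensity (Submodule.cardQuot v.asIdeal) r := by
    rw [← card_GL_quotient h𝔞 r hS, ← card_linearEquiv_eq_card_GL e]
    exact_mod_cast h2
  have hFx : (0 : ℝ) < Nat.card Fx := by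
    have : 0 < Nat.card Fx := Nat.card_pos
    exact_mod_cast this
  have hprod : 0 ≤ ∏ v ∈ S, glDensity (Submodule.cardQuot v.asIdeal) r := by
    by_contra hneg
    push Not at hneg
    have hR : (0 : ℝ) < (Nat.card (A ⧸ 𝔞) : ℝ) ^ (r * r) := by
      have : 0 < Nat.card (A ⧸ 𝔞) := Nat.card_pos
      positivity
    have : (0 : ℝ) ≤ (Fx.index : ℝ) * (Nat.card Fx : ℝ) := by positivity
    rw [h4] at this
    exact absurd this (not_le.2 (mul_neg_of_pos_of_neg hR hneg))
  refine le_trans ?_ (Nat.cast_le.2 h1)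
  apply le_of_mul_le_mul_right _ hFx
  rw [h4]
  calc _ = (Nat.card Fx : ℝ) * (Nat.card H : ℝ) ^ r *
        ∏ v ∈ S, glDensity (Submodule.cardQuot v.asIdeal) r := by ring
    _ ≤ _ := by gcongr

end GLCard

/-! ### Galois groups, rational torsion and torsion fields -/

section GaloisImage

open IsDedekindDomain

section

variable {K : Type w} [Field K]

/-- The absolute Galois group of `L`, as a subgroup of the absolute Galois group of `K`. -/
noncomputable def absGalSubgroup (L : IntermediateField K (AlgebraicClosure K)) : Subgroup (AbsGal K) :=
  (L.comap (separableClosure K (AlgebraicClosure K)).val).fixingSubgroup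

theorem mem_absGalSubgroup {L : IntermediateField K (AlgebraicClosure K)} {σ : AbsGal K} :
    σ ∈ absGalSubgroup L ↔ ∀ z : SeparableClosure K, (z : AlgebraicClosure K) ∈ L → σ z = z :=
  IntermediateField.mem_fixingSubgroup_iff _ _

/-- The index is the degree of `L ∩ K^sep`, which may be less than `[L:K]` when `L` is inseparable;
the inequality is all that the upper bounds use. -/
theorem index_absGalSubgroup (L : IntermediateField K (AlgebraicClosure K))
    [FiniteDimensional K L] :
    (absGalSubgroup L).index ≠ 0 ∧ (absGalSubgroup L).index ≤ Module.finrank K L := by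
  let E : IntermediateField K (SeparableClosure K) :=
    L.comap (separableClosure K (AlgebraicClosure K)).val
  let f : E →ₗ[K] L :=
    { toFun := fun z => ⟨(z : SeparableClosure K), z.2⟩
      map_add' := fun _ _ => rfl
      map_smul' := fun _ _ => rfl }
  have hf : Function.Injective f := fun a b h =>
    Subtype.ext (Subtype.ext (congrArg (fun z : L => (z : AlgebraicClosure K)) h))
  have hE : FiniteDimensional K E := FiniteDimensional.of_injective f hf
  have h : (absGalSubgroup L).index = Module.finrank K E :=
    (IntermediateField.finrank_eq_fixingSubgroup_index (E' := SeparableClosure K) E).symm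
  exact ⟨h ▸ Module.finrank_pos.ne', h ▸ LinearMap.finrank_le_finrank_of_injective hf⟩

end

variable {K : Type w} [Field K] {A : Type u} [CommRing A]
  {M : Type x} [AddCommGroup M] [Module A M] [DistribMulAction (AbsGal K) M]

theorem rationalPoints_subset (H : Set M) (L : IntermediateField K (AlgebraicClosure K)) :
    rationalPoints H L ⊆ H := fun _ h => h.1

theorem rationalPoints_mono {H H' : Set M} (h : H ⊆ H')
    (L : IntermediateField K (AlgebraicClosure K)) : rationalPoints H L ⊆ rationalPoints H' L :=
  fun _ hy => ⟨h hy.1, hy.2⟩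

variable [SMulCommClass (AbsGal K) A M]

/-- `M[𝔞](L)`, as a submodule of `M[𝔞]`. -/
def rationalTorsion (𝔞 : Ideal A) (L : IntermediateField K (AlgebraicClosure K)) :
    Submodule A (idealTorsion A M 𝔞) where
  carrier := {y | ∀ σ ∈ absGalSubgroup L, σ • (y : M) = y}
  add_mem' {a b} ha hb σ hσ := by rw [Submodule.coe_add, smul_add, ha σ hσ, hb σ hσ]
  zero_mem' σ _ := smul_zero σ
  smul_mem' a y hy σ hσ := by rw [Submodule.coe_smul, smul_comm, hy σ hσ]

theorem image_rationalTorsion (𝔞 : Ideal A) (L : IntermediateField K (AlgebraicClosure K)) :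
    rationalPoints (idealTorsion A M 𝔞 : Set M) L =
      Subtype.val '' (rationalTorsion (M := M) 𝔞 L : Set (idealTorsion A M 𝔞)) := by
  ext y
  constructor
  · rintro ⟨hy, h⟩
    exact ⟨⟨y, hy⟩, fun σ hσ => h σ (mem_absGalSubgroup.1 hσ), rfl⟩
  · rintro ⟨y, h, rfl⟩
    exact ⟨y.2, fun σ hσ => h σ (mem_absGalSubgroup.2 hσ)⟩

theorem ncard_rationalPoints_idealTorsion (𝔞 : Ideal A)
    (L : IntermediateField K (AlgebraicClosure K)) :
    (rationalPoints (idealTorsion A M 𝔞 : Set M) L).ncard =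
      Nat.card (rationalTorsion (M := M) 𝔞 L) := by
  rw [image_rationalTorsion, Set.ncard_image_of_injective _ Subtype.val_injective,
    ← Nat.card_coe_set_eq]
  rfl

theorem HasTorsionRank.finite_idealTorsion [Ring.HasFiniteQuotients A] {r : ℕ}
    (hM : HasTorsionRank A M r) {𝔞 : Ideal A} (h𝔞 : 𝔞 ≠ ⊥) : Finite (idealTorsion A M 𝔞) := by
  obtain ⟨e⟩ := hM 𝔞 h𝔞
  have := Ring.HasFiniteQuotients.finiteQuotient h𝔞
  exact Finite.of_equiv _ e.symm.toEquiv

theorem HasTorsionRank.card_idealTorsion {r : ℕ} (hM : HasTorsionRank A M r) {𝔞 : Ideal A}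
    (h𝔞 : 𝔞 ≠ ⊥) : Nat.card (idealTorsion A M 𝔞) = Submodule.cardQuot 𝔞 ^ r := by
  obtain ⟨e⟩ := hM 𝔞 h𝔞
  rw [Nat.card_congr e.toEquiv, Nat.card_fun, Nat.card_fin, Submodule.cardQuot_apply]

/-- The image of `G_L` fixes `M[𝔞](L)`, and its index is `I(𝔞)` times the index of that image in the
image of `G_K`, which is at most `[L:K]`. -/
theorem ncard_pow_mul_prod_glDensity_le [IsDedekindDomain A] [Ring.HasFiniteQuotients A] {r : ℕ}
    (hM : HasTorsionRank A M r) {𝔞 : Ideal A} (h𝔞 : 𝔞 ≠ ⊥)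
    {S : Finset (HeightOneSpectrum A)} (hS : ∀ v, v ∈ S ↔ 𝔞 ≤ v.asIdeal)
    (L : IntermediateField K (AlgebraicClosure K)) [FiniteDimensional K L] :
    ((rationalPoints (idealTorsion A M 𝔞 : Set M) L).ncard : ℝ) ^ r *
      ∏ v ∈ S, glDensity (Submodule.cardQuot v.asIdeal) r ≤ galoisIndex K A M 𝔞 * deg L := by
  obtain ⟨e⟩ := hM 𝔞 h𝔞
  rw [ncard_rationalPoints_idealTorsion]
  set ρ := galoisRep K A M 𝔞
  refine (card_pow_mul_prod_glDensity_le_index h𝔞 e hS (rationalTorsion (M := M) 𝔞 L)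
    ((absGalSubgroup L).map ρ) ?_).trans ?_
  · rintro _ ⟨σ, hσ, rfl⟩ y hy
    exact Subtype.ext (hy σ hσ)
  · obtain ⟨h0, h1⟩ := index_absGalSubgroup L
    have h2 : (absGalSubgroup L ⊔ ρ.ker).index ≤ (absGalSubgroup L).index :=
      Nat.le_of_dvd (Nat.pos_of_ne_zero h0) (Subgroup.index_dvd_of_le le_sup_left)
    rw [Subgroup.index_map, mul_comm]
    have : ρ.range.index * (absGalSubgroup L ⊔ ρ.ker).index ≤
        galoisIndex K A M 𝔞 * Module.finrank K L :=
      Nat.mul_le_mul le_rfl (h2.trans h1)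
    rw [deg]
    exact_mod_cast this

/-- The field generated by the `𝔞`-torsion: the fixed field of the kernel of `ρ_𝔞`. -/
noncomputable def torsionField (K : Type w) [Field K] {A : Type u} [CommRing A]
    (M : Type x) [AddCommGroup M] [Module A M] [DistribMulAction (AbsGal K) M]
    [SMulCommClass (AbsGal K) A M] (𝔞 : Ideal A) : IntermediateField K (AlgebraicClosure K) :=
  (IntermediateField.fixedField (galoisRep K A M 𝔞).ker).map
    (separableClosure K (AlgebraicClosure K)).val

theorem mem_ker_galoisRep {𝔞 : Ideal A} {σ : AbsGal K} :
    σ ∈ (galoisRep K A M 𝔞).ker ↔ ∀ y ∈ idealTorsion A M 𝔞, σ • y = y := by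
  rw [MonoidHom.mem_ker]
  constructor
  · intro h y hy
    exact congrArg Subtype.val (LinearEquiv.congr_fun h ⟨y, hy⟩)
  · intro h
    exact LinearEquiv.ext fun y => Subtype.ext (h y y.2)

theorem torsionField_mono {𝔞 𝔟 : Ideal A} (h : 𝔟 ≤ 𝔞) : torsionField K M 𝔞 ≤ torsionField K M 𝔟 := by
  refine IntermediateField.map_mono _ (IntermediateField.fixedField_antitone ?_)
  intro σ hσ
  rw [mem_ker_galoisRep] at hσ ⊢
  exact fun y hy => hσ y (Submodule.torsionBySet_le_torsionBySet_of_subset h hy)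

section Continuous

variable [Ring.HasFiniteQuotients A] {r : ℕ}

/-- `M[𝔞]` is finite, so the kernel is a finite intersection of open stabilizers. Being open it is
closed, and the Galois correspondence recovers it from its fixed field. -/
theorem HasTorsionRank.fixingSubgroup_fixedField_ker (hM : HasTorsionRank A M r)
    (hc : IsContinuousOnTorsion K A M) {𝔞 : Ideal A} (h𝔞 : 𝔞 ≠ ⊥) :
    IsOpen ((galoisRep K A M 𝔞).ker : Set (AbsGal K)) ∧
    (IntermediateField.fixedField (galoisRep K A M 𝔞).ker).fixingSubgroup =
      (galoisRep K A M 𝔞).ker := by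
  have hfin := hM.finite_idealTorsion h𝔞
  have hopen : IsOpen ((galoisRep K A M 𝔞).ker : Set (AbsGal K)) := by
    have : ((galoisRep K A M 𝔞).ker : Set (AbsGal K)) =
        ⋂ y : idealTorsion A M 𝔞, (MulAction.stabilizer (AbsGal K) (y : M) : Set (AbsGal K)) := by
      ext σ
      rw [SetLike.mem_coe, mem_ker_galoisRep]
      simp [MulAction.mem_stabilizer_iff]
    rw [this]
    exact isOpen_iInter_of_finite fun y => hc y ⟨𝔞, h𝔞, y.2⟩
  exact ⟨hopen, InfiniteGalois.fixingSubgroup_fixedField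
    ⟨(galoisRep K A M 𝔞).ker, Subgroup.isClosed_of_isOpen _ hopen⟩⟩

theorem HasTorsionRank.finiteDimensional_torsionField (hM : HasTorsionRank A M r)
    (hc : IsContinuousOnTorsion K A M) {𝔞 : Ideal A} (h𝔞 : 𝔞 ≠ ⊥) :
    FiniteDimensional K (torsionField K M 𝔞) := by
  obtain ⟨ho, hfix⟩ := hM.fixingSubgroup_fixedField_ker hc h𝔞
  have : FiniteDimensional K (IntermediateField.fixedField (galoisRep K A M 𝔞).ker) := by
    rw [← InfiniteGalois.isOpen_iff_finite, hfix]
    exact ho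
  exact LinearEquiv.finiteDimensional (IntermediateField.equivMap
    (IntermediateField.fixedField (galoisRep K A M 𝔞).ker)
    (separableClosure K (AlgebraicClosure K)).val).toLinearEquiv

theorem HasTorsionRank.finrank_torsionField_le (hM : HasTorsionRank A M r)
    (hc : IsContinuousOnTorsion K A M) {𝔞 : Ideal A} (h𝔞 : 𝔞 ≠ ⊥) :
    Module.finrank K (torsionField K M 𝔞) ≤
      Nat.card (idealTorsion A M 𝔞 ≃ₗ[A] idealTorsion A M 𝔞) := by
  obtain ⟨ho, hfix⟩ := hM.fixingSubgroup_fixedField_ker hc h𝔞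
  have hfin := hM.finite_idealTorsion h𝔞
  have hfinAut : Finite (idealTorsion A M 𝔞 ≃ₗ[A] idealTorsion A M 𝔞) :=
    Finite.of_injective (fun f => (f : idealTorsion A M 𝔞 → idealTorsion A M 𝔞))
      DFunLike.coe_injective
  rw [torsionField, ← LinearEquiv.finrank_eq (IntermediateField.equivMap
    (IntermediateField.fixedField (galoisRep K A M 𝔞).ker)
    (separableClosure K (AlgebraicClosure K)).val).toLinearEquiv,
    IntermediateField.finrank_eq_fixingSubgroup_index, hfix, Subgroup.index_ker]
  exact Nat.card_le_card_of_injective _ Subtype.val_injective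

theorem HasTorsionRank.idealTorsion_subset_rationalPoints (hM : HasTorsionRank A M r)
    (hc : IsContinuousOnTorsion K A M) {𝔞 : Ideal A} (h𝔞 : 𝔞 ≠ ⊥) :
    (idealTorsion A M 𝔞 : Set M) ⊆
      rationalPoints (idealTorsion A M 𝔞 : Set M) (torsionField K M 𝔞) := by
  refine fun y hy => ⟨hy, fun σ hσ => ?_⟩
  obtain ⟨ho, hfix⟩ := hM.fixingSubgroup_fixedField_ker hc h𝔞
  refine mem_ker_galoisRep.1 (hfix ▸ (IntermediateField.mem_fixingSubgroup_iff _ _).2 ?_) y hy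
  intro z hz
  exact hσ z ⟨z, hz, rfl⟩

end Continuous

end GaloisImage

/-! ### Bounds for products of densities -/

section Density

open IsDedekindDomain

theorem glDensity_pos {q : ℕ} (hq : 2 ≤ q) (r : ℕ) : 0 < glDensity q r := by
  have hq' : (1 : ℝ) < q := by exact_mod_cast hq
  refine Finset.prod_pos fun i _ => ?_
  rw [sub_pos, div_lt_one (by positivity)]
  exact one_lt_pow₀ hq' (by omega)

theorem glDensity_le_one {q : ℕ} (hq : 2 ≤ q) (r : ℕ) : glDensity q r ≤ 1 := by
  have hq' : (1 : ℝ) ≤ q := by exact_mod_cast (by omega : 1 ≤ q)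
  refine Finset.prod_le_one (fun i _ => ?_) fun i _ => ?_
  · rw [sub_nonneg, div_le_one (by positivity)]
    exact one_le_pow₀ hq'
  · rw [sub_le_self_iff]
    positivity

theorem glDensity_le_exp {q : ℕ} (hq : 2 ≤ q) {r : ℕ} (hr : 1 ≤ r) :
    glDensity q r ≤ Real.exp (-(1 / (q : ℝ))) := by
  obtain ⟨s, rfl⟩ := Nat.exists_eq_add_of_le' hr
  have hq' : (1 : ℝ) ≤ q := by exact_mod_cast (by omega : 1 ≤ q)
  rw [glDensity, Finset.prod_range_succ']
  have h0 : (0 : ℝ) ≤ 1 - 1 / (q : ℝ) ^ (0 + 1) := by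
    rw [sub_nonneg, div_le_one (by positivity)]
    exact one_le_pow₀ hq'
  have h1 : ∏ i ∈ Finset.range s, (1 - 1 / (q : ℝ) ^ (i + 1 + 1)) ≤ 1 := by
    refine Finset.prod_le_one (fun i _ => ?_) fun i _ => ?_
    · rw [sub_nonneg, div_le_one (by positivity)]
      exact one_le_pow₀ hq'
    · rw [sub_le_self_iff]
      positivity
  refine (mul_le_of_le_one_left h0 h1).trans ?_
  rw [zero_add, pow_one]
  linarith [Real.add_one_le_exp (-(1 / (q : ℝ)))]

/-- With `x = 1 / q`, the factor `1 - x` supplies the main term; each of the `r` factors costs an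
error of at most `3 * x ^ 2`, since the later ones involve `x ^ (i + 1) ≤ x ^ 2`. -/
theorem exp_neg_le_glDensity {q : ℕ} (hq : 2 ≤ q) (r : ℕ) :
    Real.exp (-(1 / (q : ℝ) + 3 * r * (1 / (q : ℝ) ^ 2))) ≤ glDensity q r := by
  have hq' : (2 : ℝ) ≤ q := by exact_mod_cast hq
  set x : ℝ := 1 / (q : ℝ)
  have hx0 : 0 ≤ x := by positivity
  have hx : x ≤ 1 / 2 := one_div_le_one_div_of_le (by norm_num) hq'
  have hpow : ∀ n : ℕ, 1 / (q : ℝ) ^ n = x ^ n := fun n => by rw [one_div_pow]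
  simp only [glDensity, hpow]
  induction r with
  | zero => simpa using hx0
  | succ r ih =>
    rw [Finset.prod_range_succ]
    rcases Nat.eq_zero_or_pos r with rfl | hr
    · simp only [Finset.range_zero, Finset.prod_empty, one_mul, zero_add, pow_one]
      refine le_trans (Real.exp_le_exp.2 ?_) (exp_neg_le_one_sub hx)
      push_cast
      nlinarith
    · have h2 : x ^ (r + 1) ≤ x ^ 2 := pow_le_pow_of_le_one hx0 (by linarith) (by omega)
      have h3 : x ^ (r + 1) ≤ 1 / 2 := by nlinarith
      have h4 : (0 : ℝ) ≤ x ^ (r + 1) := by positivity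
      have h5 := exp_neg_le_one_sub h3
      calc _ ≤ Real.exp (-(x + 3 * r * x ^ 2)) *
            Real.exp (-(x ^ (r + 1) + 2 * (x ^ (r + 1)) ^ 2)) := by
            rw [← Real.exp_add]
            apply Real.exp_le_exp.2
            push_cast
            nlinarith
        _ ≤ _ := mul_le_mul ih h5 (Real.exp_pos _).le
            ((Real.exp_pos _).le.trans ih)

variable {A : Type*} [CommRing A] [IsDedekindDomain A]

theorem cardQuot_le_card_of_smul_eq_zero (v : HeightOneSpectrum A) (Q : Type*) [AddCommGroup Q]
    [Module A Q] [Finite Q] [Nontrivial Q] (hQ : ∀ a ∈ v.asIdeal, ∀ x : Q, a • x = 0) :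
    Submodule.cardQuot v.asIdeal ≤ Nat.card Q := by
  obtain ⟨x, hx⟩ := exists_ne (0 : Q)
  have hle : v.asIdeal ≤ Ideal.torsionOf A Q x := fun a ha =>
    (Ideal.mem_torsionOf_iff x a).2 (hQ a ha x)
  have heq : v.asIdeal = Ideal.torsionOf A Q x := by
    refine v.isMaximal.eq_of_le (fun h => hx ?_) hle
    rwa [Ideal.torsionOf_eq_top_iff] at h
  rw [Submodule.cardQuot_apply, heq,
    Nat.card_congr (Ideal.quotTorsionOfEquivSpanSingleton A Q x).toEquiv]
  exact Nat.card_le_card_of_injective _ Subtype.val_injective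

/-- By Nakayama `H / vH` is non-zero, so it has at least `N(v)` elements. The other primes still
contain the annihilator of `vH`, because `v` is contained in none of them; induction applies to
`vH`. -/
theorem prod_cardQuot_le_card (S : Finset (HeightOneSpectrum A)) (H : Type*) [AddCommGroup H]
    [Module A H] [Finite H] (hS : ∀ v ∈ S, Module.annihilator A H ≤ v.asIdeal) :
    ∏ v ∈ S, Submodule.cardQuot v.asIdeal ≤ Nat.card H := by
  classical
  induction S using Finset.induction_on generalizing H with
  | empty =>
    rw [Finset.prod_empty]
    exact Nat.card_pos
  | insert v S hv ih =>
    rw [Finset.prod_insert hv]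
    set N : Submodule A H := v.asIdeal • ⊤
    have hvS := hS v (Finset.mem_insert_self v S)
    have hN : N ≠ ⊤ := by
      intro h
      obtain ⟨a, ha, h0⟩ := Submodule.exists_sub_one_mem_and_smul_eq_zero_of_fg_of_le_smul
        v.asIdeal (⊤ : Submodule A H) (Module.finite_def.1 inferInstance) h.ge
      have hav : a ∈ v.asIdeal := hvS (Module.mem_annihilator.2 fun m => h0 m trivial)
      refine v.isPrime.ne_top ((Ideal.eq_top_iff_one _).2 ?_)
      have := v.asIdeal.sub_mem hav ha
      rwa [sub_sub_cancel] at this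
    have hfin : Finite (H ⧸ N) := Finite.of_surjective N.mkQ N.mkQ_surjective
    have hnt : Nontrivial (H ⧸ N) := Submodule.Quotient.nontrivial_iff.2 hN
    rw [Submodule.card_eq_card_quotient_mul_card N, mul_comm (Nat.card N)]
    refine Nat.mul_le_mul (cardQuot_le_card_of_smul_eq_zero v (H ⧸ N) fun a ha x => ?_)
      (ih N fun w hw a ha => ?_)
    · obtain ⟨x, rfl⟩ := N.mkQ_surjective x
      rw [← map_smul, Submodule.mkQ_apply, Submodule.Quotient.mk_eq_zero]
      exact Submodule.smul_mem_smul ha trivial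
    · have hvw : ¬ v.asIdeal ≤ w.asIdeal := fun h => hv (HeightOneSpectrum.eq_of_le h ▸ hw)
      obtain ⟨b, hb, hbw⟩ := Set.not_subset.1 hvw
      have hab : a * b ∈ w.asIdeal := by
        refine hS w (Finset.mem_insert_of_mem hw) (Module.mem_annihilator.2 fun m => ?_)
        rw [mul_smul]
        exact congrArg Subtype.val (Module.mem_annihilator.1 ha
          ⟨b • m, Submodule.smul_mem_smul hb trivial⟩)
      exact (w.isPrime.mem_or_mem hab).resolve_right hbw

/-- If the product of the norms of the primes in `S` is at most `X`, then the product of the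
densities is at least of order `1 / log log X`. -/
theorem HasMertensBounds.exists_one_le_prod_glDensity (hA : HasMertensBounds A) (r : ℕ) :
    ∃ B : ℝ, 0 < B ∧ ∀ (X : ℝ) (S : Finset (HeightOneSpectrum A)), Real.exp 3 ≤ X →
      ((∏ v ∈ S, Submodule.cardQuot v.asIdeal : ℕ) : ℝ) ≤ X →
      1 ≤ B * Real.log (Real.log X) *
        ∏ v ∈ S, glDensity (Submodule.cardQuot v.asIdeal) r := by
  have := hA.hasFiniteQuotients
  obtain ⟨C₁, h₁⟩ := hA.sum_inv_le
  obtain ⟨C₂, h₂⟩ := hA.sum_inv_sq_le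
  refine ⟨Real.exp (C₁ + 1 + 3 * r * C₂), Real.exp_pos _, fun X S hX hS => ?_⟩
  have hX0 : 0 < X := (Real.exp_pos _).trans_le hX
  set y := Real.log X
  have hy : 3 ≤ y := (Real.le_log_iff_exp_le hX0).2 hX
  have hlogy : 1 ≤ Real.log y := by
    rw [Real.le_log_iff_exp_le (by linarith)]
    linarith [Real.exp_one_lt_d9]
  -- Primes are split at `y = log X`. Mertens handles the small ones. The large ones number at most
  -- `y / log y`, as `y ^ |S₂| ≤ X`, so their reciprocals sum to at most `1`.
  set S₁ := S.filter fun v => (Submodule.cardQuot v.asIdeal : ℝ) ≤ y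
  set S₂ := S.filter fun v => ¬ (Submodule.cardQuot v.asIdeal : ℝ) ≤ y
  have hsum₁ := h₁ y hy S₁ fun v hv => (Finset.mem_filter.1 hv).2
  have hcard₂ : (S₂.card : ℝ) * Real.log y ≤ y := by
    have h3 : y ^ S₂.card ≤ X := by
      calc y ^ S₂.card = ∏ _v ∈ S₂, y := (Finset.prod_const y).symm
        _ ≤ ∏ v ∈ S₂, (Submodule.cardQuot v.asIdeal : ℝ) :=
          Finset.prod_le_prod (fun _ _ => by linarith)
            fun v hv => (not_le.1 (Finset.mem_filter.1 hv).2).le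
        _ = ((∏ v ∈ S₂, Submodule.cardQuot v.asIdeal : ℕ) : ℝ) := (Nat.cast_prod _ _).symm
        _ ≤ ((∏ v ∈ S, Submodule.cardQuot v.asIdeal : ℕ) : ℝ) :=
          Nat.cast_le.2 (Finset.prod_le_prod_of_subset_of_one_le' (Finset.filter_subset _ _)
            fun v _ _ => one_le_two.trans (HeightOneSpectrum.two_le_cardQuot v))
        _ ≤ X := hS
    have h4 := Real.log_le_log (by positivity) h3
    rwa [Real.log_pow] at h4
  have hsum₂ : ∑ v ∈ S₂, 1 / (Submodule.cardQuot v.asIdeal : ℝ) ≤ 1 := by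
    calc _ ≤ ∑ _v ∈ S₂, 1 / y := Finset.sum_le_sum fun v hv =>
          one_div_le_one_div_of_le (by linarith) (not_le.1 (Finset.mem_filter.1 hv).2).le
      _ = S₂.card / y := by rw [Finset.sum_const, nsmul_eq_mul, mul_one_div]
      _ ≤ 1 := by
        rw [div_le_one (by linarith)]
        nlinarith [(Nat.cast_nonneg S₂.card : (0 : ℝ) ≤ S₂.card)]
  have hsum : ∑ v ∈ S, 1 / (Submodule.cardQuot v.asIdeal : ℝ) ≤
      Real.log (Real.log y) + C₁ + 1 := by
    rw [← Finset.sum_filter_add_sum_filter_not S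
      fun v => (Submodule.cardQuot v.asIdeal : ℝ) ≤ y]
    linarith
  have hprod : Real.exp (-(Real.log (Real.log y) + C₁ + 1 + 3 * r * C₂)) ≤
      ∏ v ∈ S, glDensity (Submodule.cardQuot v.asIdeal) r := by
    calc _ ≤ Real.exp (∑ v ∈ S, -(1 / (Submodule.cardQuot v.asIdeal : ℝ) +
          3 * r * (1 / (Submodule.cardQuot v.asIdeal : ℝ) ^ 2))) := by
          apply Real.exp_le_exp.2
          rw [Finset.sum_neg_distrib, Finset.sum_add_distrib, ← Finset.mul_sum]
          have := mul_le_mul_of_nonneg_left (h₂ S) (by positivity : (0 : ℝ) ≤ 3 * r)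
          linarith
      _ = ∏ v ∈ S, Real.exp _ := Real.exp_sum _ _
      _ ≤ _ := Finset.prod_le_prod (fun _ _ => (Real.exp_pos _).le) fun v _ =>
          exp_neg_le_glDensity (HeightOneSpectrum.two_le_cardQuot v) r
  calc (1 : ℝ) = Real.exp (C₁ + 1 + 3 * r * C₂) * Real.log y *
        Real.exp (-(Real.log (Real.log y) + C₁ + 1 + 3 * r * C₂)) := by
        nth_rewrite 1 [← Real.exp_log (by linarith : 0 < Real.log y)]
        rw [← Real.exp_add, ← Real.exp_add, ← Real.exp_zero]
        congr 1
        ring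
    _ ≤ _ := mul_le_mul_of_nonneg_left hprod (by positivity)

end Density

/-! ### Solving the inequality with the iterated logarithm -/

section LogLog

theorem one_lt_log_three : 1 < Real.log 3 := by
  rw [Real.lt_log_iff_exp_lt (by norm_num)]
  linarith [Real.exp_one_lt_d9]

theorem one_lt_log_max (d : ℝ) : 1 < Real.log (max d 3) :=
  one_lt_log_three.trans_le (Real.log_le_log (by norm_num) (le_max_right _ _))

theorem logLog_pos (d : ℝ) : 0 < logLog d := Real.log_pos (one_lt_log_max d)

theorem logLog_three_le (d : ℝ) : logLog 3 ≤ logLog d := by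
  rw [logLog, logLog, max_self]
  exact Real.log_le_log (by linarith [one_lt_log_three])
    (Real.log_le_log (by norm_num) (le_max_right _ _))

/-- Solving `u ≤ E d log log u` for `u`. -/
theorem exists_logLog_le (E : ℝ) (hE : 1 ≤ E) : ∃ G : ℝ, 0 < G ∧ ∀ u d h : ℝ, 1 ≤ d →
    u = max h (Real.exp 3) → h ≤ E * Real.log (Real.log u) * d →
    Real.log (Real.log u) ≤ G * logLog d := by
  set F := Real.log (4 * E ^ 2 * Real.exp 3) + 2
  have hlogF : 0 ≤ Real.log (4 * E ^ 2 * Real.exp 3) := by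
    apply Real.log_nonneg
    have : 1 ≤ E ^ 2 := one_le_pow₀ hE
    nlinarith [Real.add_one_le_exp (3 : ℝ)]
  have hF : 1 ≤ F := by linarith
  refine ⟨Real.log F / logLog 3 + 1, ?_, fun u d h hd hu hh => ?_⟩
  · have := Real.log_nonneg hF
    have := logLog_pos 3
    positivity
  have hu3 : Real.exp 3 ≤ u := hu ▸ le_max_right _ _
  have hu0 : 0 < u := (Real.exp_pos _).trans_le hu3
  have hlogu : 3 ≤ Real.log u := (Real.le_log_iff_exp_le hu0).2 hu3
  -- A crude bound is enough, since it is only used after two logarithms: `log log u ≤ 2√u` turns `u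
  -- ≤ E * d * log log u` into `√u ≤ 2 * E * d`.
  have hbound : u ≤ 4 * E ^ 2 * Real.exp 3 * d ^ 2 := by
    have hE2 : 1 ≤ E ^ 2 := one_le_pow₀ hE
    have hd2 : 1 ≤ d ^ 2 := one_le_pow₀ hd
    have he := Real.add_one_le_exp (3 : ℝ)
    rcases le_total h (Real.exp 3) with h3 | h3
    · rw [hu, max_eq_right h3]
      have : 1 ≤ E ^ 2 * d ^ 2 := one_le_mul_of_one_le_of_one_le hE2 hd2
      nlinarith
    · have hueq : u = h := by rw [hu, max_eq_left h3]
      have hs : Real.log (Real.log u) ≤ 2 * √u := by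
        have h5 := Real.log_le_sub_one_of_pos (by linarith : 0 < Real.log u)
        have h6 : Real.log u = 2 * Real.log √u := by rw [Real.log_sqrt hu0.le]; ring
        have h7 := Real.log_le_sub_one_of_pos (Real.sqrt_pos.2 hu0)
        linarith
      have hsq := Real.sq_sqrt hu0.le
      have hspos := Real.sqrt_pos.2 hu0
      have h8 : √u * √u ≤ (2 * E * d) * √u := by
        calc √u * √u = h := by rw [← hueq, ← sq, hsq]
          _ ≤ _ := hh
          _ ≤ E * (2 * √u) * d := by gcongr
          _ = _ := by ring
      have h9 := le_of_mul_le_mul_right h8 hspos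
      calc u = √u ^ 2 := hsq.symm
        _ ≤ (2 * E * d) ^ 2 := by gcongr
        _ = 4 * E ^ 2 * 1 * d ^ 2 := by ring
        _ ≤ _ := by gcongr; linarith
  have hlog : Real.log u ≤ F * Real.log (max d 3) := by
    have h1 := Real.log_le_log hu0 hbound
    rw [Real.log_mul (by positivity) (by positivity), Real.log_pow] at h1
    have h2 : Real.log d ≤ Real.log (max d 3) := Real.log_le_log (by linarith) (le_max_left _ _)
    have h3 := one_lt_log_max d
    push_cast at h1
    nlinarith
  have h3 := one_lt_log_max d
  have h4 := Real.log_le_log (by linarith) hlog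
  rw [Real.log_mul (by linarith) (by linarith)] at h4
  have h5 : Real.log F ≤ Real.log F / logLog 3 * logLog d := by
    rw [div_mul_eq_mul_div, le_div_iff₀ (logLog_pos 3)]
    exact mul_le_mul_of_nonneg_left (logLog_three_le d) (Real.log_nonneg hF)
  rw [add_mul, one_mul]
  exact h4.trans (add_le_add h5 le_rfl)

end LogLog

/-! ### The upper bounds -/

section UpperBound

open IsDedekindDomain

/-- Reduces an infinite union of torsion submodules to finite subsets, each inside a single `M[𝔞]`,
and yields finiteness at the same time. -/
theorem Set.finite_and_ncard_le {α : Type*} {H : Set α} {B : ℝ}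
    (h : ∀ t : Finset α, (t : Set α) ⊆ H → (t.card : ℝ) ≤ B) : H.Finite ∧ (H.ncard : ℝ) ≤ B := by
  have hfin : H.Finite := by
    by_contra hinf
    obtain ⟨n, hn⟩ := exists_nat_gt B
    obtain ⟨t, ht, rfl⟩ := Set.Infinite.exists_subset_card_eq hinf n
    exact absurd (h t ht) (not_le.2 hn)
  refine ⟨hfin, ?_⟩
  rw [Set.ncard_eq_toFinset_card _ hfin]
  exact h _ (by simp)

theorem le_mul_rpow_of_pow_le {h a b : ℝ} {r : ℕ} (hr : 1 ≤ r) (hh : 0 ≤ h) (ha : 0 ≤ a)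
    (hb : 0 ≤ b) (hle : h ^ r ≤ a * b) : h ≤ a ^ (1 / (r : ℝ)) * b ^ (1 / (r : ℝ)) := by
  rw [← Real.mul_rpow ha hb, one_div]
  calc h = (h ^ r) ^ ((r : ℝ)⁻¹) := (Real.pow_rpow_inv_natCast hh (by omega)).symm
    _ ≤ _ := Real.rpow_le_rpow (by positivity) hle (by positivity)

section

variable {K : Type w} [Field K]

theorem one_le_deg (L : IntermediateField K (AlgebraicClosure K)) [FiniteDimensional K L] :
    1 ≤ deg L := by
  rw [deg]
  exact_mod_cast (Module.finrank_pos : 0 < Module.finrank K L)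

end

variable {A : Type u} [CommRing A] {M : Type x} [AddCommGroup M] [Module A M]

theorem idealTorsion_mono {𝔞 𝔟 : Ideal A} (h : 𝔟 ≤ 𝔞) :
    idealTorsion A M 𝔞 ≤ idealTorsion A M 𝔟 :=
  Submodule.torsionBySet_le_torsionBySet_of_subset h

theorem exists_subset_idealTorsion {P : Ideal A → Prop} (h₀ : ∃ 𝔞, P 𝔞)
    (hmul : ∀ 𝔞 𝔟, P 𝔞 → P 𝔟 → P (𝔞 * 𝔟)) (t : Finset M)
    (ht : ∀ y ∈ t, ∃ 𝔞, P 𝔞 ∧ y ∈ idealTorsion A M 𝔞) :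
    ∃ 𝔞, P 𝔞 ∧ (t : Set M) ⊆ idealTorsion A M 𝔞 := by
  classical
  induction t using Finset.induction_on with
  | empty =>
    obtain ⟨𝔞, h𝔞⟩ := h₀
    exact ⟨𝔞, h𝔞, by simp⟩
  | insert y t _ ih =>
    obtain ⟨𝔞, h𝔞, hy⟩ := ht y (Finset.mem_insert_self y t)
    obtain ⟨𝔟, h𝔟, h⟩ := ih fun z hz => ht z (Finset.mem_insert_of_mem hz)
    refine ⟨𝔞 * 𝔟, hmul _ _ h𝔞 h𝔟, ?_⟩
    rw [Finset.coe_insert, Set.insert_subset_iff]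
    have h1 : 𝔞 * 𝔟 ≤ 𝔞 := Ideal.mul_le_left
    have h2 : 𝔞 * 𝔟 ≤ 𝔟 := Ideal.mul_le_right
    exact ⟨idealTorsion_mono h1 hy, fun z hz => idealTorsion_mono h2 (h hz)⟩

variable [IsDedekindDomain A] {K : Type w} [Field K] [DistribMulAction (AbsGal K) M]
  [SMulCommClass (AbsGal K) A M] {r : ℕ}

/-- Only `𝔭` itself contains `𝔭 ^ n`, so one density occurs, and it is at least `exp (-(1 + 3 * r))`
whatever the norm of `𝔭`. -/
theorem HasTorsionRank.ncard_rationalPoints_idealPowerTorsion_le [Ring.HasFiniteQuotients A]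
    (hr : 1 ≤ r) (hM : HasTorsionRank A M r) {𝔭 : Ideal A} (h𝔭 : 𝔭.IsPrime) (h0 : 𝔭 ≠ ⊥) {Cp : ℝ}
    (hCp : 0 ≤ Cp) (hI : ∀ n : ℕ, 1 ≤ n → (galoisIndex K A M (𝔭 ^ n) : ℝ) ≤ Cp)
    (L : IntermediateField K (AlgebraicClosure K)) [FiniteDimensional K L] :
    (rationalPoints (idealPowerTorsion A M 𝔭) L).Finite ∧
      ((rationalPoints (idealPowerTorsion A M 𝔭) L).ncard : ℝ) ≤
        (Real.exp (1 + 3 * r) * Cp) ^ (1 / (r : ℝ)) * deg L ^ (1 / (r : ℝ)) := by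
  have hd := one_le_deg L
  refine Set.finite_and_ncard_le fun t ht => ?_
  obtain ⟨_, ⟨n, hn, rfl⟩, hsub⟩ := exists_subset_idealTorsion
    (P := fun 𝔞 => ∃ n, 1 ≤ n ∧ 𝔞 = 𝔭 ^ n) ⟨𝔭, 1, le_rfl, (pow_one 𝔭).symm⟩
    (by rintro _ _ ⟨m, hm, rfl⟩ ⟨n, hn, rfl⟩; exact ⟨m + n, by omega, (pow_add 𝔭 m n).symm⟩) t
    (fun y hy => by obtain ⟨n, hn, h⟩ := (ht hy).1; exact ⟨𝔭 ^ n, ⟨n, hn, rfl⟩, h⟩)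
  have hn0 : 𝔭 ^ n ≠ ⊥ := pow_ne_zero n h0
  have hfin := hM.finite_idealTorsion hn0
  let v : HeightOneSpectrum A := ⟨𝔭, h𝔭, h0⟩
  have hS : ∀ w : HeightOneSpectrum A, w ∈ ({v} : Finset _) ↔ 𝔭 ^ n ≤ w.asIdeal := by
    intro w
    rw [Finset.mem_singleton]
    constructor
    · rintro rfl
      exact Ideal.pow_le_self (by omega)
    · intro h
      have := w.isPrime
      exact (HeightOneSpectrum.eq_of_le (v := v) (Ideal.IsPrime.le_of_pow_le h)).symm
  have key := ncard_pow_mul_prod_glDensity_le hM hn0 hS L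
  rw [Finset.prod_singleton] at key
  set h := (rationalPoints (idealTorsion A M (𝔭 ^ n) : Set M) L).ncard
  have hq := HeightOneSpectrum.two_le_cardQuot v
  set q := Submodule.cardQuot v.asIdeal
  have hdens : Real.exp (-(1 + 3 * r)) ≤ glDensity q r := by
    refine le_trans (Real.exp_le_exp.2 (neg_le_neg ?_)) (exp_neg_le_glDensity hq r)
    have hq' : (1 : ℝ) ≤ q := by exact_mod_cast one_le_two.trans hq
    have h1 : 1 / (q : ℝ) ≤ 1 := (div_le_one (by positivity)).2 hq'
    have h2 : 1 / (q : ℝ) ^ 2 ≤ 1 := (div_le_one (by positivity)).2 (one_le_pow₀ hq')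
    have h3 : (3 : ℝ) * r * (1 / (q : ℝ) ^ 2) ≤ 3 * r * 1 := by gcongr
    linarith
  have hle : (h : ℝ) ^ r ≤ Real.exp (1 + 3 * r) * Cp * deg L := by
    have h1 : (h : ℝ) ^ r * Real.exp (-(1 + 3 * r)) ≤ Cp * deg L := by
      calc _ ≤ (h : ℝ) ^ r * glDensity q r := by gcongr
        _ ≤ _ := key
        _ ≤ _ := by gcongr; exact hI n hn
    rw [Real.exp_neg, ← div_eq_mul_inv, div_le_iff₀ (Real.exp_pos _)] at h1
    linarith
  refine le_trans ?_ (le_mul_rpow_of_pow_le hr (Nat.cast_nonneg h) (by positivity)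
    (by linarith) hle)
  rw [← Set.ncard_coe_finset]
  refine Nat.cast_le.2 (Set.ncard_le_ncard (fun y hy => ⟨hsub hy, (ht hy).2⟩) ?_)
  exact (Set.toFinite (idealTorsion A M (𝔭 ^ n) : Set M)).subset (rationalPoints_subset _ L)

theorem HasMertensBounds.exists_ncard_rationalPoints_fullTorsion_le (hA : HasMertensBounds A)
    (hr : 1 ≤ r) (C₀ : ℝ) : ∃ C : ℝ, 0 < C ∧
      ∀ (M : Type x) [AddCommGroup M] [Module A M] [DistribMulAction (AbsGal K) M]
        [SMulCommClass (AbsGal K) A M] (_ : HasTorsionRank A M r)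
        (_ : ∀ 𝔞 : Ideal A, 𝔞 ≠ ⊥ → (galoisIndex K A M 𝔞 : ℝ) ≤ C₀)
        (L : IntermediateField K (AlgebraicClosure K)) (_ : FiniteDimensional K L),
          (rationalPoints (fullTorsion A M) L).Finite ∧
          ((rationalPoints (fullTorsion A M) L).ncard : ℝ) ≤
            C * (deg L * logLog (deg L)) ^ (1 / (r : ℝ)) := by
  have := hA.hasFiniteQuotients
  obtain ⟨B, hB0, hB⟩ := hA.exists_one_le_prod_glDensity r
  obtain ⟨G, hG0, hG⟩ := exists_logLog_le (max (B * C₀) 1) (le_max_right _ _)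
  set E := max (B * C₀) 1
  have hE : 0 < E := zero_lt_one.trans_le (le_max_right _ _)
  refine ⟨(E * G) ^ (1 / (r : ℝ)), by positivity, fun M _ _ _ _ hM hI L _ => ?_⟩
  have hd := one_le_deg L
  refine Set.finite_and_ncard_le fun t ht => ?_
  obtain ⟨𝔞, h𝔞, hsub⟩ := exists_subset_idealTorsion (P := fun 𝔞 : Ideal A => 𝔞 ≠ ⊥)
    ⟨⊤, top_ne_bot⟩ (fun 𝔞 𝔟 h h' => mul_ne_zero h h') t (fun y hy => (ht hy).1)
  have hfin := hM.finite_idealTorsion h𝔞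
  set H := rationalTorsion (M := M) 𝔞 L
  -- Passing from `𝔞` to the annihilator of `H` discards the primes that do not show up in `H`. The
  -- remaining ones have norms with product at most `|H|`, which bounds the loss in the densities by
  -- `log log`.
  set 𝔟 := Module.annihilator A H
  have h𝔞𝔟 : 𝔞 ≤ 𝔟 := fun a ha => Module.mem_annihilator.2 fun y =>
    Subtype.ext (Subtype.ext ((Submodule.mem_torsionBySet_iff _ _).1 y.1.2 ⟨a, ha⟩))
  have h𝔟 : 𝔟 ≠ ⊥ := fun h => h𝔞 (le_bot_iff.1 (h𝔞𝔟.trans h.le))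
  have hfin' := hM.finite_idealTorsion h𝔟
  have hrfin : (rationalPoints (idealTorsion A M 𝔟 : Set M) L).Finite :=
    (Set.toFinite (idealTorsion A M 𝔟 : Set M)).subset (rationalPoints_subset _ L)
  have hS : ∀ v : HeightOneSpectrum A,
      v ∈ (finite_heightOneSpectrum_ge h𝔟).toFinset ↔ 𝔟 ≤ v.asIdeal := fun v => by simp
  set S := (finite_heightOneSpectrum_ge h𝔟).toFinset
  have key := ncard_pow_mul_prod_glDensity_le hM h𝔟 hS L
  have hmono : rationalPoints (idealTorsion A M 𝔞 : Set M) L ⊆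
      rationalPoints (idealTorsion A M 𝔟 : Set M) L := fun y hy => by
    refine ⟨(Submodule.mem_torsionBySet_iff _ _).2 fun b => ?_, hy.2⟩
    have hyH : (⟨y, hy.1⟩ : idealTorsion A M 𝔞) ∈ H := fun σ hσ =>
      hy.2 σ (mem_absGalSubgroup.1 hσ)
    exact congrArg (fun z : H => (z.1 : M)) (Module.mem_annihilator.1 b.2 ⟨_, hyH⟩)
  have hcard : Nat.card H ≤ (rationalPoints (idealTorsion A M 𝔟 : Set M) L).ncard := by
    rw [← ncard_rationalPoints_idealTorsion]
    exact Set.ncard_le_ncard hmono hrfin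
  have hprod : ∏ v ∈ S, Submodule.cardQuot v.asIdeal ≤
      (rationalPoints (idealTorsion A M 𝔟 : Set M) L).ncard :=
    (prod_cardQuot_le_card S H fun v hv => (hS v).1 hv).trans hcard
  set h := (rationalPoints (idealTorsion A M 𝔟 : Set M) L).ncard
  set u := max (h : ℝ) (Real.exp 3) with hu
  have h1 := hB u S (le_max_right _ _) ((Nat.cast_le.2 hprod).trans (le_max_left _ _))
  have hloglog : 0 ≤ Real.log (Real.log u) := by
    apply Real.log_nonneg
    rw [Real.le_log_iff_exp_le (lt_max_of_lt_right (Real.exp_pos _))]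
    exact (Real.exp_le_exp.2 (by norm_num)).trans (le_max_right _ _)
  have hpow : (h : ℝ) ^ r ≤ E * Real.log (Real.log u) * deg L := by
    calc (h : ℝ) ^ r = (h : ℝ) ^ r * 1 := (mul_one _).symm
      _ ≤ (h : ℝ) ^ r * (B * Real.log (Real.log u) *
          ∏ v ∈ S, glDensity (Submodule.cardQuot v.asIdeal) r) := by gcongr
      _ = B * Real.log (Real.log u) * ((h : ℝ) ^ r *
          ∏ v ∈ S, glDensity (Submodule.cardQuot v.asIdeal) r) := by ring
      _ ≤ B * Real.log (Real.log u) * (C₀ * deg L) := by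
        refine mul_le_mul_of_nonneg_left (key.trans ?_) (by positivity)
        gcongr
        exact hI 𝔟 h𝔟
      _ = B * C₀ * (Real.log (Real.log u) * deg L) := by ring
      _ ≤ E * (Real.log (Real.log u) * deg L) := by
        refine mul_le_mul_of_nonneg_right (le_max_left _ _) (by positivity)
      _ = _ := by ring
  have hself : (h : ℝ) ≤ (h : ℝ) ^ r := by exact_mod_cast Nat.le_self_pow (by omega) h
  have h2 := hG u (deg L) h hd hu (hself.trans hpow)
  have hpow' : (h : ℝ) ^ r ≤ E * G * (deg L * logLog (deg L)) := by
    calc _ ≤ _ := hpow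
      _ ≤ E * (G * logLog (deg L)) * deg L := by gcongr
      _ = _ := by ring
  have hll := logLog_pos (deg L)
  refine le_trans ?_ (le_mul_rpow_of_pow_le hr (Nat.cast_nonneg h) (by positivity)
    (by positivity) hpow')
  rw [← Set.ncard_coe_finset]
  refine Nat.cast_le.2 (Set.ncard_le_ncard (fun y hy => hmono ⟨hsub hy, (ht hy).2⟩) hrfin)

end UpperBound

/-! ### Optimality: towers of torsion fields -/

section LowerBound

open IsDedekindDomain

theorem rpow_le_of_le_pow {x y : ℝ} {r : ℕ} (hr : 1 ≤ r) (hx : 0 ≤ x) (hy : 0 ≤ y)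
    (h : x ≤ y ^ r) : x ^ (1 / (r : ℝ)) ≤ y := by
  rw [one_div]
  calc _ ≤ (y ^ r) ^ ((r : ℝ)⁻¹) := Real.rpow_le_rpow hx h (by positivity)
    _ = y := Real.pow_rpow_inv_natCast hy (by omega)

section

variable {K : Type w} [Field K]

/-- Here `a n` bounds the number of points from below and `φ` is the upper bound in terms of the
degree. If the degrees stayed below `B`, then `φ` would take only finitely many values on them,
although `a` is unbounded. -/
theorem isTower_of_tendsto {L : ℕ → IntermediateField K (AlgebraicClosure K)} (hL : Monotone L)
    (hfin : ∀ n, FiniteDimensional K (L n)) {a : ℕ → ℝ} (ha : Tendsto a atTop atTop) (φ : ℝ → ℝ)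
    (h : ∀ n, a n ≤ φ (deg (L n))) : IsTower L := by
  refine ⟨hL, hfin, tendsto_atTop_atTop_of_monotone (fun m n hmn => ?_) fun B => ?_⟩
  · have := hfin n
    exact LinearMap.finrank_le_finrank_of_injective
      (f := (IntermediateField.inclusion (hL hmn)).toLinearMap)
      (IntermediateField.inclusion_injective (hL hmn))
  · by_contra hB
    push Not at hB
    obtain ⟨n, hn⟩ := (ha.eventually_gt_atTop (∑ m ∈ Finset.range B, |φ m|)).exists
    have h1 : |φ (Module.finrank K (L n))| ≤ ∑ m ∈ Finset.range B, |φ m| :=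
      Finset.single_le_sum (f := fun m : ℕ => |φ m|) (fun _ _ => abs_nonneg _)
        (Finset.mem_range.2 (hB n))
    exact absurd ((h n).trans ((le_abs_self _).trans h1)) (not_le.2 hn)

end

section

variable {A : Type u} [CommRing A] [IsDedekindDomain A]

theorem cardQuot_pow_of_infinite [Infinite A] (𝔞 : Ideal A) (n : ℕ) :
    Submodule.cardQuot (𝔞 ^ n) = Submodule.cardQuot 𝔞 ^ n := by
  induction n with
  | zero => rw [pow_zero, pow_zero, Ideal.one_eq_top, Submodule.cardQuot_top]
  | succ n ih => rw [pow_succ, pow_succ, cardQuot_mul_of_infinite, ih]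

theorem cardQuot_prod_of_infinite [Infinite A] (S : Finset (HeightOneSpectrum A)) :
    Submodule.cardQuot (∏ v ∈ S, v.asIdeal) = ∏ v ∈ S, Submodule.cardQuot v.asIdeal := by
  classical
  induction S using Finset.induction_on with
  | empty => rw [Finset.prod_empty, Finset.prod_empty, Ideal.one_eq_top, Submodule.cardQuot_top]
  | insert v S hv ih =>
    rw [Finset.prod_insert hv, Finset.prod_insert hv, cardQuot_mul_of_infinite, ih]

theorem HasMertensBounds.finite_setOf_cardQuot_le (hA : HasMertensBounds A) (n : ℕ) :
    {v : HeightOneSpectrum A | Submodule.cardQuot v.asIdeal ≤ n}.Finite := by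
  obtain ⟨C, hC⟩ := hA.card_le
  exact (Set.finite_and_ncard_le fun t ht =>
    hC (max n 1) (le_max_right _ _) t fun v hv => (ht hv).trans (le_max_left _ _)).1

/-- The product of the primes of norm at most `n`. -/
noncomputable def HasMertensBounds.primorial (hA : HasMertensBounds A) (n : ℕ) : Ideal A :=
  ∏ v ∈ (hA.finite_setOf_cardQuot_le n).toFinset, v.asIdeal

namespace HasMertensBounds

variable (hA : HasMertensBounds A)
include hA

theorem primorial_ne_bot (n : ℕ) : hA.primorial n ≠ ⊥ :=
  Finset.prod_ne_zero_iff.2 fun v _ => v.ne_bot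

theorem primorial_antitone : Antitone hA.primorial := fun m n hmn =>
  Ideal.le_of_dvd (Finset.prod_dvd_prod_of_subset _ _ _ fun v hv => by
    rw [Set.Finite.mem_toFinset] at hv ⊢
    exact hv.trans hmn)

theorem primorial_le_iff (n : ℕ) (v : HeightOneSpectrum A) :
    hA.primorial n ≤ v.asIdeal ↔ v ∈ (hA.finite_setOf_cardQuot_le n).toFinset := by
  constructor
  · intro h
    obtain ⟨w, hw, hle⟩ := (Ideal.IsPrime.prod_le v.isPrime).1 h
    exact HeightOneSpectrum.eq_of_le hle ▸ hw
  · intro h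
    exact Ideal.le_of_dvd (Finset.dvd_prod_of_mem _ h)

theorem tendsto_cardQuot_primorial (hft : Algebra.FiniteType ℤ A) :
    Tendsto (fun n => (Submodule.cardQuot (hA.primorial (n + 3)) : ℝ)) atTop atTop := by
  have := hA.hasFiniteQuotients
  have := hA.infinite
  obtain ⟨C, hC⟩ := hA.le_sum_inv hft
  have hlim : Tendsto (fun n : ℕ => Real.log (Real.log ((n + 3 : ℕ) : ℝ)) - C) atTop atTop :=
    tendsto_atTop_add_const_right _ _ (Real.tendsto_log_atTop.comp (Real.tendsto_log_atTop.comp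
      (tendsto_natCast_atTop_atTop.comp (tendsto_add_atTop_nat 3))))
  refine tendsto_atTop_mono (fun n => ?_) hlim
  set S := (hA.finite_setOf_cardQuot_le (n + 3)).toFinset
  refine (hC (n + 3) (by omega) S fun v => by simp [S]).trans ?_
  have h1 : ∑ v ∈ S, (1 / Submodule.cardQuot v.asIdeal : ℝ) ≤ S.card := by
    calc _ ≤ ∑ _v ∈ S, (1 : ℝ) := Finset.sum_le_sum fun v _ => by
          have : (1 : ℝ) ≤ Submodule.cardQuot v.asIdeal := by
            exact_mod_cast one_le_two.trans (HeightOneSpectrum.two_le_cardQuot v)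
          exact (div_le_one (by positivity)).2 this
      _ = _ := by simp
  have h2 : S.card ≤ Submodule.cardQuot (hA.primorial (n + 3)) := by
    rw [primorial, cardQuot_prod_of_infinite]
    calc S.card ≤ 2 ^ S.card := Nat.lt_two_pow_self.le
      _ = ∏ _v ∈ S, 2 := (Finset.prod_const 2).symm
      _ ≤ _ := Finset.prod_le_prod' fun v _ => HeightOneSpectrum.two_le_cardQuot v
  exact h1.trans (Nat.cast_le.2 h2)

/-- By Mertens the densities multiply to at most `exp C₂ / log n`, while `log d` is polynomially
bounded in `n`, so `logLog d` is at most a constant times `log n`. The two factors `log n` cancel.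
-/
theorem exists_mul_logLog_le (hft : Algebra.FiniteType ℤ A) {r : ℕ} (hr : 1 ≤ r) :
    ∃ C : ℝ, 0 < C ∧ ∀ (n : ℕ) (d : ℝ), 3 ≤ n → 1 ≤ d →
      d ≤ (Submodule.cardQuot (hA.primorial n) : ℝ) ^ (r * r) *
        ∏ v ∈ (hA.finite_setOf_cardQuot_le n).toFinset,
          glDensity (Submodule.cardQuot v.asIdeal) r →
      d * logLog d ≤ C * (Submodule.cardQuot (hA.primorial n) : ℝ) ^ (r * r) := by
  have := hA.hasFiniteQuotients
  have := hA.infinite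
  obtain ⟨C₁, h₁⟩ := hA.card_le
  obtain ⟨C₂, h₂⟩ := hA.le_sum_inv hft
  set F : ℝ := (r * r : ℕ) * max C₁ 0 + 2
  have hF : 1 ≤ F := by
    have : 0 ≤ ((r * r : ℕ) : ℝ) * max C₁ 0 := mul_nonneg (Nat.cast_nonneg _) (le_max_right _ _)
    linarith
  have hlogF := Real.log_nonneg hF
  refine ⟨Real.exp C₂ * (Real.log F + 2), by positivity, fun n d hn hd hle => ?_⟩
  set S := (hA.finite_setOf_cardQuot_le n).toFinset
  have hS : ∀ v, v ∈ S ↔ Submodule.cardQuot v.asIdeal ≤ n := fun v => by simp [S]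
  have hprod := cardQuot_prod_of_infinite S
  change Submodule.cardQuot (hA.primorial n) = _ at hprod
  set P := Submodule.cardQuot (hA.primorial n)
  have hn' : (3 : ℝ) ≤ n := by exact_mod_cast hn
  have hlogn : 1 < Real.log n :=
    one_lt_log_three.trans_le (Real.log_le_log (by norm_num) hn')
  have hP1 : 1 ≤ P := hprod ▸ Finset.one_le_prod' fun v _ =>
    one_le_two.trans (HeightOneSpectrum.two_le_cardQuot v)
  have hP0 : (0 : ℝ) < P := by exact_mod_cast hP1
  have hPn : P ≤ n ^ S.card := by
    rw [hprod, ← Finset.prod_const]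
    exact Finset.prod_le_prod' fun v hv => (hS v).1 hv
  -- No Chebyshev bound is needed: any power of `n` becomes a multiple of `log n` after one more
  -- logarithm.
  have hlogP : Real.log P ≤ max C₁ 0 * (n : ℝ) ^ 2 := by
    calc Real.log P ≤ Real.log ((n : ℝ) ^ S.card) :=
          Real.log_le_log hP0 (by exact_mod_cast hPn)
      _ = S.card * Real.log n := Real.log_pow _ _
      _ ≤ (max C₁ 0 * n) * n := by
        have h3 := h₁ n (by omega) S fun v hv => (hS v).1 hv
        have h4 : C₁ * n ≤ max C₁ 0 * n := by gcongr; exact le_max_left _ _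
        have h5 := Real.log_le_self (Nat.cast_nonneg (α := ℝ) n)
        gcongr
        exact h3.trans h4
      _ = _ := by ring
  have hdens1 : ∏ v ∈ S, glDensity (Submodule.cardQuot v.asIdeal) r ≤ 1 :=
    Finset.prod_le_one (fun v _ => (glDensity_pos (HeightOneSpectrum.two_le_cardQuot v) r).le)
      fun v _ => glDensity_le_one (HeightOneSpectrum.two_le_cardQuot v) r
  have hdP : d ≤ (P : ℝ) ^ (r * r) := hle.trans (mul_le_of_le_one_right (by positivity) hdens1)
  have hlogd : Real.log (max d 3) ≤ F * (n : ℝ) ^ 2 := by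
    have h3 : Real.log d ≤ ((r * r : ℕ) : ℝ) * Real.log P := by
      rw [← Real.log_pow]
      exact Real.log_le_log (by linarith) hdP
    have h4 : Real.log (max d 3) ≤ Real.log d + 2 := by
      calc _ ≤ Real.log (d * 3) := by
            apply Real.log_le_log (by positivity)
            exact max_le (by linarith) (by linarith)
        _ = Real.log d + Real.log 3 := Real.log_mul (by linarith) (by norm_num)
        _ ≤ _ := by linarith [Real.log_le_sub_one_of_pos (by norm_num : (0 : ℝ) < 3)]
    have h5 := mul_le_mul_of_nonneg_left hlogP (Nat.cast_nonneg (α := ℝ) (r * r))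
    have h6 : F * (n : ℝ) ^ 2 =
        ((r * r : ℕ) : ℝ) * (max C₁ 0 * (n : ℝ) ^ 2) + 2 * (n : ℝ) ^ 2 := by ring
    nlinarith
  have hll : logLog d ≤ (Real.log F + 2) * Real.log n := by
    have h3 := Real.log_le_log (by linarith [one_lt_log_max d]) hlogd
    rw [Real.log_mul (by linarith) (by positivity), Real.log_pow] at h3
    push_cast at h3
    rw [logLog]
    nlinarith
  have hdens2 : ∏ v ∈ S, glDensity (Submodule.cardQuot v.asIdeal) r ≤
      Real.exp C₂ / Real.log n := by
    calc _ ≤ ∏ v ∈ S, Real.exp (-(1 / (Submodule.cardQuot v.asIdeal : ℝ))) :=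
          Finset.prod_le_prod
            (fun v _ => (glDensity_pos (HeightOneSpectrum.two_le_cardQuot v) r).le)
            fun v _ => glDensity_le_exp (HeightOneSpectrum.two_le_cardQuot v) hr
      _ = Real.exp (-∑ v ∈ S, 1 / (Submodule.cardQuot v.asIdeal : ℝ)) := by
        rw [← Real.exp_sum, Finset.sum_neg_distrib]
      _ ≤ Real.exp (C₂ - Real.log (Real.log n)) := by
        apply Real.exp_le_exp.2
        linarith [h₂ n hn S hS]
      _ = _ := by rw [Real.exp_sub, Real.exp_log (by linarith)]
  have hll0 := logLog_pos d
  calc d * logLog d ≤ ((P : ℝ) ^ (r * r) * (Real.exp C₂ / Real.log n)) *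
        ((Real.log F + 2) * Real.log n) := by
        refine mul_le_mul (hle.trans (by gcongr)) hll hll0.le ?_
        have : 0 < Real.log n := by linarith
        positivity
    _ = _ := by
      have : Real.log n ≠ 0 := by linarith
      field_simp

end HasMertensBounds

end

variable {A : Type u} [CommRing A] [IsDedekindDomain A] [Ring.HasFiniteQuotients A]
  {M : Type x} [AddCommGroup M] [Module A M]
  {K : Type w} [Field K] [DistribMulAction (AbsGal K) M] [SMulCommClass (AbsGal K) A M] {r : ℕ}

theorem HasTorsionRank.deg_torsionField_le (hM : HasTorsionRank A M r)
    (hc : IsContinuousOnTorsion K A M) {𝔞 : Ideal A} (h𝔞 : 𝔞 ≠ ⊥)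
    {S : Finset (HeightOneSpectrum A)} (hS : ∀ v, v ∈ S ↔ 𝔞 ≤ v.asIdeal) :
    deg (torsionField K M 𝔞) ≤ (Submodule.cardQuot 𝔞 : ℝ) ^ (r * r) *
      ∏ v ∈ S, glDensity (Submodule.cardQuot v.asIdeal) r := by
  obtain ⟨e⟩ := hM 𝔞 h𝔞
  rw [Submodule.cardQuot_apply, ← card_GL_quotient h𝔞 r hS, ← card_linearEquiv_eq_card_GL e, deg]
  exact Nat.cast_le.2 (hM.finrank_torsionField_le hc h𝔞)

theorem HasTorsionRank.cardQuot_pow_le_ncard (hM : HasTorsionRank A M r)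
    (hc : IsContinuousOnTorsion K A M) {𝔞 : Ideal A} (h𝔞 : 𝔞 ≠ ⊥) {H : Set M}
    (hH : (idealTorsion A M 𝔞 : Set M) ⊆ H)
    (hfin : (rationalPoints H (torsionField K M 𝔞)).Finite) :
    (Submodule.cardQuot 𝔞 : ℝ) ^ r ≤ ((rationalPoints H (torsionField K M 𝔞)).ncard : ℝ) := by
  rw [← Nat.cast_pow, ← hM.card_idealTorsion h𝔞]
  exact Nat.cast_le.2 (Set.ncard_le_ncard ((hM.idealTorsion_subset_rationalPoints hc h𝔞).trans
    (rationalPoints_mono hH _)) hfin)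

/-- With `N = |A/𝔭^(n+1)|`, the torsion field has degree at most `N^(r²)` and at least `N^r`
rational points, so the constant `1` works. The upper bound `hup` provides finiteness and forces the
degrees to infinity. -/
theorem HasTorsionRank.exists_tower_idealPowerTorsion [Infinite A] (hr : 1 ≤ r)
    (hM : HasTorsionRank A M r) (hc : IsContinuousOnTorsion K A M) {𝔭 : Ideal A}
    (h𝔭 : 𝔭.IsPrime) (h0 : 𝔭 ≠ ⊥) {C : ℝ}
    (hup : ∀ L : IntermediateField K (AlgebraicClosure K), FiniteDimensional K L →
      (rationalPoints (idealPowerTorsion A M 𝔭) L).Finite ∧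
        ((rationalPoints (idealPowerTorsion A M 𝔭) L).ncard : ℝ) ≤ C * deg L ^ (1 / (r : ℝ))) :
    ∃ L : ℕ → IntermediateField K (AlgebraicClosure K), IsTower L ∧
      ∀ n, 1 * deg (L n) ^ (1 / (r : ℝ)) ≤
        ((rationalPoints (idealPowerTorsion A M 𝔭) (L n)).ncard : ℝ) := by
  have hne : ∀ n : ℕ, 𝔭 ^ (n + 1) ≠ ⊥ := fun n => pow_ne_zero _ h0
  have hfin : ∀ n : ℕ, FiniteDimensional K (torsionField K M (𝔭 ^ (n + 1))) := fun n =>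
    hM.finiteDimensional_torsionField hc (hne n)
  have hsub : ∀ n : ℕ, (idealTorsion A M (𝔭 ^ (n + 1)) : Set M) ⊆ idealPowerTorsion A M 𝔭 :=
    fun n y hy => ⟨n + 1, by omega, hy⟩
  have hlow : ∀ n : ℕ, (Submodule.cardQuot (𝔭 ^ (n + 1)) : ℝ) ^ r ≤ _ := fun n =>
    hM.cardQuot_pow_le_ncard hc (hne n) (hsub n) (hup _ (hfin n)).1
  refine ⟨fun n => torsionField K M (𝔭 ^ (n + 1)), isTower_of_tendsto
    (fun m n hmn => torsionField_mono (Ideal.pow_le_pow_right (by omega))) hfin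
    (tendsto_atTop_mono (fun n => ?_) tendsto_natCast_atTop_atTop)
    (fun d => C * d ^ (1 / (r : ℝ))) (fun n => (hlow n).trans (hup _ (hfin n)).2), fun n => ?_⟩
  · have h2 := HeightOneSpectrum.two_le_cardQuot (⟨𝔭, h𝔭, h0⟩ : HeightOneSpectrum A)
    rw [cardQuot_pow_of_infinite]
    have : n ≤ (Submodule.cardQuot 𝔭 ^ (n + 1)) ^ r := by
      rw [← pow_mul]
      calc n ≤ 2 ^ n := Nat.lt_two_pow_self.le
        _ ≤ 2 ^ ((n + 1) * r) := Nat.pow_le_pow_right (by norm_num) (by nlinarith)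
        _ ≤ _ := Nat.pow_le_pow_left h2 _
    exact_mod_cast this
  · rw [one_mul]
    refine le_trans (rpow_le_of_le_pow hr ?_ (by positivity) ?_) (hlow n)
    · exact Nat.cast_nonneg _
    · have hS : ∀ v : HeightOneSpectrum A, v ∈ (finite_heightOneSpectrum_ge (hne n)).toFinset ↔
          𝔭 ^ (n + 1) ≤ v.asIdeal := fun v => by simp
      refine (hM.deg_torsionField_le hc (hne n) hS).trans ?_
      rw [← pow_mul]
      exact mul_le_of_le_one_right (by positivity) (Finset.prod_le_one
        (fun v _ => (glDensity_pos (HeightOneSpectrum.two_le_cardQuot v) r).le)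
        fun v _ => glDensity_le_one (HeightOneSpectrum.two_le_cardQuot v) r)

omit [Ring.HasFiniteQuotients A] in
theorem HasTorsionRank.exists_tower_fullTorsion (hA : HasMertensBounds A)
    (hft : Algebra.FiniteType ℤ A) (hr : 1 ≤ r)
    (hM : HasTorsionRank A M r) (hc : IsContinuousOnTorsion K A M) {C : ℝ}
    (hup : ∀ L : IntermediateField K (AlgebraicClosure K), FiniteDimensional K L →
      (rationalPoints (fullTorsion A M) L).Finite ∧
        ((rationalPoints (fullTorsion A M) L).ncard : ℝ) ≤
          C * (deg L * logLog (deg L)) ^ (1 / (r : ℝ))) :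
    ∃ c : ℝ, 0 < c ∧ ∃ L : ℕ → IntermediateField K (AlgebraicClosure K), IsTower L ∧
      ∀ n, c * (deg (L n) * logLog (deg (L n))) ^ (1 / (r : ℝ)) ≤
        ((rationalPoints (fullTorsion A M) (L n)).ncard : ℝ) := by
  have := hA.hasFiniteQuotients
  obtain ⟨B, hB0, hB⟩ := hA.exists_mul_logLog_le hft hr
  have hne : ∀ n : ℕ, hA.primorial (n + 3) ≠ ⊥ := fun n => hA.primorial_ne_bot _
  have hfin : ∀ n : ℕ, FiniteDimensional K (torsionField K M (hA.primorial (n + 3))) := fun n =>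
    hM.finiteDimensional_torsionField hc (hne n)
  have hlow : ∀ n : ℕ, (Submodule.cardQuot (hA.primorial (n + 3)) : ℝ) ^ r ≤ _ := fun n =>
    hM.cardQuot_pow_le_ncard hc (hne n) (H := fullTorsion A M) (fun y hy => ⟨_, hne n, hy⟩)
      (hup _ (hfin n)).1
  refine ⟨(B ^ (1 / (r : ℝ)))⁻¹, by positivity, fun n => torsionField K M (hA.primorial (n + 3)),
    isTower_of_tendsto
    (fun m n hmn => torsionField_mono (hA.primorial_antitone (by omega))) hfin
    ((tendsto_pow_atTop (by omega : r ≠ 0)).comp (hA.tendsto_cardQuot_primorial hft))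
    (fun d => C * (d * logLog d) ^ (1 / (r : ℝ))) (fun n => (hlow n).trans (hup _ (hfin n)).2),
    fun n => ?_⟩
  have := hfin n
  have hd := one_le_deg (torsionField K M (hA.primorial (n + 3)))
  have h1 := hB (n + 3) _ (by omega) hd
    (hM.deg_torsionField_le hc (hne n) fun v => (hA.primorial_le_iff (n + 3) v).symm)
  set d := deg (torsionField K M (hA.primorial (n + 3)))
  have hll := logLog_pos d
  refine le_trans ?_ (hlow n)
  rw [inv_mul_le_iff₀ (by positivity)]
  calc (d * logLog d) ^ (1 / (r : ℝ))
      ≤ (B * ((Submodule.cardQuot (hA.primorial (n + 3)) : ℝ) ^ r) ^ r) ^ (1 / (r : ℝ)) := by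
        rw [← pow_mul]
        exact Real.rpow_le_rpow (by positivity) h1 (by positivity)
    _ = B ^ (1 / (r : ℝ)) *
        (((Submodule.cardQuot (hA.primorial (n + 3)) : ℝ) ^ r) ^ r) ^ (1 / (r : ℝ)) :=
        Real.mul_rpow hB0.le (by positivity)
    _ ≤ _ := by
      gcongr
      exact rpow_le_of_le_pow hr (by positivity) (by positivity) le_rfl

end LowerBound

theorem theorem2
    (A : Type u) [CommRing A] [IsDedekindDomain A]
    (k : Type v) [Field k] [Algebra A k] [IsFractionRing A k] (hk : IsGlobalField k)
    (K : Type w) [Field K] (hK : IsFinitelyGeneratedField K)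
    (r : ℕ) (hr : 1 ≤ r) :
    -- Part (I)
    (∀ Cp : ℝ, ∃ C : ℝ, 0 < C ∧
      ∀ (M : Type x) [AddCommGroup M] [Module A M] [DistribMulAction (AbsGal K) M]
        [SMulCommClass (AbsGal K) A M] (_ : HasTorsionRank A M r)
        (𝔭 : Ideal A) (_ : 𝔭.IsPrime) (_ : 𝔭 ≠ ⊥)
        (_ : ∀ n : ℕ, 1 ≤ n → (galoisIndex K A M (𝔭 ^ n) : ℝ) ≤ Cp),
        (∀ L : IntermediateField K (AlgebraicClosure K), FiniteDimensional K L →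
          (rationalPoints (idealPowerTorsion A M 𝔭) L).Finite ∧
          ((rationalPoints (idealPowerTorsion A M 𝔭) L).ncard : ℝ) ≤
            C * deg L ^ (1 / (r : ℝ))) ∧
        (IsContinuousOnTorsion K A M →
          ∃ c : ℝ, 0 < c ∧ ∃ L : ℕ → IntermediateField K (AlgebraicClosure K), IsTower L ∧
            ∀ n, c * deg (L n) ^ (1 / (r : ℝ)) ≤
              ((rationalPoints (idealPowerTorsion A M 𝔭) (L n)).ncard : ℝ))) ∧
    -- Part (II)
    (∀ C₀ : ℝ, ∃ C : ℝ, 0 < C ∧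
      ∀ (M : Type x) [AddCommGroup M] [Module A M] [DistribMulAction (AbsGal K) M]
        [SMulCommClass (AbsGal K) A M] (_ : HasTorsionRank A M r)
        (_ : ∀ 𝔞 : Ideal A, 𝔞 ≠ ⊥ → (galoisIndex K A M 𝔞 : ℝ) ≤ C₀),
        (∀ L : IntermediateField K (AlgebraicClosure K), FiniteDimensional K L →
          (rationalPoints (fullTorsion A M) L).Finite ∧
          ((rationalPoints (fullTorsion A M) L).ncard : ℝ) ≤
            C * (deg L * logLog (deg L)) ^ (1 / (r : ℝ))) ∧
        (IsContinuousOnTorsion K A M → Algebra.FiniteType ℤ A →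
          ∃ c : ℝ, 0 < c ∧ ∃ L : ℕ → IntermediateField K (AlgebraicClosure K), IsTower L ∧
            ∀ n, c * (deg (L n) * logLog (deg (L n))) ^ (1 / (r : ℝ)) ≤
              ((rationalPoints (fullTorsion A M) (L n)).ncard : ℝ))) := by
  have hA := IsGlobalField.hasMertensBounds A k hk
  have := hA.hasFiniteQuotients
  have := hA.infinite
  -- The maximum with `1` keeps the constant positive for every real `Cp`.
  refine ⟨fun Cp => ⟨(Real.exp (1 + 3 * r) * max Cp 1) ^ (1 / (r : ℝ)), by positivity, ?_⟩,
    fun C₀ => ?_⟩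
  · intro M _ _ _ _ hM 𝔭 h𝔭 h0 hI
    have hup := fun (L : IntermediateField K (AlgebraicClosure K)) (_ : FiniteDimensional K L) =>
      hM.ncard_rationalPoints_idealPowerTorsion_le (K := K) hr h𝔭 h0
        (zero_le_one.trans (le_max_right Cp 1)) (fun n hn => (hI n hn).trans (le_max_left _ _)) L
    exact ⟨hup, fun hc => ⟨1, one_pos, hM.exists_tower_idealPowerTorsion hr hc h𝔭 h0 hup⟩⟩
  · obtain ⟨C, hC0, hC⟩ := hA.exists_ncard_rationalPoints_fullTorsion_le (K := K) hr C₀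
    exact ⟨C, hC0, fun M _ _ _ _ hM hI => ⟨hC M hM hI, fun hc hft =>
      hM.exists_tower_fullTorsion hA hft hr hc (hC M hM hI)⟩⟩
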